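/- Let $\Omega\subset\mathbb R^d$ ($d\ge1$) be a bounded open set, $\Gamma_D\subseteq\partial\Omega$, and let $V$ be the space of complex-valued functions in $H^1(\Omega)$ whose trace vanishes on $\Gamma_D$: there are $\varphi_n\in C^\infty(\mathbb R^d)$ with $\varphi_n\to v$ in $H^1(\Omega)$ and $\varphi_n\to0$ in $L^2(\Gamma_D)$ for the $(d-1)$-dimensional Hausdorff measure. Let $$A(w,v)=\int_\Omega \nabla w\,\mathbf C\,(\overline{\nabla v})^T+(\mathbf a\cdot\nabla w)\overline v+r\,w\,\overline v\;dx$$ with complex-valued coefficients $\mathbf C,\mathbf a,r$ for which the integrand is integrable for all $w,v\in V$, and assume that, for some $c_0,c_1>0$ and all $v,w\in V$, $$\operatorname{Re}A(v,v)\ge c_0\|v\|_{H^1(\Omega)}^2,\qquad |A(w,v)|\le c_1\|w\|_{H^1(\Omega)}\|v\|_{H^1(\Omega)}.$$ Let $\beta\ge0$ be the index of $A$, i.e. the smallest number with $|\operatorname{Im}A(v,v)|\le\beta\operatorname{Re}A(v,v)$ for all $v\in V$. Let $V_h\subset V$ be a finite-dimensional subspace (for instance the continuous piecewise linear functions in $V$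 on a triangulation), and let $\mathcal A_h:V_h\to V_h$ be defined by $(\mathcal A_hw_h,v_h)_{L^2(\Omega)}=A(w_h,v_h)$ for all $w_h,v_h\in V_h$. For $0<\alpha<1$, let $\mathcal A_h^\alpha=\frac1{2\pi i}\oint z^\alpha(z-\mathcal A_h)^{-1}dz$ over any circle that surrounds the spectrum of $\mathcal A_h$ and bounds a closed disc disjoint from $(-\infty,0]$. For $b\ge1$, $f_h\in V_h$, $\tau>0$ and integers $M,N\ge0$ put $$u_h=(\mathcal A_h^\alpha+b)^{-1}f_h,\qquad U_{h,\tau}^{M,N}=\frac{\sin\pi\alpha}{\alpha\pi}\,\tau\sum_{n=-M}^{N}\frac{(1+e^{-n\tau/\alpha}\mathcal A_h)^{-1}f_h}{e^{n\tau}+2b\cos\pi\alpha+b^2e^{-n\tau}}.$$ Let $\kappa_1=\alpha(\pi-\arctan\beta)$, $\kappa_2=(1-\alpha)\pi$, $\kappa=\min(\kappa_1,\kappa_2)$, and $$C(\tau)=\begin{cases}\dfrac{1+|\ln\tau|}{\sin\left(\min\{\frac{\kappa_1-\kappa_2}{\alpha}+\frac{1-\alpha}{\alpha}\tau,\frac\pi2\}\right)},&\kappa_1>\kappa_2,\\[3mm]\dfrac{1+|\ln(\kappa_2-\kappa_1+\alpha\tau)|}{\sin\left(\min\{\tau,\frac\pi2\}\right)},&\kappa_1\le\kappa_2.\end{cases}$$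 Then there are constants $C(\alpha)$ and $c$ depending only on $\alpha$, and constants $c'$ and $C'$ depending only on $\alpha$ and $c_0$, such that for all $0<\tau<\pi-\arctan\beta$ and all integers $M,N\ge0$ (with $\|\cdot\|$ the $L^2(\Omega)$ norm) $$\|u_h-U_{h,\tau}^{M,N}\|\le\Big(\frac{C(\alpha)}{b}C(\tau)e^{-2\pi\kappa/\tau}+c\,e^{-N\tau}+c'\,b^{-2}e^{-(1+\alpha^{-1})M\tau}\Big)\|f_h\|.$$ Moreover, put $$M^*=\max\Big\{\frac{\alpha}{\alpha+1}\Big(\frac{2\pi\kappa}{\tau^2}-\frac{\ln b}{\tau}\Big),0\Big\},\qquad N^*=\frac{2\pi\kappa}{\tau^2}+\frac{\ln b}{\tau}.$$ If $M^*>0$ and $M,N$ are $M^*,N^*$ rounded to integers in either direction ($|M-M^*|\le1$, $|N-N^*|\le1$), then $$\|u_h-U_{h,\tau}^{M,N}\|\le\frac{C'\,C(\tau)}{b}\,e^{-\sqrt{\pi\kappa\,[(1+\alpha^{-1})M+N]}}\,\|f_h\|.$$ -/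

import Mathlib

open MeasureTheory Filter Topology
open scoped ENNReal ContDiff Real

noncomputable section

namespace FracDiff

/-! ### The space `V` of Sobolev functions vanishing on the Dirichlet part of the boundary -/

/-- Complex `L²(Ω)`, for `Ω ⊆ ℝᵈ`. -/
abbrev L2 {d : ℕ} (Ω : Set (EuclideanSpace ℝ (Fin d))) : Type :=
  Lp ℂ 2 (volume.restrict Ω)

/-- The partial derivative of a function on `ℝᵈ` in the `i`-th coordinate direction. -/
def partialDeriv {d : ℕ} (i : Fin d) (φ : EuclideanSpace ℝ (Fin d) → ℂ)
    (x : EuclideanSpace ℝ (Fin d)) : ℂ :=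
  fderiv ℝ φ x (EuclideanSpace.single i (1 : ℝ))

/-- `g` is the weak `i`-th partial derivative of `u` in `Ω`. -/
def IsWeakPartial {d : ℕ} (Ω : Set (EuclideanSpace ℝ (Fin d))) (i : Fin d) (u g : L2 Ω) : Prop :=
  ∀ φ : EuclideanSpace ℝ (Fin d) → ℂ, ContDiff ℝ ∞ φ → HasCompactSupport φ → tsupport φ ⊆ Ω →
    ∫ x in Ω, u x * partialDeriv i φ x = - ∫ x in Ω, g x * φ x

/-- Weak derivatives are unique, so that `weakPartial` below does not depend on a choice. -/
theorem IsWeakPartial.unique {d : ℕ} {Ω : Set (EuclideanSpace ℝ (Fin d))} (hΩ : IsOpen Ω)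
    {i : Fin d} {u g g' : L2 Ω} (hg : IsWeakPartial Ω i u g) (hg' : IsWeakPartial Ω i u g') :
    g = g' := by
  have hloc : LocallyIntegrableOn (fun x => g x - g' x) Ω (volume : Measure _) := by
    rw [locallyIntegrableOn_iff hΩ.isLocallyClosed]
    intro K hKΩ hK
    have hfin : IsFiniteMeasure ((volume : Measure (EuclideanSpace ℝ (Fin d))).restrict K) :=
      ⟨by simpa using hK.measure_lt_top⟩
    have h1 : MemLp (fun x => g x - g' x) 2 (volume.restrict K) :=
      ((Lp.memLp g).sub (Lp.memLp g')).mono_measure (Measure.restrict_mono hKΩ le_rfl)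
    exact h1.integrable (by norm_num)
  have key : ∀ᵐ x ∂volume, x ∈ Ω → g x - g' x = 0 := by
    refine hΩ.ae_eq_zero_of_integral_contDiff_smul_eq_zero hloc ?_
    intro ψ hψ hψc hψΩ
    have hsm : ContDiff ℝ ∞ (fun x => (ψ x : ℂ)) := Complex.ofRealCLM.contDiff.comp hψ
    have hcs : HasCompactSupport (fun x => (ψ x : ℂ)) :=
      hψc.comp_left (g := fun t : ℝ => (t : ℂ)) (by simp)
    have hsub : tsupport (fun x => (ψ x : ℂ)) ⊆ Ω := by
      refine subset_trans (closure_mono ?_) hψΩ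
      intro x hx
      simpa using hx
    have e := (hg _ hsm hcs hsub).symm.trans (hg' _ hsm hcs hsub)
    have hmem : MemLp (fun x => (ψ x : ℂ)) 2 (volume.restrict Ω) :=
      (hsm.continuous.memLp_of_hasCompactSupport hcs)
    have i1 : Integrable (fun x => g x * (ψ x : ℂ)) (volume.restrict Ω) :=
      (Lp.memLp g).integrable_mul hmem
    have i2 : Integrable (fun x => g' x * (ψ x : ℂ)) (volume.restrict Ω) :=
      (Lp.memLp g').integrable_mul hmem
    have h0 : ∫ x in Ω, ψ x • (g x - g' x) = 0 := by
      have : (fun x => ψ x • (g x - g' x)) = fun x => g x * (ψ x : ℂ) - g' x * (ψ x : ℂ) := by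
        funext x
        rw [Complex.real_smul]
        ring
      rw [this, integral_sub i1 i2, sub_eq_zero]
      exact neg_injective e
    rw [← h0]
    refine (setIntegral_eq_integral_of_forall_compl_eq_zero ?_).symm
    intro x hx
    have : ψ x = 0 := by
      by_contra hne
      exact hx (hψΩ (subset_tsupport _ hne))
    simp [this]
  refine Lp.ext ?_
  have := (ae_restrict_iff' hΩ.measurableSet).2 key
  filter_upwards [this] with x hx
  exact sub_eq_zero.1 hx

open Classical in
/-- The weak `i`-th partial derivative of `u` (used only for `u` in `H¹(Ω)`). -/
def weakPartial {d : ℕ} (Ω : Set (EuclideanSpace ℝ (Fin d))) (i : Fin d) (u : L2 Ω) : L2 Ω :=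
  if h : ∃ g : L2 Ω, IsWeakPartial Ω i u g then h.choose else 0

/-- `H¹(Ω)`. -/
def H1 {d : ℕ} (Ω : Set (EuclideanSpace ℝ (Fin d))) : Set (L2 Ω) :=
  {u | ∀ i, ∃ g : L2 Ω, IsWeakPartial Ω i u g}

/-- The square of the `H¹(Ω)` norm. -/
def h1NormSq {d : ℕ} (Ω : Set (EuclideanSpace ℝ (Fin d))) (u : L2 Ω) : ℝ :=
  ‖u‖ ^ 2 + ∑ i, ‖weakPartial Ω i u‖ ^ 2

/-- The functions in `H¹(Ω)` whose trace vanishes on `ΓD ⊆ ∂Ω`.  The trace of `u` is the limit in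
`L²` of the boundary (for the surface measure, that is, the `(d-1)`-dimensional Hausdorff measure)
of the boundary values of smooth functions that converge to `u` in `H¹(Ω)`. -/
def dirichletSpace {d : ℕ} (Ω ΓD : Set (EuclideanSpace ℝ (Fin d))) : Set (L2 Ω) :=
  {u | u ∈ H1 Ω ∧ ∃ φ : ℕ → EuclideanSpace ℝ (Fin d) → ℂ,
    (∀ n, ContDiff ℝ ∞ (φ n)) ∧
    Tendsto (fun n => ∫⁻ x in Ω, ‖φ n x - u x‖ₑ ^ 2) atTop (𝓝 0) ∧
    (∀ i, Tendsto (fun n => ∫⁻ x in Ω, ‖partialDeriv i (φ n) x - weakPartial Ω i u x‖ₑ ^ 2)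
      atTop (𝓝 0)) ∧
    Tendsto (fun n => ∫⁻ x in ΓD, ‖φ n x‖ₑ ^ 2 ∂(Measure.hausdorffMeasure ((d : ℝ) - 1)))
      atTop (𝓝 0)}

/-! ### The sesquilinear form and its discrete operator -/

/-- The integrand of the form with coefficients `C`, `a`, `r`. -/
def formIntegrand {d : ℕ} (Ω : Set (EuclideanSpace ℝ (Fin d)))
    (C : EuclideanSpace ℝ (Fin d) → Matrix (Fin d) (Fin d) ℂ)
    (a : EuclideanSpace ℝ (Fin d) → Fin d → ℂ) (r : EuclideanSpace ℝ (Fin d) → ℂ)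
    (w v : L2 Ω) (x : EuclideanSpace ℝ (Fin d)) : ℂ :=
  (∑ i, ∑ j, weakPartial Ω i w x * C x i j * star (weakPartial Ω j v x))
    + (∑ i, a x i * weakPartial Ω i w x) * star (v x)
    + r x * w x * star (v x)

/-- `A(w,v) = ∫_Ω (∇w C (conj ∇v)ᵀ + (a·∇w) conj v + r w conj v) dx`. -/
def form {d : ℕ} (Ω : Set (EuclideanSpace ℝ (Fin d)))
    (C : EuclideanSpace ℝ (Fin d) → Matrix (Fin d) (Fin d) ℂ)
    (a : EuclideanSpace ℝ (Fin d) → Fin d → ℂ) (r : EuclideanSpace ℝ (Fin d) → ℂ)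
    (w v : L2 Ω) : ℂ :=
  ∫ x in Ω, formIntegrand Ω C a r w v x

/-- `Re A(v,v) ≥ c₀ ‖v‖_V²` on `V`. -/
def IsStronglyElliptic {d : ℕ} {Ω : Set (EuclideanSpace ℝ (Fin d))} (V : Set (L2 Ω))
    (A : L2 Ω → L2 Ω → ℂ) (c₀ : ℝ) : Prop :=
  ∀ v ∈ V, c₀ * h1NormSq Ω v ≤ (A v v).re

/-- `|A(w,v)| ≤ c₁ ‖w‖_V ‖v‖_V` on `V`. -/
def IsContinuousForm {d : ℕ} {Ω : Set (EuclideanSpace ℝ (Fin d))} (V : Set (L2 Ω))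
    (A : L2 Ω → L2 Ω → ℂ) (c₁ : ℝ) : Prop :=
  ∀ w ∈ V, ∀ v ∈ V, ‖A w v‖ ≤ c₁ * √(h1NormSq Ω w) * √(h1NormSq Ω v)

/-- The index of the form `A` on `V`: the smallest `β ≥ 0` with
`|A_Im(v,v)| ≤ β A_Re(v,v)` on `V`, where `A_Re(v,v)` and `A_Im(v,v)` are the real and the
imaginary part of `A(v,v)`. -/
def formIndex {d : ℕ} {Ω : Set (EuclideanSpace ℝ (Fin d))} (V : Set (L2 Ω))
    (A : L2 Ω → L2 Ω → ℂ) : ℝ :=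
  sInf {β | 0 ≤ β ∧ ∀ v ∈ V, |(A v v).im| ≤ β * (A v v).re}

/-- `Ah : V_h → V_h` is the discrete counterpart of `A`: `(Ah w, v) = A(w, v)` on `V_h`, with the
`L²(Ω)` inner product, linear in its first argument (Mathlib's is linear in the second). -/
def IsDiscreteOperator {d : ℕ} {Ω : Set (EuclideanSpace ℝ (Fin d))} (A : L2 Ω → L2 Ω → ℂ)
    (Vh : Submodule ℂ (L2 Ω)) (Ah : Vh →L[ℂ] Vh) : Prop :=
  ∀ w v : Vh, inner ℂ v (Ah w) = A w v

/-! ### Fractional power, semidiscrete solution and quadrature -/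

/-- The circle with centre `z₀` and radius `R` surrounds the spectrum of `T` and, with its
interior, avoids the branch cut `(-∞, 0]` of `z ↦ z ^ α`. -/
def IsContourFor {X : Type*} [NormedAddCommGroup X] [NormedSpace ℂ X] (T : X →L[ℂ] X)
    (z₀ : ℂ) (R : ℝ) : Prop :=
  spectrum ℂ T ⊆ Metric.ball z₀ R ∧ Metric.closedBall z₀ R ⊆ Complex.slitPlane

/-- `T^α` by the Dunford-Taylor integral `(2πi)⁻¹ ∮ z^α (z - T)⁻¹ dz` over the circle with centre
`z₀` and radius `R`. -/
def fracPow {X : Type*} [NormedAddCommGroup X] [NormedSpace ℂ X] (α : ℝ) (T : X →L[ℂ] X)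
    (z₀ : ℂ) (R : ℝ) : X →L[ℂ] X :=
  (2 * (π : ℂ) * Complex.I)⁻¹ • ∮ z in C(z₀, R), z ^ (α : ℂ) • resolvent T z

/-- `u_h = (T^α + b)⁻¹ f`. -/
def semidiscrete {X : Type*} [NormedAddCommGroup X] [NormedSpace ℂ X] (α b : ℝ) (T : X →L[ℂ] X)
    (z₀ : ℂ) (R : ℝ) (f : X) : X :=
  Ring.inverse (fracPow α T z₀ R + (b : ℂ) • (1 : X →L[ℂ] X)) f

/-- The truncated trapezoidal sum
`U = (sin πα / (απ)) τ ∑_{n=-M}^N (1 + e^{-nτ/α} T)⁻¹ f / (e^{nτ} + 2b cos πα + b² e^{-nτ})`. -/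
def quadSum {X : Type*} [NormedAddCommGroup X] [NormedSpace ℂ X] (α b : ℝ) (T : X →L[ℂ] X)
    (f : X) (τ : ℝ) (M N : ℕ) : X :=
  ((Real.sin (π * α) / (α * π) * τ : ℝ) : ℂ) •
    ∑ n ∈ Finset.Icc (-(M : ℤ)) (N : ℤ),
      (((Real.exp (n * τ) + 2 * b * Real.cos (π * α) + b ^ 2 * Real.exp (-(n * τ)))⁻¹ : ℝ) : ℂ) •
        Ring.inverse (1 + ((Real.exp (-(n * τ) / α) : ℝ) : ℂ) • T) f

/-- `κ₁ = α (π - arctan β)`. -/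
def kappa₁ (α β : ℝ) : ℝ := α * (π - Real.arctan β)

/-- `κ₂ = (1 - α) π`. -/
def kappa₂ (α : ℝ) : ℝ := (1 - α) * π

/-- `min (κ₁, κ₂)`. -/
def kappaMin (α β : ℝ) : ℝ := min (kappa₁ α β) (kappa₂ α)

/-- The factor `C(τ)`; the inverses of the sines are reciprocals. -/
def quadFactor (α β τ : ℝ) : ℝ :=
  if kappa₂ α < kappa₁ α β then
    (Real.sin (min ((kappa₁ α β - kappa₂ α) / α + (1 - α) / α * τ) (π / 2)))⁻¹
      * (1 + |Real.log τ|)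
  else
    (Real.sin (min τ (π / 2)))⁻¹ * (1 + |Real.log (kappa₂ α - kappa₁ α β + α * τ)|)

/-- The (real) balanced value of `M`. -/
def balancedM (α β b τ : ℝ) : ℝ :=
  max (α / (α + 1) * (2 * π * kappaMin α β / τ ^ 2 - Real.log b / τ)) 0

/-- The (real) balanced value of `N`. -/
def balancedN (α β b τ : ℝ) : ℝ :=
  2 * π * kappaMin α β / τ ^ 2 + Real.log b / τ

end FracDiff

end

open FracDiff

open FracDiff

/-! ### Trapezoidal rule for functions analytic in a strip -/

/-! The estimate compares a trapezoidal sum with the integral it discretizes. For `T = A_h`, `(T^α +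
b)⁻¹` equals `sin(πα)/(απ)` times `∫ k(y) (1 + e^{-y/α} T)⁻¹ dy` over the real line, where `k(y) =
1/(e^y + 2b cos πα + b² e^{-y})` is `fracKernel`. The quadrature is the trapezoidal rule of step `τ`
for this integral, cut off at `-M` and `N`, so the error is that of the infinite sum plus two tails.

The representation is proved for scalars `z` in the slit plane by moving a contour
(`integral_fracKernel_mul`). It passes to `T` through the Dunford-Taylor calculus on the given
circle, which is multiplicative (`dunford_mul`) and commutes with the `y`-integral by Fubini; the
result is `inverse_fracPow_add`.

The infinite sum is handled by Poisson summation: if the integrand is analytic and decaying in `|Im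
z| ≤ d`, shifting each Fourier integral to `Im z = ±d` gives an error of order `e^{-2πd/τ}` times
the `L¹` norms on these lines (`norm_integral_sub_trapezoid_le`). The width is limited twice. The
kernel has poles at height `κ₂ = (1-α)π`, and its `L¹` norm on a line at distance `ε` below them
grows only like `(1 + |log ε|)/b`. The numerical range of `T` lies in the sector of half-angle
`arctan β`, which controls the resolvent for `|Im z| < κ₁ = α(π - arctan β)` by the reciprocal of a
sine. Taking `d` at most `τ` below `κ = min(κ₁, κ₂)` loses only the factor `e^{2π}` in the
exponential, and the logarithm and the sine become `C(τ)`.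

The tails are geometric. On the right the kernel is at most a multiple of `e^{-y}` and the resolvent
is a contraction. On the left the kernel is of size `b⁻² e^y`, and coercivity in `L²`, inherited
from coercivity in `H¹`, bounds the resolvent by `c₀⁻¹ e^{y/α}`. At `M*` and `N*` all three
exponential terms equal `e^{-2πκ/τ}/b` up to constants, and `(1 + 1/α)M* + N* = 4πκ/τ²` turns
`2πκ/τ` into the square root of the second bound. -/

theorem integrable_exp_neg_abs : Integrable (fun x : ℝ => Real.exp (-|x|)) := by
  rw [← integrableOn_univ, ← Set.Iic_union_Ioi (a := (0 : ℝ)), integrableOn_union]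
  constructor
  · refine (integrableOn_exp_Iic 0).congr_fun (fun x hx => ?_) measurableSet_Iic
    simp [abs_of_nonpos (Set.mem_Iic.1 hx)]
  · refine (exp_neg_integrableOn_Ioi 0 one_pos).congr_fun (fun x hx => ?_) measurableSet_Ioi
    simp [abs_of_pos (Set.mem_Ioi.1 hx)]

theorem integral_exp_neg_abs : ∫ x : ℝ, Real.exp (-|x|) = 2 := by
  rw [integral_comp_abs (f := fun x => Real.exp (-x)), integral_exp_neg_Ioi_zero, mul_one]

/-- A horizontal line of integration may be moved within a strip of analyticity. -/
theorem integral_eq_integral_add_mul_I {f : ℂ → ℂ} {y C : ℝ}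
    (hf : ∀ z : ℂ, z.im ∈ Set.uIcc 0 y → DifferentiableAt ℂ f z)
    (hb : ∀ z : ℂ, z.im ∈ Set.uIcc 0 y → ‖f z‖ ≤ C * Real.exp (-|z.re|)) :
    ∫ x : ℝ, f x = ∫ x : ℝ, f (x + y * Complex.I) := by
  have hint : ∀ t ∈ Set.uIcc 0 y, Integrable (fun x : ℝ => f (x + t * Complex.I)) := by
    intro t ht
    refine (integrable_exp_neg_abs.const_mul C).mono' ?_ ?_
    · refine Continuous.aestronglyMeasurable ?_
      refine continuous_iff_continuousAt.2 fun x => ?_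
      have h1 : ContinuousAt f (x + t * Complex.I) := (hf _ (by simpa using ht)).continuousAt
      exact ContinuousAt.comp (f := fun x : ℝ => (x + t * Complex.I : ℂ)) h1
        (by fun_prop)
    · refine Eventually.of_forall fun x => ?_
      simpa using hb (x + t * Complex.I) (by simpa using ht)
  have hint0 : Integrable (fun x : ℝ => f x) := by simpa using hint 0 Set.left_mem_uIcc
  have hT : Tendsto (fun L : ℝ => -L) atTop atBot := tendsto_neg_atTop_atBot
  have l1 := intervalIntegral_tendsto_integral hint0 hT tendsto_id
  have l2 := intervalIntegral_tendsto_integral (hint y Set.right_mem_uIcc) hT tendsto_id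
  -- The decay of `f` kills both vertical sides of the rectangle; `s` stands for `L` or `-L`.
  have side : ∀ s : ℝ → ℝ, (∀ L, |s L| = |L|) →
      Tendsto (fun L : ℝ => ∫ t : ℝ in (0 : ℝ)..y, f (s L + t * Complex.I)) atTop (𝓝 0) := by
    intro s hs
    rw [tendsto_zero_iff_norm_tendsto_zero]
    have hlim : Tendsto (fun L : ℝ => C * Real.exp (-L) * |y - 0|) atTop (𝓝 0) := by
      have := (Real.tendsto_exp_neg_atTop_nhds_zero.const_mul C).mul_const |y - 0|
      simpa using this
    refine squeeze_zero' (Eventually.of_forall fun _ => norm_nonneg _) ?_ hlim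
    filter_upwards [eventually_ge_atTop 0] with L hL
    refine intervalIntegral.norm_integral_le_of_norm_le_const fun t ht => ?_
    have ht' : t ∈ Set.uIcc 0 y := Set.uIoc_subset_uIcc ht
    have := hb (s L + t * Complex.I) (by simpa using ht')
    simpa [hs, abs_of_nonneg hL] using this
  have s1 := side (fun L => L) (fun _ => rfl)
  have s2 := side (fun L => -L) (fun L => abs_neg L)
  have key : ∀ L : ℝ, (∫ x : ℝ in -L..L, f x) - (∫ x : ℝ in -L..L, f (x + y * Complex.I))
      + Complex.I • (∫ t : ℝ in (0 : ℝ)..y, f (((L : ℝ) : ℂ) + t * Complex.I))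
      - Complex.I • (∫ t : ℝ in (0 : ℝ)..y, f (((-L : ℝ) : ℂ) + t * Complex.I)) = 0 := by
    intro L
    have := Complex.integral_boundary_rect_eq_zero_of_differentiableOn f ((-L : ℝ) : ℂ)
      (L + y * Complex.I) (fun z hz => by
        have := hz.2
        exact (hf z (by simpa using this)).differentiableWithinAt)
    simpa using this
  have lim := ((l1.sub l2).add (s1.const_smul Complex.I)).sub (s2.const_smul Complex.I)
  have := tendsto_nhds_unique (lim.congr fun L => by simpa using key L)
    (tendsto_const_nhds (x := (0 : ℂ)))
  simpa [sub_eq_zero] using this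

theorem hasSum_geometric_succ {r : ℝ} (h0 : 0 ≤ r) (h1 : r < 1) :
    HasSum (fun n : ℕ => r ^ (n + 1)) (r / (1 - r)) := by
  simpa [pow_succ', div_eq_mul_inv] using (hasSum_geometric_of_lt_one h0 h1).mul_left r

open scoped FourierTransform in
/-- Exponential convergence of the trapezoidal rule for functions analytic in a strip. -/
theorem norm_integral_sub_trapezoid_le {f : ℂ → ℂ} {d C τ : ℝ} (hd : 0 < d) (hτ : 0 < τ)
    (hf : ∀ z : ℂ, |z.im| ≤ d → DifferentiableAt ℂ f z)
    (hb : ∀ z : ℂ, |z.im| ≤ d → ‖f z‖ ≤ C * Real.exp (-|z.re|)) :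
    ‖(∫ x : ℝ, f x) - τ * ∑' n : ℤ, f (n * τ)‖ ≤
      ((∫ x : ℝ, ‖f (x + d * Complex.I)‖) + ∫ x : ℝ, ‖f (x - d * Complex.I)‖)
        * (Real.exp (-(2 * π * d / τ)) / (1 - Real.exp (-(2 * π * d / τ)))) := by
  set r : ℝ := Real.exp (-(2 * π * d / τ)) with hr
  have hr0 : 0 < r := Real.exp_pos _
  have hr1 : r < 1 := by
    rw [hr, Real.exp_lt_one_iff]
    have : 0 < 2 * π * d / τ := by positivity
    linarith
  have hC : 0 ≤ C := by
    have := (norm_nonneg _).trans (hb 0 (by simpa using hd.le))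
    simpa using this
  -- Rescaling moves the nodes `nτ` to the integers, where Poisson summation applies.
  set g : ℝ → ℂ := fun x => f (x * τ) with hg
  have hgc : Continuous g := by
    refine continuous_iff_continuousAt.2 fun x => ?_
    have h1 : ContinuousAt f ((x : ℂ) * τ) := (hf _ (by simpa using hd.le)).continuousAt
    exact ContinuousAt.comp (f := fun x : ℝ => ((x : ℂ) * τ)) h1 (by fun_prop)
  have hgO : g =O[cocompact ℝ] (fun x : ℝ => |x| ^ (-2 : ℝ)) := by
    have h1 : g =O[cocompact ℝ] (fun x : ℝ => Real.exp (-(τ * |x|))) := by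
      refine Asymptotics.IsBigO.of_bound C (Eventually.of_forall fun x => ?_)
      have := hb (x * τ) (by simpa using hd.le)
      simpa [hg, abs_mul, abs_of_pos hτ, mul_comm] using this
    refine h1.trans ?_
    have h2 : (fun x : ℝ => Real.exp (-τ * x)) =O[atTop] (fun x : ℝ => x ^ (-2 : ℝ)) :=
      (isLittleO_exp_neg_mul_rpow_atTop hτ (-2)).isBigO
    have h3 := h2.comp_tendsto (tendsto_norm_cocompact_atTop (E := ℝ))
    simpa [Function.comp_def] using h3
  have hFn : ∀ n : ℤ, 𝓕 g n = (τ : ℂ)⁻¹ * ∫ x : ℝ,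
      Complex.exp (-(2 * π * n / τ : ℝ) * x * Complex.I) * f x := by
    intro n
    rw [Real.fourier_real_eq_integral_exp_smul]
    have := Measure.integral_comp_mul_right
      (fun x : ℝ => Complex.exp (-(2 * π * n / τ : ℝ) * x * Complex.I) * f x) τ
    rw [abs_of_pos (inv_pos.2 hτ)] at this
    rw [← Complex.ofReal_inv, ← Complex.real_smul, ← this]
    refine integral_congr_ae (Eventually.of_forall fun x => ?_)
    have hτ' : (τ : ℂ) ≠ 0 := by exact_mod_cast hτ.ne'
    simp only [hg, smul_eq_mul]
    push_cast
    congr 2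
    field_simp
  have hnorm : ∀ (c : ℝ) (z : ℂ), ‖Complex.exp (-(c : ℝ) * z * Complex.I)‖
      = Real.exp (c * z.im) := by
    intro c z
    rw [Complex.norm_exp]
    simp
  -- On the line `Im z = y` the character has modulus `e^{2πny/τ}`, so taking the sign of `y`
  -- opposite to that of `n` gains `e^{-2π|n|d/τ}`.
  have hshift : ∀ (n : ℤ) (y : ℝ), |y| = d → ‖𝓕 g n‖ ≤ τ⁻¹ * (Real.exp (2 * π * n / τ * y) *
      ∫ x : ℝ, ‖f (x + y * Complex.I)‖) := by
    intro n y hy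
    have him : ∀ z : ℂ, z.im ∈ Set.uIcc 0 y → |z.im| ≤ d := by
      intro z hz
      have := Set.abs_sub_left_of_mem_uIcc hz
      rw [← hy]
      simpa using this
    rw [hFn, norm_mul, norm_inv, Complex.norm_real, Real.norm_of_nonneg hτ.le]
    refine mul_le_mul_of_nonneg_left ?_ (by positivity)
    rw [integral_eq_integral_add_mul_I
      (f := fun z => Complex.exp (-(2 * π * n / τ : ℝ) * z * Complex.I) * f z) (y := y)
      (C := Real.exp (|2 * π * n / τ| * d) * C)]
    · refine (norm_integral_le_integral_norm _).trans_eq ?_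
      rw [← integral_const_mul]
      congr 1
      ext x
      rw [norm_mul, hnorm]
      simp
    · intro z hz
      exact (by fun_prop : DifferentiableAt ℂ (fun z : ℂ =>
        Complex.exp (-(2 * π * n / τ : ℝ) * z * Complex.I)) z).mul (hf z (him z hz))
    · intro z hz
      rw [norm_mul, hnorm, mul_assoc (Real.exp _)]
      refine mul_le_mul (Real.exp_le_exp.2 ?_) (hb z (him z hz)) (norm_nonneg _) (by positivity)
      refine (le_abs_self _).trans ?_
      rw [abs_mul]
      exact mul_le_mul_of_nonneg_left (him z hz) (abs_nonneg _)
  set P := ∫ x : ℝ, ‖f (x + d * Complex.I)‖ with hP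
  set Q := ∫ x : ℝ, ‖f (x - d * Complex.I)‖ with hQ
  have hrpow : ∀ n : ℕ, Real.exp (-(2 * π * (n + 1) / τ * d)) = r ^ (n + 1) := by
    intro n
    rw [hr, ← Real.exp_nat_mul]
    push_cast
    congr 1
    ring
  have hpos : ∀ n : ℕ, ‖𝓕 g ((n : ℤ) + 1 : ℤ)‖ ≤ τ⁻¹ * Q * r ^ (n + 1) := by
    intro n
    have := hshift ((n : ℤ) + 1) (-d) (by rw [abs_neg, abs_of_pos hd])
    refine this.trans_eq ?_
    rw [← hrpow, hQ]
    push_cast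
    simp only [neg_mul, ← sub_eq_add_neg]
    rw [mul_neg]
    ring
  have hneg : ∀ n : ℕ, ‖𝓕 g (-((n : ℤ) + 1) : ℤ)‖ ≤ τ⁻¹ * P * r ^ (n + 1) := by
    intro n
    have := hshift (-((n : ℤ) + 1)) d (abs_of_pos hd)
    refine this.trans_eq ?_
    rw [← hrpow, hP]
    push_cast
    rw [show 2 * π * -((n : ℝ) + 1) / τ * d = -(2 * π * (n + 1) / τ * d) by ring]
    ring
  have hgs := hasSum_geometric_succ hr0.le hr1
  have sp := Summable.of_norm_bounded (hgs.summable.mul_left (τ⁻¹ * Q)) hpos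
  have sn := Summable.of_norm_bounded (hgs.summable.mul_left (τ⁻¹ * P)) hneg
  have sp0 : Summable (fun n : ℕ => 𝓕 g ((n : ℤ) : ℤ)) :=
    (summable_nat_add_iff 1).1 (by simpa using sp)
  have hsum : Summable (fun n : ℤ => 𝓕 g n) := by
    refine Summable.of_nat_of_neg_add_one (by simpa using sp0) (by simpa using sn)
  have hpois := Real.tsum_eq_tsum_fourier_of_rpow_decay_of_summable hgc one_lt_two hgO hsum 0
  have e1 : ∑' n : ℤ, f (n * τ) = ∑' n : ℤ, 𝓕 g n := by
    simpa [hg] using hpois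
  have e2 : ∑' n : ℤ, 𝓕 g n = 𝓕 g 0 + (∑' n : ℕ, 𝓕 g ((n : ℤ) + 1 : ℤ))
      + ∑' n : ℕ, 𝓕 g (-((n : ℤ) + 1) : ℤ) := by
    rw [tsum_of_nat_of_neg_add_one (f := fun n : ℤ => 𝓕 g n) (by simpa using sp0)
      (by simpa using sn), sp0.tsum_eq_zero_add]
    simp
  have e3 : 𝓕 g 0 = (τ : ℂ)⁻¹ * ∫ x : ℝ, f x := by
    have := hFn 0
    simpa using this
  have hτ' : (τ : ℂ) ≠ 0 := by exact_mod_cast hτ.ne'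
  rw [e1, e2, e3]
  -- The zeroth Fourier coefficient reproduces the integral, so only the nonzero frequencies remain
  -- in the error.
  have e4 : (∫ x : ℝ, f x) - τ * ((τ : ℂ)⁻¹ * (∫ x : ℝ, f x)
      + (∑' n : ℕ, 𝓕 g ((n : ℤ) + 1 : ℤ)) + ∑' n : ℕ, 𝓕 g (-((n : ℤ) + 1) : ℤ))
      = -(τ * ((∑' n : ℕ, 𝓕 g ((n : ℤ) + 1 : ℤ)) + ∑' n : ℕ, 𝓕 g (-((n : ℤ) + 1) : ℤ))) := by
    field_simp
    ring
  rw [e4, norm_neg, norm_mul, Complex.norm_real, Real.norm_of_nonneg hτ.le]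
  have b1 := tsum_of_norm_bounded (hgs.mul_left (τ⁻¹ * Q)) hpos
  have b2 := tsum_of_norm_bounded (hgs.mul_left (τ⁻¹ * P)) hneg
  calc _ ≤ τ * (τ⁻¹ * Q * (r / (1 - r)) + τ⁻¹ * P * (r / (1 - r))) := by
        refine mul_le_mul_of_nonneg_left ((norm_add_le _ _).trans (add_le_add b1 b2)) hτ.le
    _ = _ := by field_simp; ring

/-! ### The kernel of the integral representation -/

/-- The reciprocal of `e^z + 2 b cos(πα) + b² e^{-z}`. -/
noncomputable def fracKernel (α b : ℝ) (z : ℂ) : ℂ :=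
  (Complex.exp z + 2 * b * Real.cos (π * α) + b ^ 2 * Complex.exp (-z))⁻¹

theorem fracKernel_ofReal (α b y : ℝ) : fracKernel α b y =
    ((Real.exp y + 2 * b * Real.cos (π * α) + b ^ 2 * Real.exp (-y))⁻¹ : ℝ) := by
  simp [fracKernel]

theorem abs_cos_pi_mul_lt_one {α : ℝ} (h0 : 0 < α) (h1 : α < 1) :
    |Real.cos (π * α)| < 1 := by
  have hs : 0 < Real.sin (π * α) :=
    Real.sin_pos_of_pos_of_lt_pi (by positivity) (by nlinarith [Real.pi_pos])
  rw [abs_lt]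
  constructor <;> nlinarith [Real.sin_sq_add_cos_sq (π * α)]

/-- By `(e^y - b)² ≥ 0`, `2b` is at most `e^y + b² e^{-y}`; the cosine term can therefore remove at
most the fraction `|cos πα|` of that sum. -/
theorem fracKernel_denom_ge {α b : ℝ} (hb : 1 ≤ b) (y : ℝ) :
    (1 - |Real.cos (π * α)|) * (Real.exp y + b ^ 2 * Real.exp (-y)) ≤
      Real.exp y + 2 * b * Real.cos (π * α) + b ^ 2 * Real.exp (-y) := by
  have h1 : Real.exp y * Real.exp (-y) = 1 := by rw [← Real.exp_add]; simp
  have h2 : 0 ≤ Real.exp y - 2 * b + b ^ 2 * Real.exp (-y) := by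
    have h3 : 0 ≤ (Real.exp y - b) ^ 2 * Real.exp (-y) := by positivity
    linear_combination h3 + (Real.exp y - 2 * b) * h1
  have h3 := neg_abs_le (Real.cos (π * α))
  nlinarith [abs_nonneg (Real.cos (π * α)), mul_nonneg (abs_nonneg (Real.cos (π * α))) h2]

theorem norm_fracKernel_ofReal_le {α b : ℝ} (h0 : 0 < α) (h1 : α < 1) (hb : 1 ≤ b) (y : ℝ) :
    ‖fracKernel α b y‖ ≤
      (1 - |Real.cos (π * α)|)⁻¹ * (Real.exp y + b ^ 2 * Real.exp (-y))⁻¹ := by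
  have hc := abs_cos_pi_mul_lt_one h0 h1
  have hpos : 0 < (1 - |Real.cos (π * α)|) * (Real.exp y + b ^ 2 * Real.exp (-y)) :=
    mul_pos (by linarith) (by positivity)
  rw [fracKernel_ofReal, Complex.norm_real, Real.norm_of_nonneg
    (inv_nonneg.2 (hpos.le.trans (fracKernel_denom_ge hb y))), ← mul_inv]
  exact inv_anti₀ hpos (fracKernel_denom_ge hb y)

theorem norm_fracKernel_ofReal_le_exp {α b : ℝ} (h0 : 0 < α) (h1 : α < 1) (hb : 1 ≤ b) (y : ℝ) :
    ‖fracKernel α b y‖ ≤ (1 - |Real.cos (π * α)|)⁻¹ * Real.exp (-|y|) := by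
  have hc := abs_cos_pi_mul_lt_one h0 h1
  refine (norm_fracKernel_ofReal_le h0 h1 hb y).trans
    (mul_le_mul_of_nonneg_left ?_ (inv_nonneg.2 (by linarith)))
  rw [Real.exp_neg |y|]
  refine inv_anti₀ (Real.exp_pos _) ?_
  have hb2 : 1 ≤ b ^ 2 := one_le_pow₀ hb
  rcases abs_cases y with ⟨h, -⟩ | ⟨h, -⟩ <;> rw [h]
  · have : 0 ≤ b ^ 2 * Real.exp (-y) := by positivity
    linarith
  · nlinarith [Real.exp_pos (-y), Real.exp_pos y]

theorem continuous_fracKernel_ofReal {α b : ℝ} (h0 : 0 < α) (h1 : α < 1) (hb : 1 ≤ b) :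
    Continuous fun y : ℝ => fracKernel α b y := by
  have hc := abs_cos_pi_mul_lt_one h0 h1
  simp only [fracKernel_ofReal]
  refine Complex.continuous_ofReal.comp (Continuous.inv₀ (by fun_prop) fun y => ?_)
  exact ((mul_pos (by linarith) (by positivity)).trans_le (fracKernel_denom_ge hb y)).ne'

/-! ### The scalar integral representation -/

/-- The lower bound is `cos²(θ/2)` with `θ = arg z`, uniform in `t`. With `s = t|z|`, `|1 + tz|² =
sin²(θ/2)(1-s)² + cos²(θ/2)(1+s)²`, which is at least `cos²(θ/2)`; since this number is at most `1`,
it also bounds the unsquared modulus. -/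
theorem norm_one_add_mul_ge {z : ℂ} (hz : z ≠ 0) {t : ℝ} (ht : 0 ≤ t) :
    (‖z‖ + z.re) / (2 * ‖z‖) ≤ ‖1 + t * z‖ := by
  have hn : 0 < ‖z‖ := norm_pos_iff.2 hz
  have hre := abs_le.1 (Complex.abs_re_le_norm z)
  have h1 : (‖z‖ + z.re) / (2 * ‖z‖) ≤ 1 := by
    rw [div_le_one (by positivity)]; linarith
  have hsq : ‖1 + t * z‖ ^ 2 = 1 + 2 * t * z.re + t ^ 2 * ‖z‖ ^ 2 := by
    rw [← Complex.normSq_eq_norm_sq, ← Complex.normSq_eq_norm_sq, Complex.normSq_apply,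
      Complex.normSq_apply]
    simp
    ring
  have h2 : (‖z‖ + z.re) / (2 * ‖z‖) ≤ ‖1 + t * z‖ ^ 2 := by
    rw [hsq, div_le_iff₀ (by positivity)]
    nlinarith [mul_nonneg (sub_nonneg.2 hre.2) (sq_nonneg (1 - t * ‖z‖)),
      mul_nonneg (by linarith : 0 ≤ ‖z‖ + z.re)
        (by positivity : 0 ≤ 2 * (t * ‖z‖) + (t * ‖z‖) ^ 2)]
  by_contra! h
  nlinarith [norm_nonneg (1 + t * z)]

theorem norm_add_re_pos {z : ℂ} (hz : z ∈ Complex.slitPlane) : 0 < ‖z‖ + z.re := by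
  have hre := abs_le.1 (Complex.abs_re_le_norm z)
  rcases hz with h | h
  · linarith [norm_nonneg z]
  · refine lt_of_le_of_ne (by linarith) fun h0 => h ?_
    have h1 : ‖z‖ ^ 2 = z.re ^ 2 + z.im ^ 2 := by
      rw [← Complex.normSq_eq_norm_sq, Complex.normSq_apply]; ring
    rw [show ‖z‖ = -z.re by linarith] at h1
    nlinarith

theorem one_add_mul_ne_zero {z : ℂ} (hz : z ∈ Complex.slitPlane) {t : ℝ} (ht : 0 ≤ t) :
    1 + t * z ≠ 0 := by
  have hz0 := Complex.slitPlane_ne_zero hz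
  rw [← norm_pos_iff]
  refine lt_of_lt_of_le ?_ (norm_one_add_mul_ge hz0 ht)
  exact div_pos (norm_add_re_pos hz) (by have := norm_pos_iff.2 hz0; positivity)

/-- Used for the vertical sides of a rectangle receding to infinity, when the integrand has a
possibly nonzero limit there. -/
theorem tendsto_integral_vertical {Q : ℂ → ℂ} {a b : ℝ} {l : Filter ℝ} {c : ℂ}
    (hc : ∀ x : ℝ, ∀ t ∈ Set.uIcc a b, ContinuousAt Q (x + t * Complex.I))
    (hQ : Tendsto Q (comap Complex.re l) (𝓝 c)) :
    Tendsto (fun L : ℝ => ∫ t : ℝ in a..b, Q (L + t * Complex.I)) l (𝓝 ((b - a) * c)) := by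
  have hi : ∀ L : ℝ, IntervalIntegrable (fun t : ℝ => Q (L + t * Complex.I)) volume a b := by
    intro L
    refine ContinuousOn.intervalIntegrable fun t ht => ContinuousAt.continuousWithinAt ?_
    exact ContinuousAt.comp (f := fun t : ℝ => (L + t * Complex.I : ℂ)) (hc L t ht) (by fun_prop)
  have hconst : ((b - a : ℝ) : ℂ) * c = ∫ _ in a..b, c := by simp
  rw [← Complex.ofReal_sub, hconst, Metric.tendsto_nhds]
  intro ε hε
  have hε' : 0 < ε / (|b - a| + 1) := by positivity
  have h1 := Metric.tendsto_nhds.1 hQ _ hε'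
  rw [eventually_comap] at h1
  filter_upwards [h1] with L hL
  rw [dist_eq_norm, ← intervalIntegral.integral_sub (hi L) (by simp)]
  refine (intervalIntegral.norm_integral_le_of_norm_le_const (C := ε / (|b - a| + 1))
    fun t _ => ?_).trans_lt ?_
  · have := hL (L + t * Complex.I) (by simp)
    rw [dist_eq_norm] at this
    exact this.le
  · rw [div_mul_eq_mul_div, div_lt_iff₀ (by positivity)]
    nlinarith [abs_nonneg (b - a)]

/-- A zero would make `e^{-s}` a negative real, which has argument `π`, while `-Im s` stays strictly
inside `(-π, π)`. -/
theorem one_add_mul_exp_neg_ne_zero {b : ℝ} (hb : 0 < b) {s : ℂ} (hs : |s.im| < π) :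
    1 + b * Complex.exp (-s) ≠ 0 := by
  intro h
  rw [abs_lt] at hs
  have h1 : Complex.exp (-s) = ((-b⁻¹ : ℝ) : ℂ) := by
    have hb' : (b : ℂ) ≠ 0 := by exact_mod_cast hb.ne'
    push_cast
    field_simp
    linear_combination h
  have h2 := Complex.log_exp (x := -s) (by simpa using hs.2) (by
    simp only [Complex.neg_im]; linarith)
  rw [h1] at h2
  have h3 := congrArg Complex.im h2
  rw [Complex.log_im, Complex.arg_ofReal_of_neg (by simpa using hb)] at h3
  simp only [Complex.neg_im] at h3
  linarith

/-- The roots are `α (log z + 2πin)`. Since `|arg z| < π`, only `n = 0` fits into the strip,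
boundary included. -/
theorem one_sub_exp_mul_eq_zero {α : ℝ} (hα : 0 < α) {z s : ℂ} (hz : z ∈ Complex.slitPlane)
    (hs : |s.im| ≤ π * α) (h : 1 - Complex.exp (-s / α) * z = 0) : s = α * Complex.log z := by
  have hz0 := Complex.slitPlane_ne_zero hz
  have hα' : (α : ℂ) ≠ 0 := by exact_mod_cast hα.ne'
  have h1 : Complex.exp (s / α) = Complex.exp (Complex.log z) := by
    rw [Complex.exp_log hz0]
    have h2 : Complex.exp (s / α) * Complex.exp (-s / α) = 1 := by
      rw [← Complex.exp_add]; simp [neg_div]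
    linear_combination z * h2 + Complex.exp (s / α) * h
  obtain ⟨n, hn⟩ := Complex.exp_eq_exp_iff_exists_int.1 h1
  have harg : |z.arg| < π := by
    rw [abs_lt]
    exact ⟨Complex.neg_pi_lt_arg z,
      (Complex.arg_le_pi z).lt_of_ne (Complex.mem_slitPlane_iff_arg.1 hz).1⟩
  have him : s.im / α = z.arg + n * (2 * π) := by
    have := congrArg Complex.im hn
    simpa [Complex.div_ofReal_im, Complex.log_im] using this
  have h3 : |s.im / α| ≤ π := by
    rw [abs_div, abs_of_pos hα, div_le_iff₀ hα]
    exact hs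
  rw [him] at h3
  rw [abs_le] at h3
  rw [abs_lt] at harg
  have hn0 : n = 0 := by
    have h4 : (n : ℝ) < 1 := by nlinarith [Real.pi_pos]
    have h5 : (-1 : ℝ) < n := by nlinarith [Real.pi_pos]
    have h6 : n < 1 := by exact_mod_cast h4
    have h7 : -1 < n := by exact_mod_cast h5
    omega
  rw [hn0] at hn
  field_simp at hn
  simpa [mul_comm] using hn

theorem integrable_fracKernel_mul {α b : ℝ} (h0 : 0 < α) (h1 : α < 1) (hb : 1 ≤ b) {z : ℂ}
    (hz : z ∈ Complex.slitPlane) :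
    Integrable fun y : ℝ => fracKernel α b y * (1 + Real.exp (-y / α) * z)⁻¹ := by
  have hz0 := Complex.slitPlane_ne_zero hz
  have hm : 0 < (‖z‖ + z.re) / (2 * ‖z‖) :=
    div_pos (norm_add_re_pos hz) (by have := norm_pos_iff.2 hz0; positivity)
  refine ((integrable_exp_neg_abs.const_mul (1 - |Real.cos (π * α)|)⁻¹).mul_const
    ((‖z‖ + z.re) / (2 * ‖z‖))⁻¹).mono' ?_ (Eventually.of_forall fun y => ?_)
  · refine Continuous.aestronglyMeasurable ((continuous_fracKernel_ofReal h0 h1 hb).mul ?_)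
    exact Continuous.inv₀ (by fun_prop) fun y => one_add_mul_ne_zero hz (Real.exp_pos _).le
  · rw [norm_mul, norm_inv]
    exact mul_le_mul (norm_fracKernel_ofReal_le_exp h0 h1 hb y)
      (inv_anti₀ hm (norm_one_add_mul_ge hz0 (Real.exp_pos _).le)) (by positivity)
      ((norm_nonneg _).trans (norm_fracKernel_ofReal_le_exp h0 h1 hb y))

theorem tendsto_neg_comap_re_atTop :
    Tendsto (fun s : ℂ => -s) (comap Complex.re atTop) (comap Complex.re atBot) := by
  rw [tendsto_comap_iff]
  exact (tendsto_neg_atTop_atBot.comp tendsto_comap).congr fun s => by simp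

theorem tendsto_neg_comap_re_atBot :
    Tendsto (fun s : ℂ => -s) (comap Complex.re atBot) (comap Complex.re atTop) := by
  rw [tendsto_comap_iff]
  exact (tendsto_neg_atBot_atTop.comp tendsto_comap).congr fun s => by simp

theorem tendsto_neg_div_comap_re_atTop {α : ℝ} (hα : 0 < α) :
    Tendsto (fun s : ℂ => -s / α) (comap Complex.re atTop) (comap Complex.re atBot) := by
  rw [tendsto_comap_iff]
  refine ((tendsto_neg_atTop_atBot.comp tendsto_comap).atBot_div_const hα).congr fun s => ?_
  simp [Complex.div_ofReal_re]

theorem tendsto_neg_div_comap_re_atBot {α : ℝ} (hα : 0 < α) :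
    Tendsto (fun s : ℂ => -s / α) (comap Complex.re atBot) (comap Complex.re atTop) := by
  rw [tendsto_comap_iff]
  refine ((tendsto_neg_atBot_atTop.comp tendsto_comap).atTop_div_const hα).congr fun s => ?_
  simp [Complex.div_ofReal_re]

/-- The kernel is the jump of `1/(1 + b e^{-s})` between the lines `Im s = ±πα`: the two
denominators are conjugate, and their product times `e^x` is the denominator of the kernel. This
makes the real integral a contour integral over the boundary of a strip. -/
theorem fracKernel_eq_sub {α b : ℝ} (h0 : 0 < α) (h1 : α < 1) (hb : 1 ≤ b) (x : ℝ) :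
    (1 + b * Complex.exp (-(x + (π * α : ℝ) * Complex.I)))⁻¹
      - (1 + b * Complex.exp (-(x + (-(π * α) : ℝ) * Complex.I)))⁻¹
      = 2 * b * Real.sin (π * α) * Complex.I * fracKernel α b x := by
  have hb0 : 0 < b := by linarith
  have him : |π * α| < π := by
    rw [abs_of_pos (by positivity)]; nlinarith [Real.pi_pos]
  have n1 := one_add_mul_exp_neg_ne_zero hb0 (s := x + (π * α : ℝ) * Complex.I) (by simpa using him)
  have n2 := one_add_mul_exp_neg_ne_zero hb0 (s := x + (-(π * α) : ℝ) * Complex.I)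
    (by simpa using him)
  have hq : Complex.exp (x : ℂ) * Complex.exp (-x : ℂ) = 1 := by rw [← Complex.exp_add]; simp
  have e : ∀ θ : ℝ, Complex.exp (-(x + θ * Complex.I))
      = Complex.exp (-x : ℂ) * (Real.cos θ - Real.sin θ * Complex.I) := by
    intro θ
    rw [show -((x : ℂ) + θ * Complex.I) = -x + ((-θ : ℝ) : ℂ) * Complex.I by push_cast; ring,
      Complex.exp_add, Complex.exp_mul_I, ← Complex.ofReal_cos, ← Complex.ofReal_sin,
      Real.cos_neg, Real.sin_neg]
    push_cast
    ring
  have e1 := e (π * α)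
  have e2 : Complex.exp (-(x + (-(π * α) : ℝ) * Complex.I))
      = Complex.exp (-x : ℂ) * (Real.cos (π * α) + Real.sin (π * α) * Complex.I) := by
    rw [e, Real.cos_neg, Real.sin_neg]
    push_cast
    ring
  rw [e1] at n1 ⊢
  rw [e2] at n2 ⊢
  have hcs : (Real.sin (π * α) : ℂ) ^ 2 + (Real.cos (π * α) : ℂ) ^ 2 = 1 := by
    exact_mod_cast Real.sin_sq_add_cos_sq (π * α)
  have hden : (Complex.exp x + 2 * b * Real.cos (π * α) + b ^ 2 * Complex.exp (-x))
      = Complex.exp x *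
        ((1 + b * (Complex.exp (-x : ℂ) * (Real.cos (π * α) - Real.sin (π * α) * Complex.I)))
        * (1 + b * (Complex.exp (-x : ℂ) * (Real.cos (π * α) + Real.sin (π * α) * Complex.I)))) := by
    linear_combination (-(2 * b * Real.cos (π * α)) - b ^ 2 * Complex.exp (-x)) * hq
      - b ^ 2 * Complex.exp x * Complex.exp (-x) ^ 2 * hcs
      + b ^ 2 * Complex.exp x * Complex.exp (-x) ^ 2 * (Real.sin (π * α) : ℂ) ^ 2 * Complex.I_sq
  rw [fracKernel, hden]
  rw [inv_sub_inv n1 n2, mul_inv, mul_inv, div_eq_mul_inv, mul_inv]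
  have hpi : (Complex.exp (x : ℂ))⁻¹ = Complex.exp (-x : ℂ) := (Complex.exp_neg _).symm
  rw [hpi]
  ring

/-- The scalar function `z ↦ (z^α + b)⁻¹` as an integral of resolvents. -/
theorem integral_fracKernel_mul {α b : ℝ} (h0 : 0 < α) (h1 : α < 1) (hb : 1 ≤ b) {z : ℂ}
    (hz : z ∈ Complex.slitPlane) :
    (Real.sin (π * α) / (α * π) : ℝ) *
      ∫ y : ℝ, fracKernel α b y * (1 + Real.exp (-y / α) * z)⁻¹ = (z ^ (α : ℂ) + b)⁻¹ := by
  have hb0 : 0 < b := by linarith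
  have hz0 := Complex.slitPlane_ne_zero hz
  have hα' : (α : ℂ) ≠ 0 := by exact_mod_cast h0.ne'
  have hπα : π * α < π := by nlinarith [Real.pi_pos]
  have hπα0 : 0 < π * α := by positivity
  set s₀ : ℂ := α * Complex.log z with hs₀
  have hs₀im : |s₀.im| < π * α := by
    have harg : |z.arg| < π := by
      rw [abs_lt]
      exact ⟨Complex.neg_pi_lt_arg z,
        (Complex.arg_le_pi z).lt_of_ne (Complex.mem_slitPlane_iff_arg.1 hz).1⟩
    rw [hs₀, Complex.im_ofReal_mul, Complex.log_im, abs_mul, abs_of_pos h0, mul_comm π]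
    exact mul_lt_mul_of_pos_left harg h0
  set H : ℂ → ℂ := fun s => (1 + b * Complex.exp (-s))⁻¹ with hH
  set E : ℂ → ℂ := fun s => 1 - Complex.exp (-s / α) * z with hE
  have hHd : DifferentiableOn ℂ H {s | |s.im| < π} := fun s hs =>
    ((by fun_prop : DifferentiableAt ℂ (fun s : ℂ => 1 + b * Complex.exp (-s)) s).inv
      (one_add_mul_exp_neg_ne_zero hb0 hs)).differentiableWithinAt
  have hopen : IsOpen {s : ℂ | |s.im| < π} :=
    isOpen_lt (by fun_prop) continuous_const
  have hEd : Differentiable ℂ E := by fun_prop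
  have hE0 : E s₀ = 0 := by
    have : -s₀ / α = -Complex.log z := by rw [hs₀]; field_simp
    simp only [hE, this, Complex.exp_neg, Complex.exp_log hz0, inv_mul_cancel₀ hz0, sub_self]
  have hE0' : deriv E s₀ = (α : ℂ)⁻¹ := by
    have hd : HasDerivAt E (0 - Complex.exp (-s₀ / α) * (-1 / α) * z) s₀ := by
      refine (hasDerivAt_const _ _).sub ?_
      exact ((((hasDerivAt_id s₀).neg).div_const (α : ℂ)).cexp).mul_const z
    rw [hd.deriv]
    have h3 : Complex.exp (-s₀ / α) * z = 1 := by
      have := hE0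
      simp only [hE] at this
      linear_combination -this
    linear_combination (α : ℂ)⁻¹ * h3
  -- `Q` is `(H - H s₀)/E` with its singularity at `s₀` filled in: subtracting `H s₀` cancels the
  -- simple zero of `E`, so Cauchy's theorem applies without residues. On `Im s = ±πα`, `e^{-s/α} =
  -- -e^{-x/α}`, so `E` takes the same value `1 + e^{-x/α} z` on both lines and the subtracted
  -- constant drops out of the jump.
  set Q : ℂ → ℂ := fun s => dslope H s₀ s / dslope E s₀ s with hQ
  have hQne : ∀ s, s ≠ s₀ → Q s = (H s - H s₀) / E s := by
    intro s hs
    simp only [hQ, dslope_of_ne _ hs, slope_def_field, hE0, sub_zero]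
    rw [div_div_div_cancel_right₀ (sub_ne_zero.2 hs)]
  have hQd : ∀ s : ℂ, |s.im| ≤ π * α → DifferentiableAt ℂ Q s := by
    intro s hs
    have hsπ : s ∈ {s : ℂ | |s.im| < π} := hs.trans_lt hπα
    have d1 : DifferentiableAt ℂ (dslope H s₀) s :=
      ((Complex.differentiableOn_dslope (hopen.mem_nhds (hs₀im.trans hπα))).2 hHd).differentiableAt
        (hopen.mem_nhds hsπ)
    have d2 : DifferentiableAt ℂ (dslope E s₀) s :=
      ((Complex.differentiableOn_dslope univ_mem).2 hEd.differentiableOn).differentiableAt univ_mem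
    refine d1.div d2 ?_
    by_cases hss : s = s₀
    · rw [hss, dslope_same, hE0']
      exact inv_ne_zero hα'
    · rw [dslope_of_ne _ hss, slope_def_field, hE0, sub_zero]
      exact div_ne_zero (fun h => hss (one_sub_exp_mul_eq_zero h0 hz hs h)) (sub_ne_zero.2 hss)
  have hline : ∀ y : ℝ, |y| = π * α → ∀ x : ℝ,
      Q (x + y * Complex.I) = (H (x + y * Complex.I) - H s₀) * (1 + Real.exp (-x / α) * z)⁻¹ := by
    intro y hy x
    rw [hQne, div_eq_mul_inv]
    · congr 2
      have : Complex.exp (-(x + y * Complex.I) / α) = - (Real.exp (-x / α) : ℂ) := by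
        have : -(x + y * Complex.I) / α = (-x / α : ℝ) + (-y / α : ℝ) * Complex.I := by
          push_cast; ring
        rw [this, Complex.exp_add, Complex.ofReal_exp]
        rcases abs_eq hπα0.le |>.1 hy with h | h
        · rw [h, show -(π * α) / α = -π by field_simp]
          simp [Complex.exp_neg]
        · rw [h, show -(-(π * α)) / α = π by field_simp]
          simp
      simp only [hE, this]
      ring
    · intro h
      have := congrArg Complex.im h
      simp at this
      rw [← this, hy] at hs₀im
      exact lt_irrefl _ hs₀im
  have hdiff : ∀ x : ℝ, Q (x + (π * α : ℝ) * Complex.I) - Q (x + (-(π * α) : ℝ) * Complex.I)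
      = 2 * b * Real.sin (π * α) * Complex.I *
        (fracKernel α b x * (1 + Real.exp (-x / α) * z)⁻¹) := by
    intro x
    rw [hline _ (abs_of_pos hπα0), hline _ (by rw [abs_neg, abs_of_pos hπα0])]
    have := fracKernel_eq_sub h0 h1 hb x
    linear_combination (1 + Real.exp (-x / α) * z)⁻¹ * this
  set D : ℂ := 2 * b * Real.sin (π * α) * Complex.I with hD
  set F : ℝ → ℂ := fun y => fracKernel α b y * (1 + Real.exp (-y / α) * z)⁻¹ with hF
  have key : ∀ L : ℝ, D * ∫ x : ℝ in -L..L, F x =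
      Complex.I * (∫ t : ℝ in -(π * α)..π * α, Q (((L : ℝ) : ℂ) + t * Complex.I))
      - Complex.I * (∫ t : ℝ in -(π * α)..π * α, Q (((-L : ℝ) : ℂ) + t * Complex.I)) := by
    intro L
    have hrect := Complex.integral_boundary_rect_eq_zero_of_differentiableOn Q
      ((-L : ℝ) + (-(π * α) : ℝ) * Complex.I) ((L : ℝ) + (π * α : ℝ) * Complex.I) (fun s hs => by
        have h2 : s.im ∈ Set.uIcc (-(π * α)) (π * α) := by simpa using hs.2
        rw [Set.uIcc_of_le (by linarith)] at h2
        exact (hQd s (abs_le.2 h2)).differentiableWithinAt)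
    have hci : ∀ y : ℝ, |y| = π * α →
        IntervalIntegrable (fun x : ℝ => Q (x + y * Complex.I)) volume (-L) L := by
      intro y hy
      refine Continuous.intervalIntegrable (continuous_iff_continuousAt.2 fun x => ?_) _ _
      have h2 : ContinuousAt Q (x + y * Complex.I) :=
        (hQd _ (by simpa using hy.le)).continuousAt
      exact ContinuousAt.comp (f := fun x : ℝ => (x + y * Complex.I : ℂ)) h2 (by fun_prop)
    have hsub : D * ∫ x : ℝ in -L..L, F x =
        (∫ x : ℝ in -L..L, Q (x + (π * α : ℝ) * Complex.I))
        - ∫ x : ℝ in -L..L, Q (x + (-(π * α) : ℝ) * Complex.I) := by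
      rw [← intervalIntegral.integral_const_mul, ← intervalIntegral.integral_sub
        (hci _ (abs_of_pos hπα0)) (hci _ (by rw [abs_neg, abs_of_pos hπα0]))]
      exact intervalIntegral.integral_congr fun x _ => (hdiff x).symm
    rw [hsub]
    simp only [Complex.add_re, Complex.ofReal_re, Complex.mul_re, Complex.I_re, mul_zero,
      Complex.ofReal_im, Complex.I_im, mul_one, sub_self, add_zero, Complex.add_im,
      Complex.mul_im, zero_add, smul_eq_mul] at hrect
    linear_combination -hrect
  have hlimH : Tendsto H (comap Complex.re atTop) (𝓝 1) := by
    have h2 := (((Complex.tendsto_exp_comap_re_atBot.comp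
      tendsto_neg_comap_re_atTop).const_mul (b : ℂ)).const_add 1).inv₀ (by simp)
    simpa [Function.comp_def] using h2
  have hlimE : Tendsto E (comap Complex.re atTop) (𝓝 1) := by
    have h2 := ((Complex.tendsto_exp_comap_re_atBot.comp
      (tendsto_neg_div_comap_re_atTop h0)).mul_const z).const_sub 1
    simpa [Function.comp_def] using h2
  have hlimH' : Tendsto H (comap Complex.re atBot) (𝓝 0) := by
    refine tendsto_inv₀_cobounded.comp ?_
    have h2 := Complex.tendsto_exp_comap_re_atTop.comp tendsto_neg_comap_re_atBot
    have h3 := (tendsto_mul_left_cobounded (a := (b : ℂ)) (by exact_mod_cast hb0.ne')).comp h2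
    exact (tendsto_const_add_cobounded (1 : ℂ)).comp h3
  have hlimE' : Tendsto (fun s => (E s)⁻¹) (comap Complex.re atBot) (𝓝 0) := by
    refine tendsto_inv₀_cobounded.comp ?_
    have h2 := Complex.tendsto_exp_comap_re_atTop.comp (tendsto_neg_div_comap_re_atBot h0)
    have h3 := (tendsto_mul_right_cobounded hz0).comp h2
    exact (tendsto_const_sub_cobounded (1 : ℂ)).comp h3
  have hne : ∀ l : Filter ℝ, (∀ᶠ x in l, x ≠ s₀.re) →
      (fun s => (H s - H s₀) * (E s)⁻¹) =ᶠ[comap Complex.re l] Q := by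
    intro l hl
    filter_upwards [hl.comap Complex.re] with s hs
    rw [hQne s (fun h => hs (by rw [h])), div_eq_mul_inv]
  -- The whole value of the integral comes from the right-hand side of the rectangle, where the
  -- limit is `1 - H s₀ = b/(z^α + b)`; on the left `E` blows up and `Q` vanishes.
  have hQtop : Tendsto Q (comap Complex.re atTop) (𝓝 (1 - H s₀)) := by
    refine Tendsto.congr' (hne _ (eventually_ne_atTop _)) ?_
    simpa using (hlimH.sub_const (H s₀)).mul (hlimE.inv₀ one_ne_zero)
  have hQbot : Tendsto Q (comap Complex.re atBot) (𝓝 0) := by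
    refine Tendsto.congr' (hne _ (eventually_ne_atBot _)) ?_
    simpa using (hlimH'.sub_const (H s₀)).mul hlimE'
  have hQc : ∀ x : ℝ, ∀ t ∈ Set.uIcc (-(π * α)) (π * α), ContinuousAt Q (x + t * Complex.I) := by
    intro x t ht
    rw [Set.uIcc_of_le (by linarith)] at ht
    exact (hQd _ (by simpa using abs_le.2 ht)).continuousAt
  have t1 := tendsto_integral_vertical hQc hQtop
  have t2 := (tendsto_integral_vertical hQc hQbot).comp tendsto_neg_atTop_atBot
  have t3 : Tendsto (fun L : ℝ => D * ∫ x in -L..L, F x) atTop (𝓝 (D * ∫ x, F x)) :=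
    (intervalIntegral_tendsto_integral (integrable_fracKernel_mul h0 h1 hb hz)
    tendsto_neg_atTop_atBot tendsto_id).const_mul D
  have hfin := tendsto_nhds_unique t3
    (((t1.const_mul Complex.I).sub (t2.const_mul Complex.I)).congr fun L => (key L).symm)
  have hHs : 1 - H s₀ = b * (z ^ (α : ℂ) + b)⁻¹ := by
    have e1 : Complex.exp (-s₀) = (z ^ (α : ℂ))⁻¹ := by
      rw [Complex.exp_neg, Complex.cpow_def_of_ne_zero hz0, hs₀, mul_comm]
    have n1 := one_add_mul_exp_neg_ne_zero hb0 (hs₀im.trans hπα)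
    have n2 : z ^ (α : ℂ) ≠ 0 := by simp [Complex.cpow_eq_zero_iff, hz0]
    have n3 : z ^ (α : ℂ) + b ≠ 0 := by
      intro h
      apply n1
      rw [e1]
      field_simp
      simpa using h
    rw [e1] at n1
    simp only [hH, e1]
    field_simp
    ring
  have hsin : (Real.sin (π * α) : ℂ) ≠ 0 := by
    exact_mod_cast (Real.sin_pos_of_pos_of_lt_pi hπα0 hπα).ne'
  have hπ : (π : ℂ) ≠ 0 := by exact_mod_cast Real.pi_ne_zero
  have hbc : (b : ℂ) ≠ 0 := by exact_mod_cast hb0.ne'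
  rw [hHs, hD] at hfin
  have hfin' : b * Complex.I * (2 * (Real.sin (π * α) * ∫ y, F y)) =
      b * Complex.I * (2 * (α * π * (z ^ (α : ℂ) + b)⁻¹)) := by
    push_cast at hfin ⊢
    linear_combination hfin
  have hfin2 := mul_left_cancel₀ (mul_ne_zero hbc Complex.I_ne_zero) hfin'
  have hfin3 := mul_left_cancel₀ two_ne_zero hfin2
  push_cast at hfin3 ⊢
  rw [div_mul_eq_mul_div, hfin3]
  field_simp

/-! ### The Dunford-Taylor calculus on a circle -/

section Dunford

variable {A : Type*} [NormedRing A] [NormedAlgebra ℂ A]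

/-- The Dunford-Taylor integral `(2πi)⁻¹ ∮ h(z) (z - T)⁻¹ dz` over a circle. -/
noncomputable def dunford (T : A) (z₀ : ℂ) (R : ℝ) (h : ℂ → ℂ) : A :=
  (2 * (π : ℂ) * Complex.I)⁻¹ • ∮ z in C(z₀, R), h z • resolvent T z

theorem dunford_congr {T : A} {z₀ : ℂ} {R : ℝ} (hR : 0 ≤ R) {h k : ℂ → ℂ}
    (e : Set.EqOn h k (Metric.sphere z₀ R)) : dunford T z₀ R h = dunford T z₀ R k := by
  unfold dunford
  rw [circleIntegral.integral_congr hR fun z hz => by rw [e hz]]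

theorem dunford_const_mul (T : A) (z₀ : ℂ) (R : ℝ) (c : ℂ) (h : ℂ → ℂ) :
    dunford T z₀ R (fun z => c * h z) = c • dunford T z₀ R h := by
  unfold dunford
  simp only [mul_smul, circleIntegral.integral_smul]
  rw [smul_comm]

theorem notMem_spectrum_of_mem_sphere {T : A} {z₀ : ℂ} {R : ℝ} (hs : spectrum ℂ T ⊆ Metric.ball z₀ R) {z : ℂ}
    (hz : z ∈ Metric.sphere z₀ R) : z ∉ spectrum ℂ T := fun h => by
  have := hs h
  rw [Metric.mem_sphere] at hz
  rw [Metric.mem_ball, hz] at this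
  exact lt_irrefl _ this

/-- If `T - c` were invertible, the factor `X - c` could be cancelled from the minimal polynomial,
leaving an annihilating polynomial of smaller degree. -/
theorem mem_spectrum_of_mem_roots_minpoly [FiniteDimensional ℂ A] (T : A) {c : ℂ}
    (hc : c ∈ (minpoly ℂ T).roots) : c ∈ spectrum ℂ T := by
  have hint : IsIntegral ℂ T := Algebra.IsIntegral.isIntegral T
  by_contra hn
  have hu : IsUnit (algebraMap ℂ A c - T) := spectrum.notMem_iff.1 hn
  obtain ⟨ν, hν⟩ := Polynomial.dvd_iff_isRoot.2 (Polynomial.isRoot_of_mem_roots hc)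
  have h0 := minpoly.aeval ℂ T
  have hν0 : ν ≠ 0 := by
    rintro rfl
    exact minpoly.ne_zero hint (by simpa using hν)
  rw [hν, map_mul] at h0
  have hu' : IsUnit (Polynomial.aeval T (Polynomial.X - Polynomial.C c)) := by
    simpa using hu.neg
  have h1 : Polynomial.aeval T ν = 0 := (hu'.mul_right_eq_zero).1 h0
  have h2 := minpoly.degree_le_of_ne_zero ℂ T hν0 h1
  rw [hν, Polynomial.degree_mul, Polynomial.degree_X_sub_C, Polynomial.degree_eq_natDegree hν0]
    at h2
  have h3 : 1 + ν.natDegree ≤ ν.natDegree := by exact_mod_cast h2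
  omega

/-- Shows that the resolvent differs from `(z - z₀)⁻¹` by `o(1/|z|)` at infinity, so that the
difference integrates to zero over large circles. -/
theorem resolvent_sub_inv_smul_one {T : A} {z z₀ : ℂ} (hz : z ∉ spectrum ℂ T) (hne : z ≠ z₀) :
    resolvent T z - (z - z₀)⁻¹ • (1 : A)
      = (z - z₀)⁻¹ • (resolvent T z * (T - algebraMap ℂ A z₀)) := by
  have hu : IsUnit (algebraMap ℂ A z - T) := spectrum.notMem_iff.1 hz
  have h1 : resolvent T z * (algebraMap ℂ A z - T) = 1 := Ring.inverse_mul_cancel _ hu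
  have hne' := sub_ne_zero.2 hne
  have h2 : resolvent T z * (T - algebraMap ℂ A z₀) = (z - z₀) • resolvent T z - 1 := by
    rw [← h1, Algebra.smul_def, Algebra.commutes, ← mul_sub, map_sub]
    congr 1
    abel
  rw [h2, smul_sub, inv_smul_smul₀ hne']

variable [CompleteSpace A]

theorem circleIntegral_const_mul_ring (a : A) {f : ℂ → A} {z₀ : ℂ} {R : ℝ}
    (hf : CircleIntegrable f z₀ R) :
    (∮ z in C(z₀, R), a * f z) = a * ∮ z in C(z₀, R), f z := by
  have := (ContinuousLinearMap.mul ℂ A a).intervalIntegral_comp_comm hf.out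
  simpa [circleIntegral] using this

theorem differentiableAt_resolvent {T : A} {z : ℂ} (hz : z ∉ spectrum ℂ T) :
    DifferentiableAt ℂ (resolvent T) z := by
  have hu : IsUnit (algebraMap ℂ A z - T) := spectrum.notMem_iff.1 hz
  have h1 : DifferentiableAt ℂ (fun z : ℂ => algebraMap ℂ A z - T) z :=
    ((algebraMapCLM ℂ A).differentiableAt).sub_const T
  exact (differentiableAt_inverse hu).comp z h1

variable {T : A} {z₀ : ℂ} {R : ℝ}

theorem circleIntegrable_smul_resolvent (hR : 0 < R) (hs : spectrum ℂ T ⊆ Metric.ball z₀ R)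
    {h : ℂ → ℂ} (hh : ContinuousOn h (Metric.sphere z₀ R)) :
    CircleIntegrable (fun z => h z • resolvent T z) z₀ R :=
  (hh.smul fun _ hz => (differentiableAt_resolvent
    (notMem_spectrum_of_mem_sphere hs hz)).continuousAt.continuousWithinAt).circleIntegrable hR.le

theorem dunford_add (hR : 0 < R) (hs : spectrum ℂ T ⊆ Metric.ball z₀ R)
    {h k : ℂ → ℂ} (hh : ContinuousOn h (Metric.sphere z₀ R))
    (hk : ContinuousOn k (Metric.sphere z₀ R)) :
    dunford T z₀ R (fun z => h z + k z) = dunford T z₀ R h + dunford T z₀ R k := by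
  unfold dunford
  simp only [add_smul]
  rw [circleIntegral.integral_add (circleIntegrable_smul_resolvent hR hs hh)
    (circleIntegrable_smul_resolvent hR hs hk), smul_add]

/-- The resolvent is compared with `(z - z₀)⁻¹`, whose integral is known. The difference is analytic
outside the ball, so its circle may be enlarged at will, and its integral tends to zero. -/
theorem dunford_one (hR : 0 < R) (hs : spectrum ℂ T ⊆ Metric.ball z₀ R) :
    dunford T z₀ R (fun _ => 1) = 1 := by
  set F : ℂ → A := fun z => resolvent T z - (z - z₀)⁻¹ • (1 : A) with hF
  have hout : ∀ z, z ∉ Metric.ball z₀ R → z ∉ spectrum ℂ T ∧ z ≠ z₀ := fun z hz =>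
    ⟨fun h => hz (hs h), fun h => hz (h ▸ Metric.mem_ball_self hR)⟩
  have hFd : ∀ z, z ∉ Metric.ball z₀ R → DifferentiableAt ℂ F z := fun z hz => by
    refine (differentiableAt_resolvent (hout z hz).1).sub (DifferentiableAt.smul_const ?_ _)
    exact (differentiableAt_id.sub_const _).inv (sub_ne_zero.2 (hout z hz).2)
  have hzero : (∮ z in C(z₀, R), F z) = 0 := by
    rw [← norm_le_zero_iff]
    refine le_of_forall_pos_le_add fun ε hε => ?_
    rw [zero_add]
    set M : ℝ := ‖T - algebraMap ℂ A z₀‖ with hM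
    -- Sized so that the circumference `2πR'` times the bound `R'⁻¹ · M · ε/(2π(M+1))` is at most
    -- `ε`; the `+1` covers `M = 0`.
    have hε' : 0 < ε / (2 * π * (M + 1)) := by positivity
    have h1 := (tendsto_zero_iff_norm_tendsto_zero.1
      (spectrum.resolvent_tendsto_cobounded (𝕜 := ℂ) T)).eventually (eventually_lt_nhds hε')
    rw [atTop_basis_Ioi.cobounded_of_norm.eventually_iff] at h1
    obtain ⟨r, -, hr⟩ := h1
    set R' : ℝ := max R (r + ‖z₀‖ + 1) with hR'
    have hRR' : R ≤ R' := le_max_left _ _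
    have heq := Complex.circleIntegral_eq_of_differentiable_on_annulus_off_countable
      (f := F) hR hRR' Set.countable_empty
      (fun z hz => (hFd z hz.2).continuousAt.continuousWithinAt)
      (fun z hz => hFd z fun h => hz.1.2 (Metric.ball_subset_closedBall h))
    rw [← heq]
    have hR'0 : 0 < R' := hR.trans_le hRR'
    refine (circleIntegral.norm_integral_le_of_norm_le_const
      (C := R'⁻¹ * (ε / (2 * π * (M + 1)) * M)) hR'0.le fun z hz => ?_).trans ?_
    · rw [mem_sphere_iff_norm] at hz
      have hzb : z ∉ Metric.ball z₀ R := by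
        rw [mem_ball_iff_norm, hz]; exact not_lt.2 hRR'
      have hzr : r < ‖z‖ := by
        have h2 : ‖z - z₀‖ ≤ ‖z‖ + ‖z₀‖ := norm_sub_le _ _
        have h3 : r + ‖z₀‖ + 1 ≤ R' := le_max_right _ _
        linarith
      simp only [hF]
      rw [resolvent_sub_inv_smul_one (hout z hzb).1 (hout z hzb).2, norm_smul, norm_inv, hz]
      refine mul_le_mul_of_nonneg_left ((norm_mul_le _ _).trans ?_) (by positivity)
      exact mul_le_mul_of_nonneg_right (hr hzr).le (norm_nonneg _)
    · have hM0 : 0 ≤ M := norm_nonneg _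
      have : 2 * π * R' * (R'⁻¹ * (ε / (2 * π * (M + 1)) * M)) = ε * (M / (M + 1)) := by
        field_simp
      rw [this]
      refine mul_le_of_le_one_right hε.le ?_
      rw [div_le_one (by positivity)]
      linarith
  have hπ : (2 * (π : ℂ) * Complex.I) ≠ 0 := by simp [Real.pi_ne_zero]
  unfold dunford
  have hi1 : CircleIntegrable F z₀ R :=
    ContinuousOn.circleIntegrable hR.le fun z hz => (hFd z fun h => by
      rw [Metric.mem_sphere] at hz
      rw [Metric.mem_ball, hz] at h
      exact lt_irrefl _ h).continuousAt.continuousWithinAt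
  have hi2 : CircleIntegrable (fun z => (z - z₀)⁻¹ • (1 : A)) z₀ R := by
    refine ContinuousOn.circleIntegrable hR.le fun z hz => ?_
    have hne : z - z₀ ≠ 0 := by
      rw [mem_sphere_iff_norm] at hz
      rw [← norm_pos_iff, hz]
      exact hR
    exact ((continuousAt_id.sub continuousAt_const).inv₀ hne).smul continuousAt_const
      |>.continuousWithinAt
  have hdec : (∮ z in C(z₀, R), (1 : ℂ) • resolvent T z)
      = (∮ z in C(z₀, R), F z) + ∮ z in C(z₀, R), (z - z₀)⁻¹ • (1 : A) := by
    rw [← circleIntegral.integral_add hi1 hi2]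
    simp [hF]
  rw [hdec, hzero, zero_add, circleIntegral.integral_smul_const,
    circleIntegral.integral_sub_inv_of_mem_ball (Metric.mem_ball_self hR), inv_smul_smul₀ hπ]

variable {U : Set ℂ}

theorem circleIntegral_eq_zero_of_differentiableOn (hR : 0 < R) (hU : IsOpen U)
    (hRU : Metric.closedBall z₀ R ⊆ U) {h : ℂ → ℂ} (hh : DifferentiableOn ℂ h U) :
    (∮ z in C(z₀, R), h z) = 0 :=
  Complex.circleIntegral_eq_zero_of_differentiable_on_off_countable hR.le Set.countable_empty
    (hh.continuousOn.mono hRU) fun _ hz => hh.differentiableAt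
      (hU.mem_nhds (hRU (Metric.ball_subset_closedBall hz.1)))

/-- Split `z - c = (z - T) + (T - c)`: the first part cancels the resolvent and leaves `∮ h = 0` by
Cauchy, the second leaves the integral as a constant factor. -/
theorem dunford_sub_mul (hR : 0 < R) (hs : spectrum ℂ T ⊆ Metric.ball z₀ R) (hU : IsOpen U)
    (hRU : Metric.closedBall z₀ R ⊆ U) {h : ℂ → ℂ} (hh : DifferentiableOn ℂ h U) (c : ℂ) :
    dunford T z₀ R (fun z => (z - c) * h z) = (T - algebraMap ℂ A c) * dunford T z₀ R h := by
  have hhc : ContinuousOn h (Metric.sphere z₀ R) :=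
    hh.continuousOn.mono (Metric.sphere_subset_closedBall.trans hRU)
  have hint := circleIntegrable_smul_resolvent hR hs hhc
  have hpt : Set.EqOn (fun z => ((z - c) * h z) • resolvent T z)
      (fun z => h z • (1 : A) + (T - algebraMap ℂ A c) * (h z • resolvent T z))
      (Metric.sphere z₀ R) := by
    intro z hz
    have hu : IsUnit (algebraMap ℂ A z - T) :=
      spectrum.notMem_iff.1 (notMem_spectrum_of_mem_sphere hs hz)
    have h1 : (algebraMap ℂ A z - T) * resolvent T z = 1 := Ring.mul_inverse_cancel _ hu
    simp only
    rw [← h1, mul_smul_comm, ← smul_add, ← add_mul, mul_comm (z - c), mul_smul, Algebra.smul_def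
      (z - c), map_sub]
    congr 2
    abel
  have hi1 : CircleIntegrable (fun z => h z • (1 : A)) z₀ R :=
    ContinuousOn.circleIntegrable hR.le (hhc.smul continuousOn_const)
  have hi2 : CircleIntegrable
      (fun z => (T - algebraMap ℂ A c) * (h z • resolvent T z)) z₀ R := by
    refine ContinuousOn.circleIntegrable hR.le (continuousOn_const.mul (hhc.smul fun _ hz =>
      (differentiableAt_resolvent
        (notMem_spectrum_of_mem_sphere hs hz)).continuousAt.continuousWithinAt))
  unfold dunford
  rw [circleIntegral.integral_congr hR.le hpt, circleIntegral.integral_add hi1 hi2,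
    circleIntegral.integral_smul_const, circleIntegral_eq_zero_of_differentiableOn hR hU hRU hh,
    zero_smul, zero_add, circleIntegral_const_mul_ring _ hint, mul_smul_comm]

theorem dunford_prod_mul (hR : 0 < R) (hs : spectrum ℂ T ⊆ Metric.ball z₀ R) (hU : IsOpen U)
    (hRU : Metric.closedBall z₀ R ⊆ U) (p : Polynomial ℂ) :
    ∀ {h : ℂ → ℂ}, DifferentiableOn ℂ h U →
    dunford T z₀ R (fun z => p.eval z * h z) = Polynomial.aeval T p * dunford T z₀ R h := by
  have hcont : ∀ {h : ℂ → ℂ}, DifferentiableOn ℂ h U → ContinuousOn h (Metric.sphere z₀ R) :=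
    fun hh => hh.continuousOn.mono (Metric.sphere_subset_closedBall.trans hRU)
  have hX : ∀ {h : ℂ → ℂ}, DifferentiableOn ℂ h U →
      dunford T z₀ R (fun z => z * h z) = T * dunford T z₀ R h := by
    intro h hh
    have := dunford_sub_mul hR hs hU hRU hh 0
    simpa using this
  induction p using Polynomial.induction_on' with
  | add p q hp hq =>
    intro h hh
    simp only [Polynomial.eval_add, add_mul, map_add]
    rw [dunford_add hR hs (hcont (p.differentiable.differentiableOn.fun_mul hh))
      (hcont (q.differentiable.differentiableOn.fun_mul hh)), hp hh, hq hh]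
  | monomial n c =>
    induction n with
    | zero =>
      intro h hh
      simp only [Polynomial.monomial_zero_left, Polynomial.eval_C, Polynomial.aeval_C]
      rw [dunford_const_mul, Algebra.smul_def]
    | succ n ih =>
      intro h hh
      have h1 : ∀ z, (Polynomial.monomial (n + 1) c).eval z * h z
          = (Polynomial.monomial n c).eval z * (z * h z) := by
        intro z
        simp only [Polynomial.eval_monomial, pow_succ]
        ring
      simp only [h1]
      rw [ih ((show DifferentiableOn ℂ (fun z : ℂ => z) U from differentiableOn_id).fun_mul hh), hX hh, ← mul_assoc]
      congr 1
      simp only [Polynomial.aeval_monomial, pow_succ, mul_assoc]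

/-- Division with remainder of a holomorphic function by a product of linear factors. -/
theorem exists_eval_add_prod_mul (hU : IsOpen U) (s : Multiset ℂ) (hsU : ∀ c ∈ s, c ∈ U)
    {h : ℂ → ℂ} (hh : DifferentiableOn ℂ h U) :
    ∃ (p : Polynomial ℂ) (q : ℂ → ℂ), DifferentiableOn ℂ q U ∧
      ∀ z, h z = p.eval z + (s.map fun c => Polynomial.X - Polynomial.C c).prod.eval z * q z := by
  induction s using Multiset.induction_on with
  | empty => exact ⟨0, h, hh, fun z => by simp⟩
  | cons c s ih =>
    obtain ⟨p, q, hq, e⟩ := ih fun c hc => hsU c (Multiset.mem_cons_of_mem hc)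
    -- A Newton interpolation step: write the old quotient as `q(c) + (z - c)` times its divided
    -- difference, which is again holomorphic.
    refine ⟨p + (s.map fun c => Polynomial.X - Polynomial.C c).prod * Polynomial.C (q c),
      dslope q c, (Complex.differentiableOn_dslope
        (hU.mem_nhds (hsU c (Multiset.mem_cons_self c s)))).2 hq, fun z => ?_⟩
    have h1 : (z - c) * dslope q c z = q z - q c := by
      simpa using sub_smul_dslope q c z
    rw [e z, Multiset.map_cons, Multiset.prod_cons]
    simp only [Polynomial.eval_add, Polynomial.eval_mul, Polynomial.eval_sub, Polynomial.eval_X,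
      Polynomial.eval_C]
    linear_combination -(s.map fun c => Polynomial.X - Polynomial.C c).prod.eval z * h1

/-- Divide `h` by the minimal polynomial `μ` of `T`, whose roots lie in the spectrum and hence in
the disc: `h = p + μ q`. Since `μ(T) = 0`, `h` acts as the polynomial `p`, and polynomials can be
pulled out of the integral. -/
theorem dunford_mul [FiniteDimensional ℂ A] (hR : 0 < R)
    (hs : spectrum ℂ T ⊆ Metric.ball z₀ R) (hU : IsOpen U)
    (hRU : Metric.closedBall z₀ R ⊆ U) {h k : ℂ → ℂ} (hh : DifferentiableOn ℂ h U)
    (hk : DifferentiableOn ℂ k U) :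
    dunford T z₀ R (fun z => h z * k z) = dunford T z₀ R h * dunford T z₀ R k := by
  have hcont : ∀ {h : ℂ → ℂ}, DifferentiableOn ℂ h U → ContinuousOn h (Metric.sphere z₀ R) :=
    fun hh => hh.continuousOn.mono (Metric.sphere_subset_closedBall.trans hRU)
  have hint : IsIntegral ℂ T := Algebra.IsIntegral.isIntegral T
  obtain ⟨p, q, hq, e⟩ := exists_eval_add_prod_mul hU (minpoly ℂ T).roots (fun c hc =>
    hRU (Metric.ball_subset_closedBall (hs (mem_spectrum_of_mem_roots_minpoly T hc)))) hh
  have hμ : ((minpoly ℂ T).roots.map fun c => Polynomial.X - Polynomial.C c).prod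
      = minpoly ℂ T :=
    ((IsAlgClosed.splits (minpoly ℂ T)).eq_prod_roots_of_monic (minpoly.monic hint)).symm
  rw [hμ] at e
  have general : ∀ {k : ℂ → ℂ}, DifferentiableOn ℂ k U →
      dunford T z₀ R (fun z => h z * k z) = Polynomial.aeval T p * dunford T z₀ R k := by
    intro k hk
    have e1 : (fun z => h z * k z)
        = fun z => p.eval z * k z + (minpoly ℂ T).eval z * (q z * k z) := by
      funext z; rw [e z]; ring
    rw [e1, dunford_add hR hs (hcont (p.differentiable.differentiableOn.fun_mul hk))
      (hcont ((minpoly ℂ T).differentiable.differentiableOn.fun_mul (hq.fun_mul hk))),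
      dunford_prod_mul hR hs hU hRU p hk, dunford_prod_mul hR hs hU hRU _ (hq.fun_mul hk),
      minpoly.aeval, zero_mul, add_zero]
  -- The case `k = 1` identifies `p(T)` with the integral of `h`.
  have h1 := general (k := fun _ => 1) (differentiableOn_const _)
  rw [dunford_one hR hs, mul_one] at h1
  rw [general hk, ← h1]
  simp

theorem dunford_inv_one_add_mul [FiniteDimensional ℂ A] (hR : 0 < R)
    (hs : spectrum ℂ T ⊆ Metric.ball z₀ R) (hRU : Metric.closedBall z₀ R ⊆ Complex.slitPlane)
    {t : ℝ} (ht : 0 ≤ t) :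
    dunford T z₀ R (fun z => (1 + t * z)⁻¹) = Ring.inverse (1 + (t : ℂ) • T) := by
  have hU := Complex.isOpen_slitPlane
  set g : ℂ → ℂ := fun z => (1 + t * z)⁻¹ with hg
  have hgd : DifferentiableOn ℂ g Complex.slitPlane := fun z hz =>
    ((by fun_prop : DifferentiableAt ℂ (fun z : ℂ => 1 + t * z) z).inv
      (one_add_mul_ne_zero hz ht)).differentiableWithinAt
  set p : Polynomial ℂ := 1 + Polynomial.C (t : ℂ) * Polynomial.X with hp
  have hpT : Polynomial.aeval T p = 1 + (t : ℂ) • T := by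
    simp [hp, Algebra.smul_def]
  have hpg : Set.EqOn (fun z => p.eval z * g z) (fun _ => 1) (Metric.sphere z₀ R) := by
    intro z hz
    have := one_add_mul_ne_zero (hRU (Metric.sphere_subset_closedBall hz)) ht
    simp [hp, hg, mul_inv_cancel₀ this]
  have h1 : (1 + (t : ℂ) • T) * dunford T z₀ R g = 1 := by
    rw [← hpT, ← dunford_prod_mul hR hs hU hRU p hgd, dunford_congr hR.le hpg, dunford_one hR hs]
  have h2 : dunford T z₀ R g * (1 + (t : ℂ) • T) = 1 := by
    have e1 : dunford T z₀ R (fun z => p.eval z) = 1 + (t : ℂ) • T := by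
      have := dunford_prod_mul hR hs hU hRU p (h := fun _ => 1) (differentiableOn_const _)
      rw [dunford_one hR hs, hpT] at this
      simpa using this
    rw [← e1, ← dunford_mul hR hs hU hRU hgd p.differentiable.differentiableOn]
    have e2 : Set.EqOn (fun z => g z * p.eval z) (fun _ => 1) (Metric.sphere z₀ R) := by
      intro z hz
      simp only [mul_comm (g z)]
      exact hpg hz
    rw [dunford_congr hR.le e2, dunford_one hR hs]
  exact (Ring.inverse_unit (⟨_, _, h1, h2⟩ : Aˣ)).symm

/-- Fubini. The circle is compact inside the slit plane, so `|1 + tz|` is bounded below on it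
uniformly in `t ≥ 0` and the resolvent is bounded; `e^{-|y|}` then dominates. -/
theorem dunford_integral_fracKernel {α b : ℝ} (h0 : 0 < α) (h1 : α < 1) (hb : 1 ≤ b) (hR : 0 < R)
    (hs : spectrum ℂ T ⊆ Metric.ball z₀ R) (hRU : Metric.closedBall z₀ R ⊆ Complex.slitPlane) :
    dunford T z₀ R (fun z => ∫ y : ℝ, fracKernel α b y * (1 + Real.exp (-y / α) * z)⁻¹)
      = ∫ y : ℝ, fracKernel α b y •
          dunford T z₀ R (fun z => (1 + Real.exp (-y / α) * z)⁻¹) := by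
  set F : ℝ → ℂ → ℂ := fun y z => fracKernel α b y * (1 + Real.exp (-y / α) * z)⁻¹ with hF
  have hsl : ∀ θ, circleMap z₀ R θ ∈ Complex.slitPlane := fun θ =>
    hRU (Metric.sphere_subset_closedBall (circleMap_mem_sphere z₀ hR.le θ))
  have hres : ContinuousOn (resolvent T) (Metric.sphere z₀ R) := fun z hz =>
    (differentiableAt_resolvent
      (notMem_spectrum_of_mem_sphere hs hz)).continuousAt.continuousWithinAt
  obtain ⟨M, hM⟩ := (isCompact_sphere z₀ R).exists_bound_of_continuousOn hres
  have hmc : ContinuousOn (fun z : ℂ => (‖z‖ + z.re) / (2 * ‖z‖)) (Metric.sphere z₀ R) := by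
    intro z hz
    have hz' := Complex.slitPlane_ne_zero (hRU (Metric.sphere_subset_closedBall hz))
    have : 2 * ‖z‖ ≠ 0 := by simpa using hz'
    have hn : ContinuousAt (fun z : ℂ => ‖z‖) z := continuous_norm.continuousAt
    exact ((hn.add Complex.continuous_re.continuousAt).div
      (continuousAt_const.mul hn) this).continuousWithinAt
  obtain ⟨m, hm0, hm⟩ : ∃ m : ℝ, 0 < m ∧ ∀ z ∈ Metric.sphere z₀ R,
      m ≤ (‖z‖ + z.re) / (2 * ‖z‖) := by
    obtain ⟨w, hw, hmin⟩ := (isCompact_sphere z₀ R).exists_isMinOn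
      (NormedSpace.sphere_nonempty.2 hR.le) hmc
    refine ⟨_, ?_, fun z hz => hmin hz⟩
    have hw' := hRU (Metric.sphere_subset_closedBall hw)
    have := norm_pos_iff.2 (Complex.slitPlane_ne_zero hw')
    exact div_pos (norm_add_re_pos hw') (by positivity)
  have hc := abs_cos_pi_mul_lt_one h0 h1
  set G : ℝ → ℝ → A := fun θ y => deriv (circleMap z₀ R) θ •
    (F y (circleMap z₀ R θ) • resolvent T (circleMap z₀ R θ)) with hG
  have hGint : Integrable (Function.uncurry G)
      ((volume.restrict (Set.uIoc 0 (2 * π))).prod volume) := by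
    have hmaj : Integrable (fun x : ℝ × ℝ => R * ((1 - |Real.cos (π * α)|)⁻¹ *
        Real.exp (-|x.2|) * m⁻¹ * M)) ((volume.restrict (Set.uIoc 0 (2 * π))).prod volume) := by
      have h2 : Integrable (fun y : ℝ => R * ((1 - |Real.cos (π * α)|)⁻¹ *
        Real.exp (-|y|) * m⁻¹ * M)) :=
        (((integrable_exp_neg_abs.const_mul _).mul_const _).mul_const _).const_mul _
      have h3 : Integrable (fun _ : ℝ => (1 : ℝ)) (volume.restrict (Set.uIoc 0 (2 * π))) := by
        rw [Set.uIoc]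
        exact integrable_const _
      simpa using h3.mul_prod h2
    refine hmaj.mono' (Continuous.aestronglyMeasurable ?_) (Eventually.of_forall ?_)
    · have c1 : Continuous fun θ => resolvent T (circleMap z₀ R θ) :=
        hres.comp_continuous (continuous_circleMap z₀ R) (circleMap_mem_sphere z₀ hR.le)
      have c2 : Continuous fun x : ℝ × ℝ => (1 + Real.exp (-x.2 / α) * circleMap z₀ R x.1)⁻¹ := by
        refine Continuous.inv₀ ?_ fun x => one_add_mul_ne_zero (hsl _) (Real.exp_pos _).le
        have := (continuous_circleMap z₀ R).comp (continuous_fst (X := ℝ) (Y := ℝ))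
        fun_prop
      have c3 := (continuous_fracKernel_ofReal h0 h1 hb).comp (continuous_snd (X := ℝ) (Y := ℝ))
      have c4 : Continuous fun θ => deriv (circleMap z₀ R) θ := by
        simp only [deriv_circleMap]
        exact (continuous_circleMap 0 R).mul continuous_const
      exact (c4.comp continuous_fst).smul ((c3.mul c2).smul (c1.comp continuous_fst))
    · rintro ⟨θ, y⟩
      have hmem := circleMap_mem_sphere z₀ hR.le θ
      have hz0 := Complex.slitPlane_ne_zero (hsl θ)
      simp only [Function.uncurry, hG, hF, norm_smul, norm_mul, norm_inv, deriv_circleMap,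
        norm_circleMap_zero, Complex.norm_I, mul_one, abs_of_pos hR]
      have hk := norm_fracKernel_ofReal_le_exp h0 h1 hb y
      have hg : ‖1 + (Real.exp (-y / α) : ℂ) * circleMap z₀ R θ‖⁻¹ ≤ m⁻¹ :=
        inv_anti₀ hm0 ((hm _ hmem).trans (norm_one_add_mul_ge hz0 (Real.exp_pos _).le))
      have hk0 := (norm_nonneg _).trans hk
      gcongr
      exact hM _ hmem
  have hswap := intervalIntegral_integral_swap hGint
  unfold dunford
  simp only [circleIntegral, smul_comm (fracKernel α b _) (2 * (π : ℂ) * Complex.I)⁻¹,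
    integral_smul]
  congr 1
  have e1 : ∀ θ, deriv (circleMap z₀ R) θ • ((∫ y, F y (circleMap z₀ R θ)) •
      resolvent T (circleMap z₀ R θ)) = ∫ y, G θ y := by
    intro θ
    rw [integral_smul, integral_smul_const]
  have e2 : ∀ y : ℝ, fracKernel α b y • (∫ θ in (0 : ℝ)..2 * π, deriv (circleMap z₀ R) θ •
      ((1 + Real.exp (-y / α) * circleMap z₀ R θ)⁻¹ • resolvent T (circleMap z₀ R θ)))
      = ∫ θ in (0 : ℝ)..2 * π, G θ y := by
    intro y
    rw [← intervalIntegral.integral_smul]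
    congr 1
    ext θ
    rw [hG, smul_comm]
    simp only [hF, mul_smul]
  simp only [e2, ← hswap, ← e1]
  rfl

/-- The semidiscrete solution operator as an integral of resolvents. -/
theorem inverse_fracPow_add [FiniteDimensional ℂ A] {α b : ℝ} (h0 : 0 < α) (h1 : α < 1)
    (hb : 1 ≤ b) (hR : 0 < R) (hs : spectrum ℂ T ⊆ Metric.ball z₀ R)
    (hRU : Metric.closedBall z₀ R ⊆ Complex.slitPlane) :
    Ring.inverse (dunford T z₀ R (fun z => z ^ (α : ℂ)) + (b : ℂ) • (1 : A)) =
      ((Real.sin (π * α) / (α * π) : ℝ) : ℂ) • ∫ y : ℝ, fracKernel α b y •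
        Ring.inverse (1 + (Real.exp (-y / α) : ℂ) • T) := by
  have hU := Complex.isOpen_slitPlane
  have hpow : DifferentiableOn ℂ (fun z : ℂ => z ^ (α : ℂ)) Complex.slitPlane := fun z hz =>
    (DifferentiableAt.cpow differentiableAt_fun_id (differentiableAt_const _)
      hz).differentiableWithinAt
  -- The argument of `z^α` is `α arg z`, which is less than `π`, so `z^α` cannot be the negative
  -- number `-b`.
  have hne : ∀ z ∈ Complex.slitPlane, z ^ (α : ℂ) + b ≠ 0 := by
    intro z hz h
    have hz0 := Complex.slitPlane_ne_zero hz
    have h2 : (z ^ (α : ℂ)).arg = α * z.arg := by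
      have hl := Complex.neg_pi_lt_arg z
      have hu := Complex.arg_le_pi z
      rw [Complex.cpow_def_of_ne_zero hz0, Complex.arg_exp, Complex.im_mul_ofReal, Complex.log_im,
        toIocMod_eq_self Real.two_pi_pos |>.2, mul_comm]
      constructor <;> nlinarith [Real.pi_pos]
    have h3 : z ^ (α : ℂ) = ((-b : ℝ) : ℂ) := by
      push_cast; linear_combination h
    rw [h3, Complex.arg_ofReal_of_neg (by linarith)] at h2
    have hu := Complex.arg_le_pi z
    nlinarith [Real.pi_pos]
  set h : ℂ → ℂ := fun z => z ^ (α : ℂ) + b with hh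
  have hd : DifferentiableOn ℂ h Complex.slitPlane := hpow.add_const _
  have hdi : DifferentiableOn ℂ (fun z => (h z)⁻¹) Complex.slitPlane := hd.inv hne
  have hcont : ∀ {h : ℂ → ℂ}, DifferentiableOn ℂ h Complex.slitPlane →
      ContinuousOn h (Metric.sphere z₀ R) :=
    fun hh => hh.continuousOn.mono (Metric.sphere_subset_closedBall.trans hRU)
  have e0 : dunford T z₀ R h
      = dunford T z₀ R (fun z => z ^ (α : ℂ)) + (b : ℂ) • (1 : A) := by
    have e := dunford_const_mul T z₀ R b (fun _ => 1)
    rw [dunford_one hR hs] at e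
    rw [← e, ← dunford_add hR hs (hcont hpow) continuousOn_const]
    simp [hh]
  have p1 : dunford T z₀ R h * dunford T z₀ R (fun z => (h z)⁻¹) = 1 := by
    rw [← dunford_mul hR hs hU hRU hd hdi, ← dunford_one (T := T) hR hs]
    exact dunford_congr hR.le fun z hz =>
      mul_inv_cancel₀ (hne z (hRU (Metric.sphere_subset_closedBall hz)))
  have p2 : dunford T z₀ R (fun z => (h z)⁻¹) * dunford T z₀ R h = 1 := by
    rw [← dunford_mul hR hs hU hRU hdi hd, ← dunford_one (T := T) hR hs]
    exact dunford_congr hR.le fun z hz =>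
      inv_mul_cancel₀ (hne z (hRU (Metric.sphere_subset_closedBall hz)))
  rw [← e0, show Ring.inverse (dunford T z₀ R h) = dunford T z₀ R (fun z => (h z)⁻¹) from
    Ring.inverse_unit (⟨_, _, p1, p2⟩ : Aˣ)]
  rw [dunford_congr hR.le (k := fun z => ((Real.sin (π * α) / (α * π) : ℝ) : ℂ) *
    ∫ y : ℝ, fracKernel α b y * (1 + Real.exp (-y / α) * z)⁻¹) fun z hz =>
    (integral_fracKernel_mul h0 h1 hb (hRU (Metric.sphere_subset_closedBall hz))).symm,
    dunford_const_mul, dunford_integral_fracKernel h0 h1 hb hR hs hRU]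
  congr 2
  ext y
  rw [dunford_inv_one_add_mul hR hs hRU (Real.exp_pos _).le]

end Dunford

/-! ### Resolvent bounds from the numerical range -/

/-- A rotation by `-φ` must bring the sector of half-angle `ψ = arctan β`, turned by `θ`, into the
right half-plane and still leave `1` with real part `cos φ > 0`. Nothing is needed if `θ + ψ ≤ π/2`;
otherwise `φ` is the excess `θ + ψ - π/2`. -/
theorem exists_rotation_sector_of_nonneg {β θ : ℝ} (hβ : 0 ≤ β) (hθ0 : 0 ≤ θ)
    (hθ : θ + Real.arctan β < π) :
    ∃ φ : ℝ, Real.cos φ = Real.sin (min (π - Real.arctan β - θ) (π / 2)) ∧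
      ∀ x y : ℝ, 0 ≤ x → |y| ≤ β * x →
        0 ≤ x * Real.cos (θ - φ) - y * Real.sin (θ - φ) := by
  set ψ := Real.arctan β with hψ
  have hψ0 : 0 ≤ ψ := Real.arctan_nonneg.2 hβ
  have hψ1 : ψ < π / 2 := Real.arctan_lt_pi_div_two β
  have hcos : 0 < Real.cos ψ := Real.cos_arctan_pos β
  have hsin : Real.sin ψ = β * Real.cos ψ := by
    conv_rhs => rw [← Real.tan_arctan β]
    rw [← hψ, Real.tan_mul_cos hcos.ne']
  rcases le_or_gt (θ + ψ) (π / 2) with h | h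
  · refine ⟨0, ?_, fun x y hx hxy => ?_⟩
    · rw [min_eq_right (by linarith), Real.cos_zero, Real.sin_pi_div_two]
    · rw [sub_zero]
      have hs : 0 ≤ Real.sin θ := Real.sin_nonneg_of_nonneg_of_le_pi hθ0 (by linarith)
      have hc : 0 ≤ Real.cos (θ + ψ) := Real.cos_nonneg_of_mem_Icc ⟨by linarith, h⟩
      rw [Real.cos_add, hsin] at hc
      have hc' : 0 ≤ Real.cos θ - β * Real.sin θ := by
        by_contra! hneg
        nlinarith
      have hy := (abs_le.1 hxy).2
      nlinarith [mul_nonneg hx hc', mul_le_mul_of_nonneg_right hy hs]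
  · refine ⟨θ + ψ - π / 2, ?_, fun x y hx hxy => ?_⟩
    · rw [min_eq_left (by linarith), Real.cos_sub_pi_div_two,
        show π - ψ - θ = π - (θ + ψ) by ring, Real.sin_pi_sub]
    · rw [show θ - (θ + ψ - π / 2) = π / 2 - ψ by ring, Real.cos_pi_div_two_sub,
        Real.sin_pi_div_two_sub, hsin]
      have hy := (abs_le.1 hxy).2
      nlinarith

theorem exists_rotation_sector {β θ : ℝ} (hβ : 0 ≤ β) (hθ : |θ| + Real.arctan β < π) :
    ∃ φ : ℝ, Real.cos φ = Real.sin (min (π - Real.arctan β - |θ|) (π / 2)) ∧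
      ∀ x y : ℝ, 0 ≤ x → |y| ≤ β * x →
        0 ≤ x * Real.cos (θ - φ) - y * Real.sin (θ - φ) := by
  rcases abs_cases θ with ⟨h, h'⟩ | ⟨h, h'⟩
  · rw [h] at hθ ⊢
    exact exists_rotation_sector_of_nonneg hβ h' hθ
  · rw [h] at hθ ⊢
    obtain ⟨φ, h1, h2⟩ := exists_rotation_sector_of_nonneg hβ (by linarith) hθ
    refine ⟨-φ, by rw [Real.cos_neg, h1], fun x y hx hxy => ?_⟩
    have := h2 x (-y) hx (by rwa [abs_neg])
    rw [show θ - -φ = -(-θ - φ) by ring, Real.cos_neg, Real.sin_neg]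
    linarith

section NumericalRange

variable {X : Type*} [NormedAddCommGroup X] [InnerProductSpace ℂ X]

theorem isUnit_and_norm_inverse_le [FiniteDimensional ℂ X] {S : X →L[ℂ] X} {m : ℝ} (hm : 0 < m)
    (h : ∀ v, m * ‖v‖ ≤ ‖S v‖) : IsUnit S ∧ ∀ f, ‖Ring.inverse S f‖ ≤ m⁻¹ * ‖f‖ := by
  have : CompleteSpace X := FiniteDimensional.complete ℂ X
  have hinj : Function.Injective (S : X →ₗ[ℂ] X) := by
    rw [← LinearMap.ker_eq_bot, LinearMap.ker_eq_bot']
    intro v hv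
    have h1 := h v
    rw [show S v = 0 from hv, norm_zero] at h1
    have h2 : ‖v‖ = 0 := by nlinarith [norm_nonneg v]
    exact norm_eq_zero.1 h2
  have hu : IsUnit S := ContinuousLinearMap.isUnit_iff_bijective.2
    ⟨hinj, LinearMap.injective_iff_surjective.1 hinj⟩
  refine ⟨hu, fun f => ?_⟩
  have h1 := h (Ring.inverse S f)
  have h2 : S (Ring.inverse S f) = f := by
    have := congrArg (fun B : X →L[ℂ] X => B f) (Ring.mul_inverse_cancel S hu)
    simpa using this
  rw [h2] at h1
  rwa [← div_eq_inv_mul, le_div_iff₀ hm, mul_comm]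

/-- Pair with `v`, multiply by `e^{-iφ}` and take real parts: the sector term becomes nonnegative,
the identity contributes `cos φ ‖v‖²`, and Cauchy-Schwarz finishes. -/
theorem norm_add_rotated_smul_ge {T : X →L[ℂ] X} {β : ℝ} (hβ : 0 ≤ β)
    (hre : ∀ v, 0 ≤ (inner ℂ v (T v)).re)
    (him : ∀ v, |(inner ℂ v (T v)).im| ≤ β * (inner ℂ v (T v)).re)
    {s θ : ℝ} (hs : 0 ≤ s) (hθ : |θ| + Real.arctan β < π) (v : X) :
    Real.sin (min (π - Real.arctan β - |θ|) (π / 2)) * ‖v‖ ≤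
      ‖(1 + (s * Complex.exp (θ * Complex.I)) • T) v‖ := by
  obtain ⟨φ, hφ, hsec⟩ := exists_rotation_sector hβ hθ
  rw [← hφ]
  rcases eq_or_ne v 0 with rfl | hv
  · simp
  have hvn : 0 < ‖v‖ := norm_pos_iff.2 hv
  set y : X := (1 + (s * Complex.exp (θ * Complex.I)) • T) v with hy
  have hinner : Complex.exp (((-φ : ℝ) : ℂ) * Complex.I) * inner ℂ v y =
      Complex.exp (((-φ : ℝ) : ℂ) * Complex.I) * (‖v‖ ^ 2 : ℝ)
        + s * (Complex.exp (((θ - φ : ℝ) : ℂ) * Complex.I) * inner ℂ v (T v)) := by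
    have : inner ℂ v y = (‖v‖ ^ 2 : ℝ)
        + (s * Complex.exp (θ * Complex.I)) * inner ℂ v (T v) := by
      rw [hy]
      simp only [add_apply, one_apply_eq_self,
        smul_apply, inner_add_right, inner_smul_right]
      rw [inner_self_eq_norm_sq_to_K]
      simp
    rw [this, show (((θ - φ : ℝ) : ℂ) * Complex.I) = ((-φ : ℝ) : ℂ) * Complex.I + θ * Complex.I by
      push_cast; ring, Complex.exp_add]
    ring
  have hre1 : Real.cos φ * ‖v‖ ^ 2 ≤
      (Complex.exp (((-φ : ℝ) : ℂ) * Complex.I) * inner ℂ v y).re := by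
    rw [hinner, Complex.add_re, Complex.re_mul_ofReal, Complex.re_ofReal_mul, Complex.mul_re,
      Complex.exp_ofReal_mul_I_re, Complex.exp_ofReal_mul_I_re, Complex.exp_ofReal_mul_I_im,
      Real.cos_neg]
    have := mul_nonneg hs (hsec _ _ (hre v) (him v))
    nlinarith
  have hle : (Complex.exp (((-φ : ℝ) : ℂ) * Complex.I) * inner ℂ v y).re ≤ ‖v‖ * ‖y‖ := by
    refine (Complex.re_le_norm _).trans ?_
    rw [norm_mul, Complex.norm_exp_ofReal_mul_I, one_mul]
    exact norm_inner_le_norm v y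
  have : ‖v‖ * (Real.cos φ * ‖v‖) ≤ ‖v‖ * ‖y‖ := by nlinarith
  exact le_of_mul_le_mul_left this hvn

/-- Resolvent bound for an operator whose numerical range lies in a sector. -/
theorem isUnit_and_norm_inverse_one_add_exp_smul_le [FiniteDimensional ℂ X] {T : X →L[ℂ] X}
    {β : ℝ} (hβ : 0 ≤ β) (hre : ∀ v, 0 ≤ (inner ℂ v (T v)).re)
    (him : ∀ v, |(inner ℂ v (T v)).im| ≤ β * (inner ℂ v (T v)).re)
    {z : ℂ} (hz : |z.im| + Real.arctan β < π) :
    IsUnit (1 + Complex.exp (-z) • T) ∧ ∀ f, ‖Ring.inverse (1 + Complex.exp (-z) • T) f‖ ≤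
      (Real.sin (min (π - Real.arctan β - |z.im|) (π / 2)))⁻¹ * ‖f‖ := by
  have e : Complex.exp (-z) = Real.exp (-z.re) * Complex.exp ((-z.im : ℝ) * Complex.I) := by
    rw [Complex.ofReal_exp, ← Complex.exp_add]
    congr 1
    apply Complex.ext <;> simp
  rw [e]
  refine isUnit_and_norm_inverse_le ?_ fun v => ?_
  · refine Real.sin_pos_of_pos_of_lt_pi (lt_min (by linarith) (by positivity)) ?_
    exact (min_le_right _ _).trans_lt (by linarith [Real.pi_pos])
  · have := norm_add_rotated_smul_ge hβ hre him (Real.exp_pos (-z.re)).le (θ := -z.im)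
      (by rwa [abs_neg]) v
    rwa [abs_neg] at this

/-- For real `t` no rotation is needed and coercivity is kept. With `c₀ = 0` this is contractivity;
with `c₀ > 0` it gives the extra decay at the left end. -/
theorem norm_inverse_one_add_smul_le [FiniteDimensional ℂ X] {T : X →L[ℂ] X}
    {c₀ : ℝ} (hc₀ : 0 ≤ c₀) (hre : ∀ v, c₀ * ‖v‖ ^ 2 ≤ (inner ℂ v (T v)).re)
    {t : ℝ} (ht : 0 ≤ t) (f : X) :
    ‖Ring.inverse (1 + (t : ℂ) • T) f‖ ≤ (1 + c₀ * t)⁻¹ * ‖f‖ := by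
  refine (isUnit_and_norm_inverse_le (by positivity) fun v => ?_).2 f
  rcases eq_or_ne v 0 with rfl | hv
  · simp
  have hvn : 0 < ‖v‖ := norm_pos_iff.2 hv
  have h1 : (inner ℂ v ((1 + (t : ℂ) • T) v)).re = ‖v‖ ^ 2 + t * (inner ℂ v (T v)).re := by
    simp only [add_apply, one_apply_eq_self,
      smul_apply, inner_add_right, inner_smul_right]
    rw [inner_self_eq_norm_sq_to_K, Complex.add_re, Complex.re_ofReal_mul]
    congr 1
    norm_cast
  have h2 := (Complex.re_le_norm _).trans (norm_inner_le_norm (𝕜 := ℂ) v ((1 + (t : ℂ) • T) v))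
  rw [h1] at h2
  have h3 := mul_le_mul_of_nonneg_left (hre v) ht
  have : ‖v‖ * ((1 + c₀ * t) * ‖v‖) ≤ ‖v‖ * ‖(1 + (t : ℂ) • T) v‖ := by nlinarith
  exact le_of_mul_le_mul_left this hvn

end NumericalRange

/-! ### The kernel in a strip -/

/-- Behind this is `2 cosh w + 2 cos a = 4 cosh((w+ia)/2) cosh((w-ia)/2)`, together with `|2
cosh(w/2)|² = 2 (cosh Re w + cos Im w)`. -/
theorem norm_sq_exp_add_exp_neg_add (u y a : ℝ) :
    ‖Complex.exp (u + y * Complex.I) + Complex.exp (-(u + y * Complex.I)) + 2 * Real.cos a‖ ^ 2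
      = 4 * ((Real.cosh u + Real.cos (y + a)) * (Real.cosh u + Real.cos (y - a))) := by
  have h1 : Complex.exp (u + y * Complex.I)
      = Real.exp u * (Real.cos y + Real.sin y * Complex.I) := by
    rw [Complex.exp_add, Complex.exp_mul_I]; simp
  have h2 : Complex.exp (-(u + y * Complex.I))
      = Real.exp (-u) * (Real.cos y - Real.sin y * Complex.I) := by
    rw [show -((u : ℂ) + y * Complex.I) = ((-u : ℝ) : ℂ) + ((-y : ℝ) : ℂ) * Complex.I by
      push_cast; ring, Complex.exp_add, Complex.exp_mul_I, ← Complex.ofReal_cos,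
      ← Complex.ofReal_sin, Real.cos_neg, Real.sin_neg]
    simp [sub_eq_add_neg]
  have h3 : Complex.exp (u + y * Complex.I) + Complex.exp (-(u + y * Complex.I)) + 2 * Real.cos a
      = ((Real.exp u + Real.exp (-u)) * Real.cos y + 2 * Real.cos a : ℝ)
        + ((Real.exp u - Real.exp (-u)) * Real.sin y : ℝ) * Complex.I := by
    rw [h1, h2]; push_cast; ring
  have h4 : Real.exp u * Real.exp (-u) = 1 := by rw [← Real.exp_add]; simp
  have hy := Real.sin_sq_add_cos_sq y
  have ha := Real.sin_sq_add_cos_sq a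
  rw [h3, ← Complex.normSq_eq_norm_sq, Complex.normSq_add_mul_I, Real.cosh_eq, Real.cos_add,
    Real.cos_sub]
  linear_combination (4 * Real.cos y ^ 2 - 4) * h4
    + ((Real.exp u - Real.exp (-u)) ^ 2 + 4 * Real.sin a ^ 2) * hy
    + (4 - 4 * Real.cos y ^ 2) * ha

/-- Translating by `log b` reduces the dependence on `b` to the factor `1/b`. -/
theorem fracKernel_eq_inv {α b : ℝ} (hb : 0 < b) (x y : ℝ) :
    fracKernel α b (x + y * Complex.I) = (b * (Complex.exp (((x - Real.log b : ℝ) : ℂ)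
      + y * Complex.I) + Complex.exp (-(((x - Real.log b : ℝ) : ℂ) + y * Complex.I))
      + 2 * Real.cos (π * α)))⁻¹ := by
  have hb' : (b : ℂ) ≠ 0 := by exact_mod_cast hb.ne'
  have hl : Complex.exp (Real.log b : ℂ) = b := by
    rw [← Complex.ofReal_exp, Real.exp_log hb]
  have e1 : (b : ℂ) * Complex.exp (((x - Real.log b : ℝ) : ℂ) + y * Complex.I)
      = Complex.exp (x + y * Complex.I) := by
    nth_rw 1 [← hl]
    rw [← Complex.exp_add]
    congr 1
    push_cast
    ring
  have e2 : (b : ℂ) * Complex.exp (-(((x - Real.log b : ℝ) : ℂ) + y * Complex.I))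
      = b ^ 2 * Complex.exp (-(x + y * Complex.I)) := by
    have : Complex.exp (-(((x - Real.log b : ℝ) : ℂ) + y * Complex.I))
        = b * Complex.exp (-(x + y * Complex.I)) := by
      conv_rhs => rw [← hl, ← Complex.exp_add]
      congr 1
      push_cast
      ring
    rw [this]
    ring
  rw [fracKernel, mul_add, mul_add, e1, e2]
  congr 1
  ring

/-- For `y ≥ 0` only the factor with `y + πα` degenerates as `y` nears `(1-α)π`, and it is at least
`cosh u - cos ε`. The other stays comparable to `cosh u`. -/
theorem exists_cosh_add_cos_ge {α : ℝ} (h0 : 0 < α) (h1 : α < 1) :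
    ∃ p : ℝ, 0 < p ∧ ∀ ε y u : ℝ, 0 < ε → |y| ≤ (1 - α) * π - ε →
      p * Real.cosh u * (Real.cosh u - Real.cos ε) ≤
        (Real.cosh u + Real.cos (y + π * α)) * (Real.cosh u + Real.cos (y - π * α)) := by
  have hπ := Real.pi_pos
  -- The largest possible `|y - πα|` for `0 ≤ y ≤ (1-α)π`; it is less than `π`.
  set m : ℝ := max (π * α) (π - 2 * (π * α)) with hm
  have hm0 : 0 < m := lt_max_of_lt_left (by positivity)
  have hmπ : m < π := max_lt (by nlinarith) (by nlinarith)
  have hcm : -1 < Real.cos m := by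
    have := Real.cos_lt_cos_of_nonneg_of_le_pi hm0.le le_rfl hmπ
    rwa [Real.cos_pi] at this
  refine ⟨min 1 (1 + Real.cos m), lt_min one_pos (by linarith), fun ε y u hε hy => ?_⟩
  wlog hy0 : 0 ≤ y generalizing y
  · have := this (-y) (by rwa [abs_neg]) (by linarith)
    rw [show -y + π * α = -(y - π * α) by ring, show -y - π * α = -(y + π * α) by ring,
      Real.cos_neg, Real.cos_neg] at this
    linarith
  rw [abs_of_nonneg hy0] at hy
  have hC : 1 ≤ Real.cosh u := Real.one_le_cosh u
  have f1 : Real.cosh u - Real.cos ε ≤ Real.cosh u + Real.cos (y + π * α) := by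
    have := Real.cos_le_cos_of_nonneg_of_le_pi (x := y + π * α) (y := π - ε) (by positivity)
      (by linarith) (by linarith)
    rw [Real.cos_pi_sub] at this
    linarith
  have f2 : min 1 (1 + Real.cos m) * Real.cosh u ≤ Real.cosh u + Real.cos (y - π * α) := by
    have h2 : |y - π * α| ≤ m := by
      rw [abs_le]
      constructor
      · have : π * α ≤ m := le_max_left _ _
        linarith
      · have : π - 2 * (π * α) ≤ m := le_max_right _ _
        linarith
    have h3 : Real.cos m ≤ Real.cos (y - π * α) := by
      rw [← Real.cos_abs (y - π * α)]
      exact Real.cos_le_cos_of_nonneg_of_le_pi (abs_nonneg _) hmπ.le h2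
    have h4 : min 1 (1 + Real.cos m) * Real.cosh u ≤ Real.cosh u + Real.cos m := by
      rcases le_or_gt 0 (Real.cos m) with h | h
      · rw [min_eq_left (by linarith)]; linarith
      · rw [min_eq_right (by linarith)]; nlinarith
    linarith
  have h5 : 0 ≤ Real.cosh u - Real.cos ε := by linarith [Real.cos_le_one ε]
  have h6 : 0 ≤ min 1 (1 + Real.cos m) * Real.cosh u :=
    mul_nonneg (le_min zero_le_one (by linarith)) (by linarith)
  calc _ ≤ (Real.cosh u + Real.cos (y - π * α)) * (Real.cosh u + Real.cos (y + π * α)) :=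
        mul_le_mul f2 f1 h5 (h6.trans f2)
    _ = _ := mul_comm _ _

theorem one_add_sq_div_two_le_cosh (u : ℝ) : 1 + u ^ 2 / 2 ≤ Real.cosh u := by
  rw [← Real.cosh_abs, ← sq_abs]
  have h1 : |u| / 2 ≤ Real.sinh (|u| / 2) := Real.self_le_sinh_iff.2 (by positivity)
  have h2 := Real.cosh_two_mul (|u| / 2)
  rw [mul_div_cancel₀ _ two_ne_zero, Real.cosh_sq] at h2
  rw [h2]
  nlinarith [abs_nonneg u]

theorem exp_abs_le_two_mul_cosh (u : ℝ) : Real.exp |u| ≤ 2 * Real.cosh u := by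
  rw [← Real.cosh_abs, Real.cosh_eq]
  linarith [Real.exp_pos (-|u|)]

/-- An integrable majorant for the reciprocal of `√(cosh u (cosh u - cos ε))`. -/
noncomputable def coshMajorant (ε u : ℝ) : ℝ :=
  4 * (Real.exp (-|u|) + (Set.Icc (-1) 1).indicator (fun u => (|u| + ε)⁻¹) u)

theorem integrable_coshMajorant {ε : ℝ} (hε : 0 < ε) : Integrable (coshMajorant ε) := by
  refine (integrable_exp_neg_abs.add ?_).const_mul 4
  rw [integrable_indicator_iff measurableSet_Icc]
  refine ContinuousOn.integrableOn_Icc (Continuous.continuousOn ?_)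
  exact Continuous.inv₀ (by fun_prop) fun u => by positivity

/-- The peak `1/(|u| + ε)` is the source of the logarithm in `C(τ)`. -/
theorem integral_coshMajorant {ε : ℝ} (hε : 0 < ε) :
    ∫ u, coshMajorant ε u = 8 * (1 + Real.log ((1 + ε) / ε)) := by
  have h1 : ∀ u : ℝ, coshMajorant ε u = (fun u =>
      4 * (Real.exp (-u) + (Set.Iic 1).indicator (fun u => (u + ε)⁻¹) u)) |u| := by
    intro u
    simp only [coshMajorant, Set.indicator_apply, Set.mem_Icc, Set.mem_Iic, abs_le]
  have hc : ContinuousOn (fun u : ℝ => (u + ε)⁻¹) (Set.Icc 0 1) := by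
    refine ContinuousOn.inv₀ (by fun_prop) fun u hu => ?_
    have := hu.1
    positivity
  have h2 : IntegrableOn ((Set.Iic 1).indicator (fun u : ℝ => (u + ε)⁻¹)) (Set.Ioi 0) := by
    rw [IntegrableOn, integrable_indicator_iff measurableSet_Iic, IntegrableOn,
      Measure.restrict_restrict measurableSet_Iic, Set.Iic_inter_Ioi]
    exact hc.integrableOn_Icc.mono_set Set.Ioc_subset_Icc_self
  have h3 : ∫ u in Set.Ioi (0 : ℝ), (Set.Iic 1).indicator (fun u : ℝ => (u + ε)⁻¹) u
      = Real.log ((1 + ε) / ε) := by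
    rw [integral_indicator measurableSet_Iic, Measure.restrict_restrict measurableSet_Iic,
      Set.Iic_inter_Ioi, ← intervalIntegral.integral_of_le zero_le_one,
      intervalIntegral.integral_comp_add_right (fun u : ℝ => u⁻¹),
      integral_inv_of_pos (by linarith) (by linarith), zero_add]
  have h4 : IntegrableOn (fun u : ℝ => Real.exp (-u)) (Set.Ioi 0) :=
    (exp_neg_integrableOn_Ioi 0 one_pos).congr_fun (fun x _ => by simp) measurableSet_Ioi
  rw [integral_congr_ae (Eventually.of_forall h1), integral_comp_abs (f := fun u : ℝ =>
      4 * (Real.exp (-u) + (Set.Iic 1).indicator (fun u => (u + ε)⁻¹) u)), integral_const_mul,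
    integral_add h4 h2, integral_exp_neg_Ioi_zero, h3]
  ring

/-- For `|u| ≤ 1`, `cosh u - cos ε ≥ u²/2 + ε²/5 ≥ (|u| + ε)²/10`. For `|u| > 1`, `cosh u > 3/2`, so
subtracting `cos ε ≤ 1` leaves at least a third of `cosh u`. -/
theorem inv_sqrt_le_coshMajorant {ε : ℝ} (hε : 0 < ε) (hεπ : ε ≤ π) (u : ℝ) :
    (√(Real.cosh u * (Real.cosh u - Real.cos ε)))⁻¹ ≤ coshMajorant ε u := by
  have hC := one_add_sq_div_two_le_cosh u
  have hC1 : 1 ≤ Real.cosh u := Real.one_le_cosh u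
  rw [coshMajorant]
  rcases le_or_gt |u| 1 with h | h
  · rw [Set.indicator_of_mem (Set.mem_Icc.2 (abs_le.1 h))]
    have hcos := Real.cos_le_one_sub_mul_cos_sq (x := ε) (by rwa [abs_of_pos hε])
    have hπ2 : (1 / 5 : ℝ) ≤ 2 / π ^ 2 := by
      rw [div_le_div_iff₀ (by norm_num) (by positivity)]
      nlinarith [Real.pi_lt_d2, Real.pi_pos]
    have h1 : (|u| + ε) ^ 2 / 10 ≤ Real.cosh u - Real.cos ε := by
      have h2 : 1 / 5 * ε ^ 2 ≤ 2 / π ^ 2 * ε ^ 2 := mul_le_mul_of_nonneg_right hπ2 (sq_nonneg ε)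
      nlinarith [sq_nonneg (|u| - ε), sq_abs u, sq_nonneg u]
    have hpos : 0 < |u| + ε := by positivity
    have h2 : (|u| + ε) / 4 ≤ √(Real.cosh u * (Real.cosh u - Real.cos ε)) := by
      refine Real.le_sqrt_of_sq_le ?_
      have h3 : 0 ≤ Real.cosh u - Real.cos ε := le_trans (by positivity) h1
      nlinarith [sq_nonneg (|u| + ε)]
    calc _ ≤ ((|u| + ε) / 4)⁻¹ := inv_anti₀ (by positivity) h2
      _ = 4 * (|u| + ε)⁻¹ := by rw [inv_div, div_eq_mul_inv]
      _ ≤ _ := by nlinarith [Real.exp_pos (-|u|)]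
  · rw [Set.indicator_of_notMem (fun h' => absurd (abs_le.2 (Set.mem_Icc.1 h')) (not_le.2 h)), add_zero]
    have hu2 : 1 < u ^ 2 := by rw [← sq_abs]; nlinarith
    have h1 : Real.cosh u / 3 ≤ Real.cosh u - Real.cos ε := by
      linarith [Real.cos_le_one ε]
    have h2 : Real.exp |u| / 4 ≤ √(Real.cosh u * (Real.cosh u - Real.cos ε)) := by
      refine Real.le_sqrt_of_sq_le ?_
      have h3 := exp_abs_le_two_mul_cosh u
      have h4 := Real.exp_pos |u|
      nlinarith
    calc _ ≤ (Real.exp |u| / 4)⁻¹ := inv_anti₀ (by positivity) h2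
      _ = _ := by rw [inv_div, div_eq_mul_inv, Real.exp_neg]

theorem norm_fracKernel_eq {α b : ℝ} (hb : 0 < b) (x y : ℝ) :
    ‖fracKernel α b (x + y * Complex.I)‖ = (2 * b)⁻¹ *
      (√((Real.cosh (x - Real.log b) + Real.cos (y + π * α)) *
        (Real.cosh (x - Real.log b) + Real.cos (y - π * α))))⁻¹ := by
  have h := norm_sq_exp_add_exp_neg_add (x - Real.log b) y (π * α)
  rw [fracKernel_eq_inv hb, norm_inv, norm_mul, Complex.norm_real, Real.norm_of_nonneg hb.le,
    ← Real.sqrt_sq (norm_nonneg (_ + 2 * (Real.cos (π * α) : ℂ))), h,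
    show (4 : ℝ) = 2 ^ 2 by norm_num, Real.sqrt_mul (by positivity), Real.sqrt_sq zero_le_two,
    ← mul_inv]
  congr 1
  ring

theorem exists_norm_fracKernel_le {α : ℝ} (h0 : 0 < α) (h1 : α < 1) :
    ∃ K : ℝ, 0 < K ∧ ∀ b ε x y : ℝ, 0 < b → 0 < ε → |y| ≤ (1 - α) * π - ε →
      ‖fracKernel α b (x + y * Complex.I)‖ ≤ K / b *
        (√(Real.cosh (x - Real.log b) * (Real.cosh (x - Real.log b) - Real.cos ε)))⁻¹ := by
  obtain ⟨p, hp, hge⟩ := exists_cosh_add_cos_ge h0 h1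
  refine ⟨2⁻¹ * (√p)⁻¹, by positivity, fun b ε x y hb hε hy => ?_⟩
  have hεπ : ε < π := by
    have := abs_nonneg y
    nlinarith [Real.pi_pos]
  have hcos : Real.cos ε < 1 := by
    have := Real.cos_lt_cos_of_nonneg_of_le_pi le_rfl hεπ.le hε
    rwa [Real.cos_zero] at this
  have hC := Real.one_le_cosh (x - Real.log b)
  have hpos : 0 < Real.cosh (x - Real.log b) * (Real.cosh (x - Real.log b) - Real.cos ε) :=
    mul_pos (by linarith) (by linarith)
  rw [norm_fracKernel_eq hb]
  have h2 : √p * √(Real.cosh (x - Real.log b) * (Real.cosh (x - Real.log b) - Real.cos ε)) ≤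
      √((Real.cosh (x - Real.log b) + Real.cos (y + π * α)) *
        (Real.cosh (x - Real.log b) + Real.cos (y - π * α))) := by
    rw [← Real.sqrt_mul hp.le, ← mul_assoc]
    exact Real.sqrt_le_sqrt (hge ε y _ hε hy)
  have h3 := inv_anti₀ (mul_pos (Real.sqrt_pos.2 hp) (Real.sqrt_pos.2 hpos)) h2
  rw [mul_inv] at h3
  calc _ ≤ (2 * b)⁻¹ * _ := mul_le_mul_of_nonneg_left h3 (by positivity)
    _ = _ := by rw [mul_inv, div_eq_mul_inv]; ring

/-! ### The infinite trapezoidal sum -/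

theorem fracKernel_denom_ne_zero {α b : ℝ} (h0 : 0 < α) (h1 : α < 1) (hb : 0 < b) {z : ℂ}
    (hz : |z.im| < (1 - α) * π) :
    Complex.exp z + 2 * b * Real.cos (π * α) + b ^ 2 * Complex.exp (-z) ≠ 0 := by
  intro h
  -- The inverse of `0` is `0`, so a vanishing denominator would contradict the positive formula for
  -- the norm of the kernel.
  have hk : fracKernel α b (z.re + z.im * Complex.I) = 0 := by
    rw [Complex.re_add_im, fracKernel, h, inv_zero]
  obtain ⟨p, hp, hge⟩ := exists_cosh_add_cos_ge h0 h1
  set ε := (1 - α) * π - |z.im| with hε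
  have hε0 : 0 < ε := by linarith
  have hεπ : ε ≤ π := by
    have := abs_nonneg z.im
    nlinarith [Real.pi_pos]
  have hge' := hge ε z.im (z.re - Real.log b) hε0 (by linarith)
  have hC := Real.one_le_cosh (z.re - Real.log b)
  have hcos : Real.cos ε < 1 := by
    have := Real.cos_lt_cos_of_nonneg_of_le_pi le_rfl hεπ hε0
    rwa [Real.cos_zero] at this
  have hpos : 0 < p * Real.cosh (z.re - Real.log b) *
      (Real.cosh (z.re - Real.log b) - Real.cos ε) :=
    mul_pos (mul_pos hp (by linarith)) (by linarith)
  have hn := norm_fracKernel_eq (α := α) hb z.re z.im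
  rw [hk, norm_zero] at hn
  have hs := Real.sqrt_pos.2 (hpos.trans_le hge')
  have : 0 < (2 * b)⁻¹ * (√((Real.cosh (z.re - Real.log b) + Real.cos (z.im + π * α)) *
      (Real.cosh (z.re - Real.log b) + Real.cos (z.im - π * α))))⁻¹ := by positivity
  linarith

/-- Needed only to justify contour shifts and Poisson summation: `C` may depend on `b` and `ε`,
because it does not enter the final bound. -/
theorem exists_norm_fracKernel_le_exp_neg_abs {α b ε : ℝ} (h0 : 0 < α) (h1 : α < 1) (hb : 0 < b)
    (hε : 0 < ε) (hεπ : ε < π) :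
    ∃ C : ℝ, ∀ z : ℂ, |z.im| ≤ (1 - α) * π - ε →
      ‖fracKernel α b z‖ ≤ C * Real.exp (-|z.re|) := by
  obtain ⟨K, hK, hle⟩ := exists_norm_fracKernel_le h0 h1
  have hq : 0 < 1 - |Real.cos ε| := by
    have hs := Real.sin_pos_of_pos_of_lt_pi hε hεπ
    have : |Real.cos ε| < 1 := by
      rw [abs_lt]
      constructor <;> nlinarith [Real.sin_sq_add_cos_sq ε]
    linarith
  set q := 1 - |Real.cos ε| with hqd
  refine ⟨K / b * ((√q)⁻¹ * (2 * Real.exp |Real.log b|)), fun z hz => ?_⟩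
  have h2 := hle b ε z.re z.im hb hε hz
  rw [Complex.re_add_im] at h2
  refine h2.trans ?_
  rw [mul_assoc]
  refine mul_le_mul_of_nonneg_left ?_ (by positivity)
  set u := z.re - Real.log b with hu
  have hC := Real.one_le_cosh u
  have h3 : √q * Real.cosh u ≤ √(Real.cosh u * (Real.cosh u - Real.cos ε)) := by
    rw [← Real.sqrt_sq (by linarith : 0 ≤ Real.cosh u), ← Real.sqrt_mul hq.le,
      Real.sqrt_sq (by linarith : 0 ≤ Real.cosh u)]
    refine Real.sqrt_le_sqrt ?_
    have h4 := le_abs_self (Real.cos ε)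
    have h5 := abs_nonneg (Real.cos ε)
    have h6 : q * Real.cosh u ≤ Real.cosh u - Real.cos ε := by
      rw [hqd]
      nlinarith
    nlinarith
  have h4 : Real.exp |z.re| ≤ Real.exp |Real.log b| * (2 * Real.cosh u) := by
    refine le_trans ?_ (mul_le_mul_of_nonneg_left (exp_abs_le_two_mul_cosh u) (Real.exp_pos _).le)
    rw [← Real.exp_add]
    refine Real.exp_le_exp.2 ?_
    calc |z.re| = |Real.log b + u| := by rw [hu]; congr 1; ring
      _ ≤ _ := abs_add_le _ _
  have hsq := Real.sqrt_pos.2 hq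
  calc _ ≤ (√q * Real.cosh u)⁻¹ := inv_anti₀ (by positivity) h3
    _ = (√q)⁻¹ * (Real.cosh u)⁻¹ := mul_inv _ _
    _ ≤ (√q)⁻¹ * ((2 * Real.exp |Real.log b|) * Real.exp (-|z.re|)) := by
        refine mul_le_mul_of_nonneg_left ?_ (by positivity)
        rw [Real.exp_neg, ← div_eq_mul_inv, le_div_iff₀ (Real.exp_pos _),
          inv_mul_le_iff₀ (by linarith)]
        linarith
    _ = _ := by ring

theorem exists_integral_norm_fracKernel_le {α : ℝ} (h0 : 0 < α) (h1 : α < 1) :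
    ∃ K : ℝ, 0 < K ∧ ∀ b ε y : ℝ, 0 < b → 0 < ε → |y| ≤ (1 - α) * π - ε →
      ∫ x : ℝ, ‖fracKernel α b (x + y * Complex.I)‖ ≤ K / b * (1 + |Real.log ε|) := by
  obtain ⟨K, hK, hle⟩ := exists_norm_fracKernel_le h0 h1
  -- As `ε < π < 4`, `1 + log((1+ε)/ε) ≤ 5 (1 + |log ε|)`, and `40 = 8 · 5`.
  refine ⟨K * 40, by positivity, fun b ε y hb hε hy => ?_⟩
  have hεπ : ε < π := by
    have := abs_nonneg y
    nlinarith [Real.pi_pos]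
  have hint : Integrable fun x => K / b * coshMajorant ε (x - Real.log b) :=
    ((integrable_coshMajorant hε).comp_sub_right _).const_mul _
  calc ∫ x : ℝ, ‖fracKernel α b (x + y * Complex.I)‖
      ≤ ∫ x : ℝ, K / b * coshMajorant ε (x - Real.log b) := by
        refine integral_mono_of_nonneg (Eventually.of_forall fun x => norm_nonneg _) hint
          (Eventually.of_forall fun x => ?_)
        exact (hle b ε x y hb hε hy).trans
          (mul_le_mul_of_nonneg_left (inv_sqrt_le_coshMajorant hε hεπ.le _) (by positivity))
    _ = K / b * (8 * (1 + Real.log ((1 + ε) / ε))) := by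
        rw [integral_const_mul, integral_sub_right_eq_self, integral_coshMajorant hε]
    _ ≤ K / b * (40 * (1 + |Real.log ε|)) := by
        refine mul_le_mul_of_nonneg_left ?_ (by positivity)
        rw [Real.log_div (by positivity) hε.ne']
        have l1 := Real.log_le_sub_one_of_pos (by linarith : 0 < 1 + ε)
        have l2 := neg_abs_le (Real.log ε)
        have l3 := abs_nonneg (Real.log ε)
        linarith [Real.pi_lt_four]
    _ = _ := by ring

/-- `e^y + b² e^{-y} = 2b cosh(y - log b)`. Centring at `log b` gains the factor `1/b`. -/
theorem norm_fracKernel_ofReal_le_exp_sub_log {α b : ℝ} (h0 : 0 < α) (h1 : α < 1) (hb : 1 ≤ b)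
    (y : ℝ) : ‖fracKernel α b y‖ ≤
      (1 - |Real.cos (π * α)|)⁻¹ / b * Real.exp (-|y - Real.log b|) := by
  have hc := abs_cos_pi_mul_lt_one h0 h1
  have hb0 : 0 < b := by linarith
  refine (norm_fracKernel_ofReal_le h0 h1 hb y).trans ?_
  rw [div_mul_eq_mul_div, mul_div_assoc]
  refine mul_le_mul_of_nonneg_left ?_ (inv_nonneg.2 (by linarith))
  rw [Real.exp_neg |_|, ← one_div, ← one_div, div_div, mul_comm]
  refine one_div_le_one_div_of_le (by positivity) ?_
  have e1 := Real.exp_pos y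
  have e2 : 0 < b ^ 2 * Real.exp (-y) := by positivity
  rcases abs_cases (y - Real.log b) with ⟨h, -⟩ | ⟨h, -⟩
  · rw [h, Real.exp_sub, Real.exp_log hb0, div_mul_cancel₀ _ hb0.ne']
    linarith
  · rw [h, neg_sub, Real.exp_sub, Real.exp_log hb0]
    have : b / Real.exp y * b = b ^ 2 * Real.exp (-y) := by
      rw [Real.exp_neg]; ring
    linarith

theorem hasSum_exp_neg_abs_int_mul {τ : ℝ} (hτ : 0 < τ) :
    HasSum (fun n : ℤ => Real.exp (-|n * τ|))
      (1 + 2 * (Real.exp (-τ) / (1 - Real.exp (-τ)))) := by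
  have hr1 : Real.exp (-τ) < 1 := by rw [Real.exp_lt_one_iff]; linarith
  have h := hasSum_geometric_succ (Real.exp_pos (-τ)).le hr1
  have hp : ∀ n : ℕ, Real.exp (-τ) ^ (n + 1) = Real.exp (-(((n : ℝ) + 1) * τ)) := by
    intro n
    rw [← Real.exp_nat_mul]
    push_cast
    congr 1
    ring
  simp only [hp] at h
  have h1 : HasSum (fun n : ℕ => Real.exp (-|((n : ℤ) : ℝ) * τ|))
      (1 + Real.exp (-τ) / (1 - Real.exp (-τ))) := by
    have h2 : HasSum (fun n : ℕ => Real.exp (-|(((n + 1 : ℕ) : ℤ) : ℝ) * τ|))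
        (Real.exp (-τ) / (1 - Real.exp (-τ))) := by
      refine h.congr_fun fun n => ?_
      push_cast
      rw [abs_of_nonneg (by positivity)]
    have := (hasSum_nat_add_iff (f := fun n : ℕ => Real.exp (-|((n : ℤ) : ℝ) * τ|)) 1).1 h2
    simpa [add_comm] using this
  have h3 : HasSum (fun n : ℕ => Real.exp (-|((-((n : ℤ) + 1) : ℤ) : ℝ) * τ|))
        (Real.exp (-τ) / (1 - Real.exp (-τ))) := by
    refine h.congr_fun fun n => ?_
    rw [Int.cast_neg, Int.cast_add, Int.cast_natCast, Int.cast_one, neg_mul, abs_neg, abs_of_nonneg (by positivity)]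
  have h4 := h1.of_nat_of_neg_add_one (f := fun n : ℤ => Real.exp (-|n * τ|)) h3
  rwa [add_assoc, ← two_mul] at h4

/-- The quantity is `τ/(e^τ - 1)`; the step length thus absorbs the geometric series uniformly in
`τ`. -/
theorem mul_exp_neg_div_le_one {τ : ℝ} (hτ : 0 < τ) :
    τ * (Real.exp (-τ) / (1 - Real.exp (-τ))) ≤ 1 := by
  have hr1 : Real.exp (-τ) < 1 := by rw [Real.exp_lt_one_iff]; linarith
  rw [mul_div_assoc', div_le_one (by linarith), Real.exp_neg, ← div_eq_mul_inv,
    div_le_iff₀ (Real.exp_pos _), sub_mul, inv_mul_cancel₀ (Real.exp_pos _).ne']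
  linarith [Real.add_one_le_exp τ]

/-- Replacing the centre `a` by the nearest node to its left shifts exponents by at most `τ`, hence
the factor `e^τ`. -/
theorem summable_exp_neg_abs_sub {τ : ℝ} (hτ : 0 < τ) (a : ℝ) :
    Summable (fun n : ℤ => Real.exp (-|n * τ - a|)) ∧
      τ * ∑' n : ℤ, Real.exp (-|n * τ - a|) ≤ Real.exp τ * (τ + 2) := by
  have hs := hasSum_exp_neg_abs_int_mul hτ
  set k : ℤ := ⌊a / τ⌋ with hk
  have hs' : HasSum (fun n : ℤ => Real.exp τ * Real.exp (-|((n - k : ℤ) : ℝ) * τ|))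
      (Real.exp τ * (1 + 2 * (Real.exp (-τ) / (1 - Real.exp (-τ))))) :=
    ((Equiv.subRight k).hasSum_iff.2 hs).mul_left _
  have hle : ∀ n : ℤ, Real.exp (-|n * τ - a|) ≤
      Real.exp τ * Real.exp (-|((n - k : ℤ) : ℝ) * τ|) := by
    intro n
    rw [← Real.exp_add]
    refine Real.exp_le_exp.2 ?_
    have h1 : |k * τ - a| ≤ τ := by
      have l1 : (k : ℝ) ≤ a / τ := Int.floor_le _
      have l2 : a / τ < k + 1 := Int.lt_floor_add_one _
      rw [le_div_iff₀ hτ] at l1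
      rw [div_lt_iff₀ hτ] at l2
      rw [abs_le]
      constructor <;> linarith
    have h2 : |((n - k : ℤ) : ℝ) * τ| ≤ |n * τ - a| + |k * τ - a| := by
      rw [show ((n - k : ℤ) : ℝ) * τ = (n * τ - a) - (k * τ - a) by push_cast; ring]
      exact abs_sub _ _
    linarith
  refine ⟨Summable.of_nonneg_of_le (fun n => (Real.exp_pos _).le) hle hs'.summable, ?_⟩
  have hsum : Summable (fun n : ℤ => Real.exp (-|n * τ - a|)) :=
    Summable.of_nonneg_of_le (fun n => (Real.exp_pos _).le) hle hs'.summable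
  have := hsum.tsum_le_tsum hle hs'.summable
  rw [hs'.tsum_eq] at this
  calc _ ≤ τ * (Real.exp τ * (1 + 2 * (Real.exp (-τ) / (1 - Real.exp (-τ))))) :=
        mul_le_mul_of_nonneg_left this hτ.le
    _ = Real.exp τ * (τ + 2 * (τ * (Real.exp (-τ) / (1 - Real.exp (-τ))))) := by ring
    _ ≤ _ := by
        refine mul_le_mul_of_nonneg_left ?_ (Real.exp_pos _).le
        linarith [mul_exp_neg_div_le_one hτ]

/-! ### The operator-valued integrand: bounds, analyticity, summability -/

section Operator

variable {X : Type*} [NormedAddCommGroup X] [InnerProductSpace ℂ X]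

/-- The integrand in the resolvent representation of `(T^α + b)⁻¹ f`. -/
noncomputable def resolventIntegrand (α b : ℝ) (T : X →L[ℂ] X) (f : X) (z : ℂ) : X :=
  fracKernel α b z • Ring.inverse (1 + Complex.exp (-(z / α)) • T) f

variable [FiniteDimensional ℂ X] {T : X →L[ℂ] X} {α b β τ : ℝ}

theorem norm_resolventIntegrand_ofReal_le (h0 : 0 < α) (h1 : α < 1) (hb : 1 ≤ b)
    (hre : ∀ v, 0 ≤ (inner ℂ v (T v)).re) (f : X) (y : ℝ) :
    ‖resolventIntegrand α b T f y‖ ≤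
      (1 - |Real.cos (π * α)|)⁻¹ / b * Real.exp (-|y - Real.log b|) * ‖f‖ := by
  rw [resolventIntegrand, norm_smul]
  have h2 := norm_inverse_one_add_smul_le le_rfl (by simpa using hre)
    (Real.exp_pos (-(y / α))).le f
  rw [zero_mul, add_zero, inv_one, one_mul] at h2
  have e : Complex.exp (-((y : ℂ) / α)) = (Real.exp (-(y / α)) : ℂ) := by push_cast; rfl
  rw [e]
  exact mul_le_mul (norm_fracKernel_ofReal_le_exp_sub_log h0 h1 hb y) h2 (norm_nonneg _)
    ((norm_nonneg _).trans (norm_fracKernel_ofReal_le_exp_sub_log h0 h1 hb y))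

theorem differentiableAt_resolventIntegrand (h0 : 0 < α) (h1 : α < 1) (hb : 0 < b)
    (hβ : 0 ≤ β) (hre : ∀ v, 0 ≤ (inner ℂ v (T v)).re)
    (him : ∀ v, |(inner ℂ v (T v)).im| ≤ β * (inner ℂ v (T v)).re) (f : X) {z : ℂ}
    (hz1 : |z.im| < (1 - α) * π) (hz2 : |z.im| / α + Real.arctan β < π) :
    DifferentiableAt ℂ (resolventIntegrand α b T f) z := by
  have : CompleteSpace X := FiniteDimensional.complete ℂ X
  have hk : DifferentiableAt ℂ (fracKernel α b) z :=
    (by fun_prop : DifferentiableAt ℂ (fun z => Complex.exp z + 2 * b * Real.cos (π * α)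
      + b ^ 2 * Complex.exp (-z)) z).inv (fracKernel_denom_ne_zero h0 h1 hb hz1)
  have him' : |(z / α).im| + Real.arctan β < π := by
    rwa [Complex.div_ofReal_im, abs_div, abs_of_pos h0]
  have hu := (isUnit_and_norm_inverse_one_add_exp_smul_le hβ hre him him').1
  have hd : DifferentiableAt ℂ (fun z : ℂ => (1 : X →L[ℂ] X) + Complex.exp (-(z / α)) • T) z := by
    fun_prop
  have hi : DifferentiableAt ℂ
      (fun z : ℂ => Ring.inverse ((1 : X →L[ℂ] X) + Complex.exp (-(z / α)) • T)) z :=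
    DifferentiableAt.comp (g := Ring.inverse) z (differentiableAt_inverse hu) hd
  exact hk.smul (hi.clm_apply (differentiableAt_const f))

theorem norm_resolventIntegrand_le (h0 : 0 < α) (hβ : 0 ≤ β)
    (hre : ∀ v, 0 ≤ (inner ℂ v (T v)).re)
    (him : ∀ v, |(inner ℂ v (T v)).im| ≤ β * (inner ℂ v (T v)).re) (f : X) {z : ℂ} {d : ℝ}
    (hz : |z.im| ≤ d) (hd : d / α + Real.arctan β < π) :
    ‖resolventIntegrand α b T f z‖ ≤ ‖fracKernel α b z‖ *
      ((Real.sin (min (π - Real.arctan β - d / α) (π / 2)))⁻¹ * ‖f‖) := by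
  have e : |(z / α).im| = |z.im| / α := by
    rw [Complex.div_ofReal_im, abs_div, abs_of_pos h0]
  have hle : |z.im| / α ≤ d / α := div_le_div_of_nonneg_right hz h0.le
  have h2 := (isUnit_and_norm_inverse_one_add_exp_smul_le hβ hre him (z := z / α)
    (by rw [e]; linarith)).2 f
  rw [resolventIntegrand, norm_smul]
  refine mul_le_mul_of_nonneg_left (h2.trans (mul_le_mul_of_nonneg_right ?_ (norm_nonneg _)))
    (norm_nonneg _)
  have hpos : 0 < min (π - Real.arctan β - d / α) (π / 2) :=
    lt_min (by linarith) (by positivity)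
  refine inv_anti₀ (Real.sin_pos_of_pos_of_lt_pi hpos
    ((min_le_right _ _).trans_lt (by linarith [Real.pi_pos]))) ?_
  refine Real.sin_le_sin_of_le_of_le_pi_div_two (by linarith [Real.pi_pos]) (min_le_right _ _) ?_
  rw [e]
  exact min_le_min_right _ (by linarith)

theorem integrable_resolventIntegrand (h0 : 0 < α) (h1 : α < 1) (hb : 1 ≤ b) (hβ : 0 ≤ β)
    (hre : ∀ v, 0 ≤ (inner ℂ v (T v)).re)
    (him : ∀ v, |(inner ℂ v (T v)).im| ≤ β * (inner ℂ v (T v)).re) (f : X) :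
    Integrable (fun y : ℝ => resolventIntegrand α b T f y) := by
  refine (((integrable_exp_neg_abs.comp_sub_right (Real.log b)).const_mul
    ((1 - |Real.cos (π * α)|)⁻¹ / b)).mul_const ‖f‖).mono' ?_ (Eventually.of_forall
      (norm_resolventIntegrand_ofReal_le h0 h1 hb hre f))
  refine Continuous.aestronglyMeasurable (continuous_iff_continuousAt.2 fun y => ?_)
  have h2 : ContinuousAt (resolventIntegrand α b T f) (y : ℂ) :=
    (differentiableAt_resolventIntegrand h0 h1 (by linarith) hβ hre him f
      (by simpa using by nlinarith [Real.pi_pos])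
      (by simpa using (Real.arctan_lt_pi_div_two β).trans (by linarith [Real.pi_pos]))).continuousAt
  exact ContinuousAt.comp (f := fun y : ℝ => (y : ℂ)) h2 (by fun_prop)

theorem summable_resolventIntegrand (h0 : 0 < α) (h1 : α < 1) (hb : 1 ≤ b)
    (hre : ∀ v, 0 ≤ (inner ℂ v (T v)).re) (hτ : 0 < τ) (f : X) :
    Summable (fun n : ℤ => resolventIntegrand α b T f (n * τ)) := by
  have : CompleteSpace X := FiniteDimensional.complete ℂ X
  refine Summable.of_norm_bounded (((summable_exp_neg_abs_sub hτ (Real.log b)).1.mul_left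
    ((1 - |Real.cos (π * α)|)⁻¹ / b)).mul_right ‖f‖) fun n => ?_
  have := norm_resolventIntegrand_ofReal_le h0 h1 hb hre f (n * τ)
  simpa using this

/-- A crude bound of the integral and the sum separately, for the case that `d/τ` is too small for
the exponential estimate to help. -/
theorem norm_integral_sub_tsum_resolventIntegrand_le_of_norm (h0 : 0 < α) (h1 : α < 1)
    (hb : 1 ≤ b) (hre : ∀ v, 0 ≤ (inner ℂ v (T v)).re) (hτ : 0 < τ) (hτπ : τ < π) (f : X) :
    ‖(∫ y : ℝ, resolventIntegrand α b T f y)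
        - (τ : ℂ) • ∑' n : ℤ, resolventIntegrand α b T f (n * τ)‖ ≤
      ((1 - |Real.cos (π * α)|)⁻¹ * (2 + Real.exp π * (π + 2))) / b * ‖f‖ := by
  have hc := abs_cos_pi_mul_lt_one h0 h1
  set c := (1 - |Real.cos (π * α)|)⁻¹ with hcd
  have hc0 : 0 ≤ c := inv_nonneg.2 (by linarith)
  have i1 : ‖∫ y : ℝ, resolventIntegrand α b T f y‖ ≤ c / b * 2 * ‖f‖ := by
    refine (norm_integral_le_of_norm_le (((integrable_exp_neg_abs.comp_sub_right
      (Real.log b)).const_mul (c / b)).mul_const ‖f‖) (Eventually.of_forall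
      (norm_resolventIntegrand_ofReal_le h0 h1 hb hre f))).trans_eq ?_
    rw [integral_mul_const, integral_const_mul,
      integral_sub_right_eq_self (fun x : ℝ => Real.exp (-|x|)), integral_exp_neg_abs]
  obtain ⟨hs, hle⟩ := summable_exp_neg_abs_sub hτ (Real.log b)
  have i2 : ‖∑' n : ℤ, resolventIntegrand α b T f (n * τ)‖ ≤
      c / b * (∑' n : ℤ, Real.exp (-|n * τ - Real.log b|)) * ‖f‖ := by
    refine tsum_of_norm_bounded ((hs.hasSum.mul_left (c / b)).mul_right ‖f‖) fun n => ?_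
    have := norm_resolventIntegrand_ofReal_le h0 h1 hb hre f (n * τ)
    simpa using this
  have hle' : Real.exp τ * (τ + 2) ≤ Real.exp π * (π + 2) :=
    mul_le_mul (Real.exp_le_exp.2 hτπ.le) (by linarith) (by linarith) (Real.exp_pos _).le
  calc _ ≤ c / b * 2 * ‖f‖
        + τ * (c / b * (∑' n : ℤ, Real.exp (-|n * τ - Real.log b|)) * ‖f‖) := by
        refine (norm_sub_le _ _).trans (add_le_add i1 ?_)
        rw [norm_smul, Complex.norm_real, Real.norm_of_nonneg hτ.le]
        exact mul_le_mul_of_nonneg_left i2 hτ.le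
    _ = c / b * (2 + τ * ∑' n : ℤ, Real.exp (-|n * τ - Real.log b|)) * ‖f‖ := by ring
    _ ≤ c / b * (2 + Real.exp π * (π + 2)) * ‖f‖ := by
        have hb0 : 0 < b := by linarith
        refine mul_le_mul_of_nonneg_right (mul_le_mul_of_nonneg_left ?_ (by positivity))
          (norm_nonneg _)
        linarith
    _ = _ := by ring

end Operator

/-! ### Discretization error of the infinite sum -/

section Operator

variable {X : Type*} [NormedAddCommGroup X] [InnerProductSpace ℂ X]
variable [FiniteDimensional ℂ X] {T : X →L[ℂ] X} {α b β τ : ℝ}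

/-- Poisson summation is available for scalar functions, so the integrand is paired with the error
vector `e` itself: the scalar error is `‖e‖²`, the bound is linear in `‖e‖`, and one factor cancels.
-/
theorem norm_integral_sub_tsum_resolventIntegrand_le (h0 : 0 < α) (h1 : α < 1) {K : ℝ}
    (hK : ∀ b ε y : ℝ, 0 < b → 0 < ε → |y| ≤ (1 - α) * π - ε →
      ∫ x : ℝ, ‖fracKernel α b (x + y * Complex.I)‖ ≤ K / b * (1 + |Real.log ε|))
    (hb : 1 ≤ b) (hβ : 0 ≤ β)
    (hre : ∀ v, 0 ≤ (inner ℂ v (T v)).re)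
    (him : ∀ v, |(inner ℂ v (T v)).im| ≤ β * (inner ℂ v (T v)).re) (hτ : 0 < τ)
    {d ε : ℝ} (hd : 0 < d) (hε : 0 < ε) (hdε : d ≤ (1 - α) * π - ε)
    (hd2 : d / α + Real.arctan β < π) (f : X) :
    ‖(∫ y : ℝ, resolventIntegrand α b T f y)
        - (τ : ℂ) • ∑' n : ℤ, resolventIntegrand α b T f (n * τ)‖ ≤
      2 * K / b * ((Real.sin (min (π - Real.arctan β - d / α) (π / 2)))⁻¹ * (1 + |Real.log ε|))
        * (Real.exp (-(2 * π * d / τ)) / (1 - Real.exp (-(2 * π * d / τ)))) * ‖f‖ := by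
  have : CompleteSpace X := FiniteDimensional.complete ℂ X
  have hb0 : 0 < b := by linarith
  have hεπ : ε < π := by nlinarith [Real.pi_pos]
  set e := (∫ y : ℝ, resolventIntegrand α b T f y)
        - (τ : ℂ) • ∑' n : ℤ, resolventIntegrand α b T f (n * τ) with he
  set s := (Real.sin (min (π - Real.arctan β - d / α) (π / 2)))⁻¹ with hs
  have hs0 : 0 < s := by
    refine inv_pos.2 (Real.sin_pos_of_pos_of_lt_pi (lt_min (by linarith) (by positivity)) ?_)
    exact (min_le_right _ _).trans_lt (by linarith [Real.pi_pos])
  set ρ := Real.exp (-(2 * π * d / τ)) / (1 - Real.exp (-(2 * π * d / τ))) with hρ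
  have hρ0 : 0 ≤ ρ := by
    refine div_nonneg (Real.exp_pos _).le (sub_nonneg.2 (Real.exp_le_one_iff.2 ?_))
    have : 0 < 2 * π * d / τ := by positivity
    linarith
  set F : ℂ → ℂ := fun z => inner ℂ e (resolventIntegrand α b T f z) with hF
  have hFle : ∀ z : ℂ, |z.im| ≤ d → ‖F z‖ ≤ ‖fracKernel α b z‖ * (‖e‖ * (s * ‖f‖)) := by
    intro z hz
    refine (norm_inner_le_norm _ _).trans ?_
    have := mul_le_mul_of_nonneg_left
      (norm_resolventIntegrand_le (b := b) h0 hβ hre him f hz hd2) (norm_nonneg e)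
    refine this.trans_eq ?_
    ring
  obtain ⟨C, hC⟩ := exists_norm_fracKernel_le_exp_neg_abs h0 h1 hb0 hε hεπ
  have htrap := norm_integral_sub_trapezoid_le (f := F) (C := C * (‖e‖ * (s * ‖f‖))) hd hτ
    (fun z hz => by
      have hdz := differentiableAt_resolventIntegrand h0 h1 hb0 hβ hre him f (z := z)
        (by linarith) ((add_le_add_left (div_le_div_of_nonneg_right hz h0.le) _).trans_lt hd2)
      exact ((innerSL ℂ e).differentiableAt).comp z hdz)
    (fun z hz => by
      refine (hFle z hz).trans ?_
      have := mul_le_mul_of_nonneg_right (hC z (hz.trans hdε))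
        (by positivity : 0 ≤ ‖e‖ * (s * ‖f‖))
      refine this.trans_eq ?_
      ring)
  have hee : (∫ x : ℝ, F x) - τ * ∑' n : ℤ, F (n * τ) = inner ℂ e e := by
    have a1 : ∫ x : ℝ, F x = inner ℂ e (∫ y : ℝ, resolventIntegrand α b T f y) :=
      integral_inner (integrable_resolventIntegrand h0 h1 hb hβ hre him f) e
    have a2 : ∑' n : ℤ, F (n * τ) = inner ℂ e (∑' n : ℤ, resolventIntegrand α b T f (n * τ)) :=
      ((innerSL ℂ e).map_tsum (summable_resolventIntegrand h0 h1 hb hre hτ f)).symm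
    rw [a1, a2, ← inner_smul_right, ← inner_sub_right]
  rw [hee, inner_self_eq_norm_sq_to_K] at htrap
  have hint : ∀ y : ℝ, |y| = d → ∫ x : ℝ, ‖F (x + y * Complex.I)‖ ≤
      K / b * (1 + |Real.log ε|) * (‖e‖ * (s * ‖f‖)) := by
    intro y hy
    by_cases hi : Integrable fun x : ℝ => ‖fracKernel α b (x + y * Complex.I)‖
    · calc ∫ x : ℝ, ‖F (x + y * Complex.I)‖
          ≤ ∫ x : ℝ, ‖fracKernel α b (x + y * Complex.I)‖ * (‖e‖ * (s * ‖f‖)) :=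
            integral_mono_of_nonneg (Eventually.of_forall fun x => norm_nonneg _)
              (hi.mul_const _) (Eventually.of_forall fun x => hFle _ (by simpa using hy.le))
        _ = (∫ x : ℝ, ‖fracKernel α b (x + y * Complex.I)‖) * (‖e‖ * (s * ‖f‖)) :=
            integral_mul_const _ _
        _ ≤ _ := mul_le_mul_of_nonneg_right (hK b ε y hb0 hε (hy.le.trans hdε)) (by positivity)
    · refine absurd ?_ hi
      refine (integrable_exp_neg_abs.const_mul C).mono' ?_ (Eventually.of_forall fun x => ?_)
      · refine Continuous.aestronglyMeasurable (continuous_iff_continuousAt.2 fun x => ?_)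
        have hz : |((x : ℂ) + y * Complex.I).im| < (1 - α) * π := by
          simp only [Complex.add_im, Complex.ofReal_im, Complex.mul_im, Complex.ofReal_re,
            Complex.I_im, mul_one, Complex.I_re, mul_zero, add_zero, zero_add, hy]
          linarith
        have h2 : ContinuousAt (fracKernel α b) ((x : ℂ) + y * Complex.I) :=
          ContinuousAt.inv₀ (by fun_prop) (fracKernel_denom_ne_zero h0 h1 hb0 hz)
        exact (ContinuousAt.comp (f := fun x : ℝ => ((x : ℂ) + y * Complex.I)) h2
          (by fun_prop)).norm
      · rw [norm_norm]
        have := hC (x + y * Complex.I) (by simpa using hy.le.trans hdε)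
        simpa using this
  have i1 := hint d (abs_of_pos hd)
  have i2 := hint (-d) (by rw [abs_neg, abs_of_pos hd])
  simp only [Complex.ofReal_neg, neg_mul, ← sub_eq_add_neg] at i2
  have hsum := mul_le_mul_of_nonneg_right (add_le_add i1 i2) hρ0
  have hfin := htrap.trans hsum
  have hne : ‖((‖e‖ : ℂ)) ^ 2‖ = ‖e‖ * ‖e‖ := by
    rw [norm_pow, Complex.norm_real, norm_norm, sq]
  have hne' : ‖e‖ * ‖e‖ ≤ ‖e‖ * (2 * K / b * (s * (1 + |Real.log ε|)) * ρ * ‖f‖) := by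
    calc ‖e‖ * ‖e‖ = ‖((‖e‖ : ℂ)) ^ 2‖ := hne.symm
      _ ≤ _ := hfin
      _ = _ := by ring
  -- For `e = 0` the right side must be seen to be nonnegative; the sign of `K` follows from its
  -- bounding an integral of norms.
  rcases (norm_nonneg e).eq_or_lt with h | h
  · rw [← h]
    have hK0 : 0 ≤ K / b * (1 + |Real.log ε|) :=
      (integral_nonneg fun x => norm_nonneg _).trans
        (hK b ε d hb0 hε (by rwa [abs_of_pos hd]))
    have : 0 ≤ K / b * (1 + |Real.log ε|) * (2 * s * ρ * ‖f‖) := by positivity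
    refine this.trans_eq ?_
    ring
  · exact le_of_mul_le_mul_left hne' h

theorem exp_neg_div_one_sub_le {x : ℝ} (hx : 1 ≤ x) :
    Real.exp (-x) / (1 - Real.exp (-x)) ≤ 2 * Real.exp (-x) := by
  have h1 : Real.exp (-x) ≤ 1 / 2 := by
    rw [Real.exp_neg, ← one_div]
    exact one_div_le_one_div_of_le two_pos (by linarith [Real.add_one_le_exp x])
  rw [div_le_iff₀ (by linarith)]
  nlinarith [Real.exp_pos (-x)]

theorem inv_sin_min_ge_one {δ : ℝ} (hδ : 0 < δ) : 1 ≤ (Real.sin (min δ (π / 2)))⁻¹ :=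
  (one_le_inv₀ (Real.sin_pos_of_pos_of_lt_pi (lt_min hδ (by positivity))
    ((min_le_right _ _).trans_lt (by linarith [Real.pi_pos])))).2 (Real.sin_le_one _)

/-- Lets error terms that lack the factor `C(τ)` be absorbed into it. -/
theorem one_le_quadFactor (h0 : 0 < α) (h1 : α < 1) (hτ : 0 < τ) :
    1 ≤ quadFactor α β τ := by
  have aux : ∀ {s l : ℝ}, 1 ≤ s → 0 ≤ l → 1 ≤ s * (1 + l) := fun hs hl => by nlinarith
  unfold quadFactor
  split_ifs with h
  · refine aux (inv_sin_min_ge_one ?_) (abs_nonneg _)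
    have e1 : 0 < (kappa₁ α β - kappa₂ α) / α := div_pos (by linarith) h0
    have e2 : 0 < (1 - α) / α * τ := mul_pos (div_pos (by linarith) h0) hτ
    linarith
  · exact aux (inv_sin_min_ge_one hτ) (abs_nonneg _)

/-- Error of the infinite trapezoidal sum. -/
theorem exists_norm_integral_sub_tsum_resolventIntegrand_le (h0 : 0 < α) (h1 : α < 1) :
    ∃ K : ℝ, 0 < K ∧ ∀ {X : Type} [NormedAddCommGroup X] [InnerProductSpace ℂ X]
      [FiniteDimensional ℂ X] (T : X →L[ℂ] X) (β b τ : ℝ) (_ : 0 ≤ β) (_ : 1 ≤ b)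
      (_ : ∀ v, 0 ≤ (inner ℂ v (T v)).re)
      (_ : ∀ v, |(inner ℂ v (T v)).im| ≤ β * (inner ℂ v (T v)).re)
      (_ : 0 < τ) (_ : τ < π - Real.arctan β) (f : X),
      ‖(∫ y : ℝ, resolventIntegrand α b T f y)
          - (τ : ℂ) • ∑' n : ℤ, resolventIntegrand α b T f (n * τ)‖ ≤
        K / b * quadFactor α β τ * Real.exp (-(2 * π * kappaMin α β / τ)) * ‖f‖ := by
  obtain ⟨K, hK0, hK⟩ := exists_integral_norm_fracKernel_le h0 h1
  have hc := abs_cos_pi_mul_lt_one h0 h1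
  set c := (1 - |Real.cos (π * α)|)⁻¹ * (2 + Real.exp π * (π + 2)) with hcd
  have hc0 : 0 < c := mul_pos (inv_pos.2 (by linarith)) (by positivity)
  set ℓ := 1 + |Real.log (1 - α)| with hℓ
  have hℓ1 : 1 ≤ ℓ := by have := abs_nonneg (Real.log (1 - α)); linarith
  refine ⟨4 * K * ℓ * Real.exp (2 * π) + c * Real.exp (1 + 2 * π), by positivity, ?_⟩
  intro X _ _ _ T β b τ hβ hb hre him hτ hτ2 f
  have hb0 : 0 < b := by linarith
  have harc := Real.arctan_nonneg.2 hβ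
  have hτπ : τ < π := by linarith
  have hQ1 := one_le_quadFactor (β := β) h0 h1 hτ
  set Q := quadFactor α β τ with hQ
  -- If `κ₁ > κ₂`, take `d = κ₂ - (1-α)τ`: the poles are at distance `ε = (1-α)τ`, whose logarithm
  -- costs the factor `ℓ`. Otherwise `d = κ₁ - ατ` and `ε = κ₂ - κ₁ + ατ`. In both cases `π - arctan
  -- β - d/α` is exactly the angle in `C(τ)`.
  obtain ⟨d, ε, hd, hε, hdε, hd2, hκd, hfac⟩ : ∃ d ε : ℝ, 0 < d ∧ 0 < ε ∧
      d ≤ (1 - α) * π - ε ∧ d / α + Real.arctan β < π ∧ kappaMin α β ≤ d + τ ∧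
      (Real.sin (min (π - Real.arctan β - d / α) (π / 2)))⁻¹ * (1 + |Real.log ε|) ≤ ℓ * Q := by
    rcases lt_or_ge (kappa₂ α) (kappa₁ α β) with h | h
    · have hδ : π - Real.arctan β - (1 - α) * (π - τ) / α
          = (kappa₁ α β - kappa₂ α) / α + (1 - α) / α * τ := by
        unfold kappa₁ kappa₂; field_simp; ring
      have hδ0 : 0 < (kappa₁ α β - kappa₂ α) / α + (1 - α) / α * τ :=
        add_pos (div_pos (by linarith) h0) (mul_pos (div_pos (by linarith) h0) hτ)
      refine ⟨(1 - α) * (π - τ), (1 - α) * τ, mul_pos (by linarith) (by linarith),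
        mul_pos (by linarith) hτ, by linarith, by linarith, ?_, ?_⟩
      · refine (min_le_right _ _).trans ?_
        unfold kappa₂
        nlinarith
      · rw [hδ, hQ, quadFactor, if_pos h, Real.log_mul (by linarith) hτ.ne']
        have hs := inv_sin_min_ge_one hδ0
        set s := (Real.sin (min ((kappa₁ α β - kappa₂ α) / α + (1 - α) / α * τ) (π / 2)))⁻¹
        have ha := abs_add_le (Real.log (1 - α)) (Real.log τ)
        have hb1 := abs_nonneg (Real.log (1 - α))
        have hb2 := abs_nonneg (Real.log τ)
        rw [mul_left_comm]
        refine mul_le_mul_of_nonneg_left ?_ (by linarith)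
        rw [hℓ]
        nlinarith
    · have hδ : π - Real.arctan β - α * (π - Real.arctan β - τ) / α = τ := by
        field_simp; ring
      have hε : kappa₂ α - kappa₁ α β + α * τ
          = (1 - α) * π - α * (π - Real.arctan β - τ) := by
        unfold kappa₁ kappa₂; ring
      refine ⟨α * (π - Real.arctan β - τ), kappa₂ α - kappa₁ α β + α * τ,
        mul_pos h0 (by linarith), ?_, by linarith, by linarith, ?_, ?_⟩
      · have := mul_pos h0 hτ
        linarith
      · refine (min_le_left _ _).trans ?_
        unfold kappa₁
        nlinarith
      · rw [hδ, hQ, quadFactor, if_neg (not_lt.2 h)]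
        have hs := inv_sin_min_ge_one hτ
        set s := (Real.sin (min τ (π / 2)))⁻¹
        refine le_mul_of_one_le_left ?_ hℓ1
        positivity
  have hexp : Real.exp (-(2 * π * d / τ)) ≤
      Real.exp (2 * π) * Real.exp (-(2 * π * kappaMin α β / τ)) := by
    rw [← Real.exp_add]
    refine Real.exp_le_exp.2 ?_
    have h2 : kappaMin α β / τ ≤ d / τ + 1 := by
      rw [div_add_one hτ.ne']
      exact div_le_div_of_nonneg_right hκd hτ.le
    have h3 := mul_le_mul_of_nonneg_left h2 Real.two_pi_pos.le
    rw [mul_div_assoc, mul_div_assoc]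
    linarith
  set E := Real.exp (-(2 * π * kappaMin α β / τ)) with hE
  have hE0 : 0 < E := Real.exp_pos _
  -- For large `2πd/τ` the geometric denominator is harmless. Otherwise `e^{-2πκ/τ}` is bounded
  -- below and the crude bound suffices.
  rcases le_or_gt 1 (2 * π * d / τ) with hx | hx
  · refine (norm_integral_sub_tsum_resolventIntegrand_le h0 h1 hK hb hβ hre him hτ hd hε hdε hd2
      f).trans (mul_le_mul_of_nonneg_right ?_ (norm_nonneg f))
    have h4 := (exp_neg_div_one_sub_le hx).trans (mul_le_mul_of_nonneg_left hexp zero_le_two)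
    have h5 : 0 ≤ Real.exp (-(2 * π * d / τ)) / (1 - Real.exp (-(2 * π * d / τ))) :=
      div_nonneg (Real.exp_pos _).le (sub_nonneg.2 (Real.exp_le_one_iff.2 (by linarith)))
    calc _ ≤ 2 * K / b * (ℓ * Q) * (2 * (Real.exp (2 * π) * E)) :=
          mul_le_mul (mul_le_mul_of_nonneg_left hfac (by positivity)) h4 h5 (by positivity)
      _ = (4 * K * ℓ * Real.exp (2 * π)) / b * Q * E := by ring
      _ ≤ _ := by
        gcongr
        exact le_add_of_nonneg_right (by positivity)
  · refine (norm_integral_sub_tsum_resolventIntegrand_le_of_norm h0 h1 hb hre hτ hτπ f).trans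
      (mul_le_mul_of_nonneg_right ?_ (norm_nonneg f))
    have h6 : 1 ≤ Real.exp (1 + 2 * π) * E := by
      have h7 : Real.exp (-1) ≤ Real.exp (-(2 * π * d / τ)) := Real.exp_le_exp.2 (by linarith)
      have h8 := mul_le_mul_of_nonneg_left (h7.trans hexp) (Real.exp_pos 1).le
      rw [← Real.exp_add, add_neg_cancel, Real.exp_zero, ← mul_assoc, ← Real.exp_add] at h8
      exact h8
    calc c / b = c / b * (1 * 1) := by ring
      _ ≤ c / b * (Q * (Real.exp (1 + 2 * π) * E)) := by
          refine mul_le_mul_of_nonneg_left ?_ (by positivity)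
          exact mul_le_mul hQ1 h6 zero_le_one (by linarith)
      _ = (c * Real.exp (1 + 2 * π)) / b * Q * E := by ring
      _ ≤ _ := by
        gcongr
        exact le_add_of_nonneg_left (by positivity)

end Operator

/-! ### Truncation and balancing -/

section Operator

variable {X : Type*} [NormedAddCommGroup X] [InnerProductSpace ℂ X]
theorem quadSum_eq {T : X →L[ℂ] X} {α b τ : ℝ} (f : X) (M N : ℕ) :
    quadSum α b T f τ M N = ((Real.sin (π * α) / (α * π) : ℝ) : ℂ) •
      ((τ : ℂ) • ∑ n ∈ Finset.Icc (-(M : ℤ)) (N : ℤ), resolventIntegrand α b T f (n * τ)) := by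
  rw [quadSum, smul_smul, ← Complex.ofReal_mul]
  congr 1
  refine Finset.sum_congr rfl fun n _ => ?_
  have e1 : ((n : ℂ) * τ) = ((n * τ : ℝ) : ℂ) := by push_cast; rfl
  rw [resolventIntegrand, e1, fracKernel_ofReal]
  congr 3
  push_cast
  rw [neg_div]

variable [FiniteDimensional ℂ X] {T : X →L[ℂ] X} {α b β τ : ℝ}

theorem norm_resolventIntegrand_le_exp_neg (h0 : 0 < α) (h1 : α < 1) (hb : 1 ≤ b)
    (hre : ∀ v, 0 ≤ (inner ℂ v (T v)).re) (f : X) (y : ℝ) :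
    ‖resolventIntegrand α b T f y‖ ≤
      (1 - |Real.cos (π * α)|)⁻¹ * ‖f‖ * Real.exp (-y) := by
  have hc := abs_cos_pi_mul_lt_one h0 h1
  have hc0 : 0 ≤ (1 - |Real.cos (π * α)|)⁻¹ := inv_nonneg.2 (by linarith)
  rw [resolventIntegrand, norm_smul]
  have h2 := norm_inverse_one_add_smul_le le_rfl (by simpa using hre)
    (Real.exp_pos (-(y / α))).le f
  rw [zero_mul, add_zero, inv_one, one_mul] at h2
  have e : Complex.exp (-((y : ℂ) / α)) = (Real.exp (-(y / α)) : ℂ) := by push_cast; rfl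
  rw [e]
  have h3 : ‖fracKernel α b y‖ ≤ (1 - |Real.cos (π * α)|)⁻¹ * Real.exp (-y) := by
    refine (norm_fracKernel_ofReal_le h0 h1 hb y).trans (mul_le_mul_of_nonneg_left ?_ hc0)
    rw [Real.exp_neg y]
    exact inv_anti₀ (Real.exp_pos _) (le_add_of_nonneg_right (by positivity))
  refine (mul_le_mul h3 h2 (norm_nonneg _) (by positivity)).trans_eq ?_
  ring

/-- Both factors decay to the left: the kernel like `b⁻² e^y`, and, by coercivity, the resolvent
like `c₀⁻¹ e^{y/α}`. Hence the rate `1 + 1/α` and the dependence of `c'` on `c₀`. -/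
theorem norm_resolventIntegrand_le_exp (h0 : 0 < α) (h1 : α < 1) (hb : 1 ≤ b) {c₀ : ℝ}
    (hc₀ : 0 < c₀) (hre : ∀ v, c₀ * ‖v‖ ^ 2 ≤ (inner ℂ v (T v)).re) (f : X) (y : ℝ) :
    ‖resolventIntegrand α b T f y‖ ≤
      (1 - |Real.cos (π * α)|)⁻¹ * c₀⁻¹ * (b ^ 2)⁻¹ * ‖f‖ * Real.exp ((1 + α⁻¹) * y) := by
  have hc := abs_cos_pi_mul_lt_one h0 h1
  have hc0 : 0 ≤ (1 - |Real.cos (π * α)|)⁻¹ := inv_nonneg.2 (by linarith)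
  have hb0 : 0 < b := by linarith
  rw [resolventIntegrand, norm_smul]
  have h2 := norm_inverse_one_add_smul_le hc₀.le hre (Real.exp_pos (-(y / α))).le f
  have e : Complex.exp (-((y : ℂ) / α)) = (Real.exp (-(y / α)) : ℂ) := by push_cast; rfl
  rw [e]
  have h3 : ‖fracKernel α b y‖ ≤
      (1 - |Real.cos (π * α)|)⁻¹ * ((b ^ 2)⁻¹ * Real.exp y) := by
    refine (norm_fracKernel_ofReal_le h0 h1 hb y).trans (mul_le_mul_of_nonneg_left ?_ hc0)
    rw [← inv_inv (Real.exp y), ← Real.exp_neg, ← mul_inv]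
    exact inv_anti₀ (by positivity) (le_add_of_nonneg_left (by positivity))
  have h4 : (1 + c₀ * Real.exp (-(y / α)))⁻¹ ≤ c₀⁻¹ * Real.exp (y / α) := by
    rw [← inv_inv (Real.exp (y / α)), ← Real.exp_neg, ← mul_inv]
    exact inv_anti₀ (by positivity) (by linarith)
  have h5 := h2.trans (mul_le_mul_of_nonneg_right h4 (norm_nonneg f))
  refine (mul_le_mul h3 h5 (norm_nonneg _) (by positivity)).trans_eq ?_
  rw [show (1 + α⁻¹) * y = y + y / α by ring, Real.exp_add]
  ring

theorem hasSum_exp_neg_nat_add {γ τ : ℝ} (hγ : 0 < γ) (hτ : 0 < τ) (N : ℕ) :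
    HasSum (fun k : ℕ => Real.exp (-(γ * ((N : ℝ) + 1 + k) * τ)))
      (Real.exp (-(γ * N * τ)) * (Real.exp (-(γ * τ)) / (1 - Real.exp (-(γ * τ))))) := by
  have hpos : 0 < γ * τ := mul_pos hγ hτ
  have h := (hasSum_geometric_succ (Real.exp_pos (-(γ * τ))).le
    (by rw [Real.exp_lt_one_iff]; linarith)).mul_left (Real.exp (-(γ * N * τ)))
  refine h.congr_fun fun k => ?_
  rw [← Real.exp_nat_mul, ← Real.exp_add]
  congr 1
  push_cast
  ring

/-- The part of an exponentially decaying two-sided series that truncation neglects. -/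
theorem norm_tsum_sub_sum_Icc_le {G : ℤ → X} (hG : Summable G) {A B γ : ℝ}
    (hγ : 1 ≤ γ) (hτ : 0 < τ) (hA : 0 ≤ A) (hB : 0 ≤ B)
    (hpos : ∀ n, ‖G n‖ ≤ A * Real.exp (-(n * τ)))
    (hneg : ∀ n, ‖G n‖ ≤ B * Real.exp (γ * (n * τ))) (M N : ℕ) :
    ‖(τ : ℂ) • ∑' n, G n - (τ : ℂ) • ∑ n ∈ Finset.Icc (-(M : ℤ)) (N : ℤ), G n‖ ≤
      A * Real.exp (-(N * τ)) + B * Real.exp (-(γ * M * τ)) := by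
  have : CompleteSpace X := FiniteDimensional.complete ℂ X
  set S := Finset.Icc (-(M : ℤ)) (N : ℤ) with hS
  have h1 : HasSum (fun n => if n ∈ S then G n else 0) (∑ n ∈ S, G n) := by
    have : HasSum (fun n => if n ∈ S then G n else 0) (∑ n ∈ S, if n ∈ S then G n else 0) :=
      hasSum_sum_of_ne_finset_zero fun n hn => if_neg hn
    rwa [Finset.sum_congr rfl fun n hn => if_pos hn] at this
  have h2 := hG.hasSum.sub h1
  have hu : HasSum (fun n : ℤ => if (N : ℤ) < n then A * Real.exp (-(n * τ)) else 0)
      (A * (Real.exp (-(1 * N * τ)) * (Real.exp (-(1 * τ)) / (1 - Real.exp (-(1 * τ)))))) := by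
    have hinj : Function.Injective fun k : ℕ => (N : ℤ) + 1 + k := fun a b h => by
      simpa using h
    refine (hinj.hasSum_iff fun n hn => if_neg fun h => hn ⟨(n - N - 1).toNat, ?_⟩).1 ?_
    · simp only
      omega
    · refine ((hasSum_exp_neg_nat_add one_pos hτ N).mul_left A).congr_fun fun k => ?_
      rw [Function.comp_apply, if_pos (by omega)]
      push_cast
      rw [one_mul]
  have hv : HasSum (fun n : ℤ => if n < -(M : ℤ) then B * Real.exp (γ * (n * τ)) else 0)
      (B * (Real.exp (-(γ * M * τ)) * (Real.exp (-(γ * τ)) / (1 - Real.exp (-(γ * τ)))))) := by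
    have hinj : Function.Injective fun k : ℕ => -((M : ℤ) + 1 + k) := fun a b h => by
      simpa using h
    refine (hinj.hasSum_iff fun n hn => if_neg fun h => hn ⟨(-n - M - 1).toNat, ?_⟩).1 ?_
    · simp only
      omega
    · refine ((hasSum_exp_neg_nat_add (by linarith) hτ M).mul_left B).congr_fun fun k => ?_
      rw [Function.comp_apply, if_pos (by omega)]
      push_cast
      congr 2
      ring
  have hle : ‖(∑' n, G n) - ∑ n ∈ S, G n‖ ≤
      A * (Real.exp (-(1 * N * τ)) * (Real.exp (-(1 * τ)) / (1 - Real.exp (-(1 * τ)))))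
      + B * (Real.exp (-(γ * M * τ)) *
        (Real.exp (-(γ * τ)) / (1 - Real.exp (-(γ * τ))))) := by
    rw [← h2.tsum_eq]
    refine tsum_of_norm_bounded (hu.add hv) fun n => ?_
    by_cases hn : n ∈ S
    · rw [if_pos hn, sub_self, norm_zero]
      refine add_nonneg ?_ ?_ <;> split_ifs <;> positivity
    · rw [if_neg hn, sub_zero]
      rw [hS, Finset.mem_Icc, not_and_or, not_le, not_le] at hn
      rcases hn with hn | hn
      · rw [if_pos hn]
        refine (hneg n).trans (le_add_of_nonneg_left ?_)
        split_ifs <;> positivity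
      · rw [if_pos hn]
        refine (hpos n).trans (le_add_of_nonneg_right ?_)
        split_ifs <;> positivity
  have e1 := mul_exp_neg_div_le_one hτ
  -- Here `γ ≥ 1` enters, through `τ ≤ γτ`.
  have e2 : τ * (Real.exp (-(γ * τ)) / (1 - Real.exp (-(γ * τ)))) ≤ 1 := by
    have h3 := mul_exp_neg_div_le_one (mul_pos (by linarith : 0 < γ) hτ)
    refine le_trans (mul_le_mul_of_nonneg_right (by nlinarith) ?_) h3
    refine div_nonneg (Real.exp_pos _).le (sub_nonneg.2 (Real.exp_le_one_iff.2 ?_))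
    have : 0 < γ * τ := mul_pos (by linarith) hτ
    linarith
  rw [← smul_sub, norm_smul, Complex.norm_real, Real.norm_of_nonneg hτ.le]
  refine (mul_le_mul_of_nonneg_left hle hτ.le).trans ?_
  calc _
    _ = A * Real.exp (-(N * τ)) * (τ * (Real.exp (-τ) / (1 - Real.exp (-τ))))
        + B * Real.exp (-(γ * M * τ)) *
          (τ * (Real.exp (-(γ * τ)) / (1 - Real.exp (-(γ * τ))))) := by
        rw [one_mul, one_mul]; ring
    _ ≤ _ := add_le_add (mul_le_of_le_one_right (by positivity) e1)
        (mul_le_of_le_one_right (by positivity) e2)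

theorem semidiscrete_eq_integral (h0 : 0 < α) (h1 : α < 1) (hb : 1 ≤ b) (hβ : 0 ≤ β)
    (hre : ∀ v, 0 ≤ (inner ℂ v (T v)).re)
    (him : ∀ v, |(inner ℂ v (T v)).im| ≤ β * (inner ℂ v (T v)).re) {z₀ : ℂ} {R : ℝ}
    (hR : 0 < R) (hc : IsContourFor T z₀ R) (f : X) :
    semidiscrete α b T z₀ R f = ((Real.sin (π * α) / (α * π) : ℝ) : ℂ) •
      ∫ y : ℝ, resolventIntegrand α b T f y := by
  have : CompleteSpace X := FiniteDimensional.complete ℂ X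
  have hfp : fracPow α T z₀ R = dunford T z₀ R (fun z => z ^ (α : ℂ)) := rfl
  rw [semidiscrete, hfp, inverse_fracPow_add h0 h1 hb hR hc.1 hc.2, smul_apply]
  congr 1
  have e : ∀ y : ℝ, Complex.exp (-((y : ℂ) / α)) = (Real.exp (-y / α) : ℂ) := by
    intro y
    push_cast
    rw [neg_div]
  have hint : Integrable fun y : ℝ => fracKernel α b y •
      Ring.inverse (1 + (Real.exp (-y / α) : ℂ) • T) := by
    refine (integrable_exp_neg_abs.const_mul (1 - |Real.cos (π * α)|)⁻¹).mono' ?_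
      (Eventually.of_forall fun y => ?_)
    · refine Continuous.aestronglyMeasurable
        ((continuous_fracKernel_ofReal h0 h1 hb).smul (continuous_iff_continuousAt.2 fun y => ?_))
      have hu : IsUnit (1 + (Real.exp (-y / α) : ℂ) • T) := by
        rw [← e]
        refine (isUnit_and_norm_inverse_one_add_exp_smul_le hβ hre him ?_).1
        rw [Complex.div_ofReal_im, Complex.ofReal_im, zero_div, abs_zero, zero_add]
        linarith [Real.arctan_lt_pi_div_two β, Real.pi_pos]
      exact ContinuousAt.comp (g := Ring.inverse)
        (differentiableAt_inverse (𝕜 := ℂ) hu).continuousAt (by fun_prop)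
    · rw [norm_smul]
      have h2 : ‖Ring.inverse (1 + (Real.exp (-y / α) : ℂ) • T)‖ ≤ 1 := by
        refine ContinuousLinearMap.opNorm_le_bound _ zero_le_one fun f => ?_
        have := norm_inverse_one_add_smul_le le_rfl (by simpa using hre)
          (Real.exp_pos (-y / α)).le f
        rwa [zero_mul, add_zero, inv_one] at this
      exact mul_le_of_le_one_right (norm_nonneg _) h2 |>.trans
        (norm_fracKernel_ofReal_le_exp h0 h1 hb y)
  rw [ContinuousLinearMap.integral_apply hint]
  congr 1
  ext y
  rw [resolventIntegrand, e, smul_apply]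

end Operator

theorem kappaMin_nonneg {α β : ℝ} (h0 : 0 < α) (h1 : α < 1) : 0 ≤ kappaMin α β := by
  refine le_min (mul_nonneg h0.le ?_) (mul_nonneg (by linarith) Real.pi_pos.le)
  linarith [Real.arctan_lt_pi_div_two β, Real.pi_pos]

theorem kappaMin_le_pi {α β : ℝ} (h0 : 0 < α) : kappaMin α β ≤ π := by
  refine (min_le_right _ _).trans ?_
  unfold kappa₂
  nlinarith [Real.pi_pos]

/-- With balanced truncation all three error contributions are of the same size. -/
theorem balanced_error_le {α β b τ K₁ K₂ K₃ : ℝ} (h0 : 0 < α) (h1 : α < 1) (hb : 1 ≤ b)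
    (hτ : 0 < τ) (hτπ : τ < π) (hK₁ : 0 ≤ K₁) (hK₂ : 0 ≤ K₂) (hK₃ : 0 ≤ K₃) {M N : ℕ}
    (hM0 : 0 < balancedM α β b τ) (hM : |(M : ℝ) - balancedM α β b τ| ≤ 1)
    (hN : |(N : ℝ) - balancedN α β b τ| ≤ 1) :
    K₁ / b * quadFactor α β τ * Real.exp (-(2 * π * kappaMin α β / τ))
        + K₂ * Real.exp (-(N * τ)) + K₃ * (b ^ 2)⁻¹ * Real.exp (-((1 + α⁻¹) * M * τ))
      ≤ (K₁ + K₂ * Real.exp π + K₃ * Real.exp ((1 + α⁻¹) * π)) *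
          Real.exp (π * (2 + α⁻¹)) * quadFactor α β τ / b *
          Real.exp (-√(π * kappaMin α β * ((1 + α⁻¹) * M + N))) := by
  have hb0 : 0 < b := by linarith
  have hQ := one_le_quadFactor (β := β) h0 h1 hτ
  set Q := quadFactor α β τ
  have hκ0 := kappaMin_nonneg (β := β) h0 h1
  have hκπ := kappaMin_le_pi (β := β) h0
  set κ := kappaMin α β with hκ
  have hα1 : 0 < α⁻¹ := inv_pos.2 h0
  set γ := 1 + α⁻¹ with hγ
  have hγα : γ * (α / (α + 1)) = 1 := by rw [hγ]; field_simp
  set a := 2 * π * κ / τ with ha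
  have ha0 : 0 ≤ a := by positivity
  have hM' : balancedM α β b τ = α / (α + 1) * (2 * π * κ / τ ^ 2 - Real.log b / τ) := by
    unfold balancedM at hM0 ⊢
    rcases lt_max_iff.1 hM0 with h | h
    · exact max_eq_left h.le
    · exact absurd h (lt_irrefl _)
  -- Thus `e^{-γM*τ} = b e^{-a}` and, by the next identity, `e^{-N*τ} = e^{-a}/b`; the prefactor
  -- `b⁻²` of the left tail makes both tails equal to `e^{-a}/b`. Rounding costs a bounded factor
  -- because `τ < π`.
  have hγM : γ * balancedM α β b τ = (a - Real.log b) / τ := by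
    rw [hM', ← mul_assoc, hγα, ha]
    field_simp
  have hNa : balancedN α β b τ = (a + Real.log b) / τ := by
    unfold balancedN
    rw [← hκ, ha]
    field_simp
  set E := Real.exp (-a) with hE
  have hEb : Real.exp (-(a + Real.log b)) = E / b := by
    rw [neg_add, ← sub_eq_add_neg, Real.exp_sub, Real.exp_log hb0]
  have hEb' : Real.exp (-(a - Real.log b)) = E * b := by
    rw [neg_sub, sub_eq_add_neg, add_comm, Real.exp_add, Real.exp_log hb0]
  rw [abs_le] at hM hN
  have eN : Real.exp (-(N * τ)) ≤ Real.exp π * (E / b) := by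
    rw [← hEb, ← Real.exp_add]
    refine Real.exp_le_exp.2 ?_
    have : (balancedN α β b τ - 1) * τ ≤ N * τ := mul_le_mul_of_nonneg_right (by linarith) hτ.le
    rw [hNa, sub_mul, div_mul_cancel₀ _ hτ.ne'] at this
    linarith
  have eM : (b ^ 2)⁻¹ * Real.exp (-(γ * M * τ)) ≤ Real.exp (γ * π) * (E / b) := by
    have h2 : Real.exp (-(γ * M * τ)) ≤ Real.exp (γ * π) * (E * b) := by
      rw [← hEb', ← Real.exp_add]
      refine Real.exp_le_exp.2 ?_
      have h3 : γ * (balancedM α β b τ - 1) * τ ≤ γ * M * τ :=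
        mul_le_mul_of_nonneg_right (mul_le_mul_of_nonneg_left (by linarith) (by positivity)) hτ.le
      rw [mul_sub, hγM, mul_one, sub_mul, div_mul_cancel₀ _ hτ.ne'] at h3
      have h4 : γ * τ ≤ γ * π := mul_le_mul_of_nonneg_left hτπ.le (by positivity)
      linarith
    calc _ ≤ (b ^ 2)⁻¹ * (Real.exp (γ * π) * (E * b)) :=
          mul_le_mul_of_nonneg_left h2 (by positivity)
      _ = _ := by field_simp
  -- The logarithms cancel in `γM* + N* = 2a/τ`, and `πκ · 2a/τ = a²`. Rounding adds at most `γ +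
  -- 1`, which moves the square root by at most `π(γ + 1)`.
  have eE : E ≤ Real.exp (π * (γ + 1)) * Real.exp (-√(π * κ * (γ * M + N))) := by
    rw [← Real.exp_add]
    refine Real.exp_le_exp.2 ?_
    have h2 : √(π * κ * (γ * M + N)) ≤ a + π * (γ + 1) := by
      refine Real.sqrt_le_iff.2 ⟨by positivity, ?_⟩
      have h3 : γ * M ≤ γ * (balancedM α β b τ + 1) :=
        mul_le_mul_of_nonneg_left (by linarith) (by positivity)
      have h4 : γ * M + N ≤ 2 * a / τ + (γ + 1) := by
        rw [mul_add, hγM] at h3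
        have h5 : (N : ℝ) ≤ (a + Real.log b) / τ + 1 := by linarith
        have h6 : (a - Real.log b) / τ + (a + Real.log b) / τ = 2 * a / τ := by ring
        linarith
      have h7 : π * κ * (γ * M + N) ≤ π * κ * (2 * a / τ + (γ + 1)) :=
        mul_le_mul_of_nonneg_left h4 (by positivity)
      have h8 : π * κ * (2 * a / τ) = a ^ 2 := by rw [ha]; field_simp
      have h9 : π * κ * (γ + 1) ≤ (π * (γ + 1)) ^ 2 := by
        have hγ1 : 1 ≤ γ + 1 := by linarith
        calc π * κ * (γ + 1) ≤ π * π * (γ + 1) := by gcongr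
          _ ≤ π * π * (γ + 1) * (γ + 1) := le_mul_of_one_le_right (by positivity) hγ1
          _ = _ := by ring
      have h10 : 0 ≤ a * (π * (γ + 1)) := by positivity
      calc _ ≤ π * κ * (2 * a / τ) + π * κ * (γ + 1) := h7.trans_eq (mul_add _ _ _)
        _ ≤ a ^ 2 + (π * (γ + 1)) ^ 2 := add_le_add h8.le h9
        _ ≤ a ^ 2 + (π * (γ + 1)) ^ 2 + 2 * (a * (π * (γ + 1))) := by linarith
        _ = _ := by ring
    linarith
  have hγ2 : γ + 1 = 2 + α⁻¹ := by rw [hγ]; ring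
  rw [hγ2] at eE
  set W := Real.exp (-√(π * κ * (γ * M + N)))
  have hE0 : 0 < E := Real.exp_pos _
  have hQE : E / b ≤ Q * (E / b) := le_mul_of_one_le_left (by positivity) hQ
  calc _ ≤ K₁ / b * Q * E + K₂ * (Real.exp π * (Q * (E / b)))
        + K₃ * (Real.exp (γ * π) * (Q * (E / b))) := by
        rw [mul_assoc K₃]
        refine add_le_add (add_le_add le_rfl ?_) ?_
        · exact mul_le_mul_of_nonneg_left
            (eN.trans (mul_le_mul_of_nonneg_left hQE (Real.exp_pos _).le)) hK₂
        · exact mul_le_mul_of_nonneg_left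
            (eM.trans (mul_le_mul_of_nonneg_left hQE (Real.exp_pos _).le)) hK₃
    _ = (K₁ + K₂ * Real.exp π + K₃ * Real.exp (γ * π)) * Q / b * E := by ring
    _ ≤ (K₁ + K₂ * Real.exp π + K₃ * Real.exp (γ * π)) * Q / b *
          (Real.exp (π * (2 + α⁻¹)) * W) := mul_le_mul_of_nonneg_left eE (by positivity)
    _ = _ := by ring

/-! ### The sesquilinear form -/

theorem h1NormSq_nonneg {d : ℕ} {Ω : Set (EuclideanSpace ℝ (Fin d))} (v : L2 Ω) :
    0 ≤ h1NormSq Ω v :=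
  add_nonneg (sq_nonneg _) (Finset.sum_nonneg fun _ _ => sq_nonneg _)

/-- The index of a strongly elliptic continuous form is attained. -/
theorem formIndex_spec {d : ℕ} {Ω : Set (EuclideanSpace ℝ (Fin d))} {V : Set (L2 Ω)}
    {A : L2 Ω → L2 Ω → ℂ} {c₀ c₁ : ℝ} (hc₀ : 0 < c₀) (hell : IsStronglyElliptic V A c₀)
    (hcont : IsContinuousForm V A c₁) :
    0 ≤ formIndex V A ∧ ∀ v ∈ V, |(A v v).im| ≤ formIndex V A * (A v v).re := by
  have hne : {β | 0 ≤ β ∧ ∀ v ∈ V, |(A v v).im| ≤ β * (A v v).re}.Nonempty := by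
    -- Continuity divided by ellipticity gives an admissible `β`; the absolute value is there
    -- because `c₁` has no assumed sign.
    refine ⟨|c₁| / c₀, by positivity, fun v hv => ?_⟩
    have h1 := hcont v hv v hv
    rw [mul_assoc, Real.mul_self_sqrt (h1NormSq_nonneg v)] at h1
    have h2 := mul_le_mul_of_nonneg_left (hell v hv) (by positivity : 0 ≤ |c₁| / c₀)
    calc |(A v v).im| ≤ ‖A v v‖ := Complex.abs_im_le_norm _
      _ ≤ c₁ * h1NormSq Ω v := h1
      _ ≤ |c₁| * h1NormSq Ω v :=
        mul_le_mul_of_nonneg_right (le_abs_self _) (h1NormSq_nonneg v)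
      _ = |c₁| / c₀ * (c₀ * h1NormSq Ω v) := by field_simp
      _ ≤ _ := h2
  have hcl : IsClosed {β | 0 ≤ β ∧ ∀ v ∈ V, |(A v v).im| ≤ β * (A v v).re} := by
    simp only [Set.ofPred_and, Set.ofPred_forall]
    exact (isClosed_le continuous_const continuous_id).inter
      (isClosed_biInter fun v _ => isClosed_le continuous_const (by fun_prop))
  exact hcl.csInf_mem hne ⟨0, fun _ h => h.1⟩

theorem mainTheorem3 (α : ℝ) (hα₀ : 0 < α) (hα₁ : α < 1) :
    -- `K₁ = C(α)` and `K₂ = c` depend on `α` only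
    ∃ K₁ K₂ : ℝ, ∀ c₀ : ℝ, 0 < c₀ →
    -- `K₃` and `K₄` (the constants `c'` and `C'`) depend on `α` and `c₀` only
    ∃ K₃ K₄ : ℝ,
    ∀ (d : ℕ) (_ : 1 ≤ d) (Ω ΓD : Set (EuclideanSpace ℝ (Fin d)))
      (_ : IsOpen Ω) (_ : Bornology.IsBounded Ω) (_ : ΓD ⊆ frontier Ω)
      (C : EuclideanSpace ℝ (Fin d) → Matrix (Fin d) (Fin d) ℂ)
      (a : EuclideanSpace ℝ (Fin d) → Fin d → ℂ) (r : EuclideanSpace ℝ (Fin d) → ℂ)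
      -- the form is well defined, strongly elliptic and continuous on `V`
      (_ : ∀ w ∈ dirichletSpace Ω ΓD, ∀ v ∈ dirichletSpace Ω ΓD,
        MeasureTheory.IntegrableOn (formIntegrand Ω C a r w v) Ω)
      (_ : IsStronglyElliptic (dirichletSpace Ω ΓD) (form Ω C a r) c₀)
      (c₁ : ℝ) (_ : IsContinuousForm (dirichletSpace Ω ΓD) (form Ω C a r) c₁)
      (β : ℝ) (_ : β = formIndex (dirichletSpace Ω ΓD) (form Ω C a r))
      -- a finite-dimensional subspace `V_h` of `V`, and the discrete operator on it
      (Vh : Submodule ℂ (L2 Ω)) (_ : FiniteDimensional ℂ Vh)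
      (_ : ∀ v ∈ Vh, v ∈ dirichletSpace Ω ΓD)
      (Ah : Vh →L[ℂ] Vh) (_ : IsDiscreteOperator (form Ω C a r) Vh Ah)
      (z₀ : ℂ) (R : ℝ) (_ : IsContourFor Ah z₀ R)
      (b : ℝ) (_ : 1 ≤ b) (fh : Vh)
      (τ : ℝ) (_ : 0 < τ) (_ : τ < Real.pi - Real.arctan β) (M N : ℕ),
      ‖semidiscrete α b Ah z₀ R fh - quadSum α b Ah fh τ M N‖
        ≤ (K₁ / b * quadFactor α β τ * Real.exp (-(2 * Real.pi * kappaMin α β / τ))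
            + K₂ * Real.exp (-(N * τ))
            + K₃ * (b ^ 2)⁻¹ * Real.exp (-((1 + α⁻¹) * M * τ))) * ‖fh‖
      ∧ (0 < balancedM α β b τ → |(M : ℝ) - balancedM α β b τ| ≤ 1 →
          |(N : ℝ) - balancedN α β b τ| ≤ 1 →
          ‖semidiscrete α b Ah z₀ R fh - quadSum α b Ah fh τ M N‖
            ≤ K₄ * quadFactor α β τ / b
                * Real.exp (-√(Real.pi * kappaMin α β * ((1 + α⁻¹) * M + N))) * ‖fh‖) := by
  obtain ⟨K, hK0, hK⟩ := exists_norm_integral_sub_tsum_resolventIntegrand_le hα₀ hα₁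
  have hc := abs_cos_pi_mul_lt_one hα₀ hα₁
  have hc0 : 0 < (1 - |Real.cos (π * α)|)⁻¹ := inv_pos.2 (by linarith)
  set c := (1 - |Real.cos (π * α)|)⁻¹ with hcd
  have hs0 : 0 < Real.sin (π * α) / (α * π) :=
    div_pos (Real.sin_pos_of_pos_of_lt_pi (by positivity) (by nlinarith [Real.pi_pos]))
      (by positivity)
  set s := Real.sin (π * α) / (α * π) with hsd
  refine ⟨s * K, s * c, fun c₀ hc₀ => ⟨s * (c * c₀⁻¹),
    (s * K + s * c * Real.exp π + s * (c * c₀⁻¹) * Real.exp ((1 + α⁻¹) * π)) *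
      Real.exp (π * (2 + α⁻¹)), ?_⟩⟩
  intro d _ Ω ΓD _ _ _ C a r _ hell c₁ hcont β hβ Vh hfin hVh Ah hAh z₀ R hcontour b hb fh τ hτ
    hτ2 M N
  obtain ⟨hβ0, hβim⟩ := formIndex_spec hc₀ hell hcont
  rw [← hβ] at hβ0 hβim
  -- Coercivity passes to `L²` with the same constant, the `H¹` norm being the larger one.
  have hre : ∀ v : Vh, c₀ * ‖v‖ ^ 2 ≤ (inner ℂ v (Ah v)).re := by
    intro v
    rw [hAh v v]
    refine le_trans (mul_le_mul_of_nonneg_left ?_ hc₀.le) (hell v (hVh v v.2))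
    exact le_add_of_nonneg_right (Finset.sum_nonneg fun _ _ => sq_nonneg _)
  have hre0 : ∀ v : Vh, 0 ≤ (inner ℂ v (Ah v)).re := fun v => le_trans (by positivity) (hre v)
  have him : ∀ v : Vh, |(inner ℂ v (Ah v)).im| ≤ β * (inner ℂ v (Ah v)).re := by
    intro v
    rw [hAh v v]
    exact hβim v (hVh v v.2)
  have hmain : ‖semidiscrete α b Ah z₀ R fh - quadSum α b Ah fh τ M N‖
        ≤ (s * K / b * quadFactor α β τ * Real.exp (-(2 * π * kappaMin α β / τ))
            + s * c * Real.exp (-(N * τ))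
            + s * (c * c₀⁻¹) * (b ^ 2)⁻¹ * Real.exp (-((1 + α⁻¹) * M * τ))) * ‖fh‖ := by
    -- On the zero space the spectrum is empty and `R` need not be positive, but both sides vanish.
    -- Otherwise a point of the spectrum in the ball forces `R > 0`.
    rcases subsingleton_or_nontrivial Vh with hsub | hnt
    · rw [Subsingleton.elim (_ - _) (0 : Vh), Subsingleton.elim fh 0]
      simp
    have : CompleteSpace Vh := FiniteDimensional.complete ℂ Vh
    have hR : 0 < R := by
      obtain ⟨z, hz⟩ := spectrum.nonempty Ah
      exact dist_nonneg.trans_lt (hcontour.1 hz)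
    have hb0 : 0 < b := by linarith
    rw [semidiscrete_eq_integral hα₀ hα₁ hb hβ0 hre0 him hR hcontour, quadSum_eq, ← smul_sub,
      norm_smul, Complex.norm_real, Real.norm_of_nonneg hs0.le]
    have e1 := hK Ah β b τ hβ0 hb hre0 him hτ hτ2 fh
    have e2 := norm_tsum_sub_sum_Icc_le (summable_resolventIntegrand hα₀ hα₁ hb hre0 hτ fh)
      (A := c * ‖fh‖) (B := c * c₀⁻¹ * (b ^ 2)⁻¹ * ‖fh‖) (γ := 1 + α⁻¹)
      (by have := inv_pos.2 hα₀; linarith) hτ (by positivity) (by positivity)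
      (fun n => by
        have := norm_resolventIntegrand_le_exp_neg hα₀ hα₁ hb hre0 fh (n * τ)
        simpa using this)
      (fun n => by
        have := norm_resolventIntegrand_le_exp hα₀ hα₁ hb hc₀ hre fh (n * τ)
        simpa using this) M N
    refine (mul_le_mul_of_nonneg_left ((norm_sub_le_norm_sub_add_norm_sub _ _ _).trans
      (add_le_add e1 e2)) hs0.le).trans_eq ?_
    ring
  refine ⟨hmain, fun hM0 hM hN => hmain.trans (mul_le_mul_of_nonneg_right ?_ (norm_nonneg _))⟩
  have hτπ : τ < π := by linarith [Real.arctan_nonneg.2 hβ0]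
  exact balanced_error_le hα₀ hα₁ hb hτ hτπ (by positivity) (by positivity) (by positivity)
    hM0 hM hN
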